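/- Let $h>0$, $u_0>0$, $z_0\in\mathbb R$. For $u>0$, $z\in\mathbb C$ and $w\in\mathbb C$ put (with principal powers) $$\xi=\xi(u,z)=\frac{2uu_0}{u^2+u_0^2+(z-z_0)^2},\qquad G_k(u,z)=\Big(\frac{\xi}{2}\Big)^{k}{}_2F_1\Big(\frac k2,\frac k2+\frac12;k+\frac12;\xi^2\Big),$$ $$c_h=\frac{-2i}{4^{h}}\frac{\Gamma(2h)}{\Gamma(h)^2},\qquad \widehat G_h(u,z,w)=c_h\Big(\frac{u_0}{u_0^2+(z_0-w)^2}\Big)^{1-h}\Big(\frac{u}{u^2+(z-w)^2}\Big)^{h},$$ $$\widetilde G_h(u,z)=c_h\Big(4^{h}\frac{\Gamma(1-2h)}{\Gamma(1-h)^2}\,G_h(u,z)+4^{1-h}\frac{\Gamma(2h-1)}{\Gamma(h)^2}\,G_{1-h}(u,z)\Big),$$ where for $h\in\{\frac12,\frac32,\frac52,\dots\}$ the last expression is understood as its limit in $h$. For $w=z_0+it$, $|t|\le u_0$, and $\varepsilon>0$ let $C(\varepsilon)=C_w(\varepsilon)$ be the $\Pi$-shaped contour made of the segments $z_0-\varepsilon\to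 w-\varepsilon\to w+\varepsilon\to z_0+\varepsilon$. Let $\varepsilon_0>0$, let $R=\{z:|\mathrm{Re}\,z-z_0|\le\varepsilon_0,\ |\mathrm{Im}\,z|\le u_0\}$ (the union of these contours for $0<\varepsilon\le\varepsilon_0$), and let $f(u,z)$ be holomorphic on an open set of $\mathbb C^2$ containing $(0,\infty)\times R$. Assume that, uniformly in $z\in R$, $u^{-h}f(u,z)=O(u^{\delta})$ as $u\to0^+$ for some $\delta>\max(0,1-2h)$ (in particular $u^{-h}f\to0$), and that $|f(u,z)|\le M(u)$ for $u>1$, $z\in R$, where $\int_1^\infty u^{-h-2}M(u)\,du<\infty$. Then the integrals below converge (those on the left for every $0<\varepsilon\le\varepsilon_0$), and $$\lim_{\varepsilon\to0^+}\int_{z_0-iu_0}^{z_0+iu_0}dw\int_0^\infty\frac{du}{u^2}\int_{C_w(\varepsilon)}dz\,\widehat G_h(u,z,w)f(u,z)=\pi\int_0^{u_0}\frac{du}{u^2}\int_{z_0-i(u_0-u)}^{z_0+i(u_0-u)}dz\,\widetilde G_h(u,z)f(u,z).$$ -/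

import Mathlib

open MeasureTheory Set Filter Topology

noncomputable section

namespace AdS

/-- The complex line integral of `g` along the straight segment from `a` to `b`. -/
def segInt (g : ℂ → ℂ) (a b : ℂ) : ℂ :=
  (b - a) * ∫ s in (0 : ℝ)..1, g (a + (s : ℂ) * (b - a))

/-- Integrability of `g` along the straight segment from `a` to `b`. -/
def SegIntegrable (g : ℂ → ℂ) (a b : ℂ) : Prop :=
  IntervalIntegrable (fun s : ℝ => g (a + (s : ℂ) * (b - a))) volume 0 1

/-- The integral of `g` along the `Π`-shaped contour of half-width `ε` that leaves the real axis at
`z₀ - ε`, runs vertically to `w - ε`, horizontally to `w + ε` and vertically to `z₀ + ε`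
(here `z₀` is real and `Re w = z₀`). -/
def piContourInt (z₀ : ℝ) (w : ℂ) (ε : ℝ) (g : ℂ → ℂ) : ℂ :=
  segInt g (z₀ - ε) (w - ε) + segInt g (w - ε) (w + ε) + segInt g (w + ε) (z₀ + ε)

/-- The closed rectangle swept out by the `Π`-shaped contours of half-width at most `ε₀`, when `w`
runs through the segment from `z₀ - i u₀` to `z₀ + i u₀`. -/
def rect (u₀ z₀ ε₀ : ℝ) : Set ℂ :=
  {z | |z.re - z₀| ≤ ε₀ ∧ |z.im| ≤ u₀}

/-- The invariant `ξ = 2 u u' / (u² + u'² + (z - z')²)`. -/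
def xi (u : ℝ) (z : ℂ) (u' : ℝ) (z' : ℂ) : ℂ :=
  2 * u * u' / ((u : ℂ) ^ 2 + (u' : ℂ) ^ 2 + (z - z') ^ 2)

/-- The bulk-to-bulk propagator `G_h = (ξ/2)^h ₂F₁(h/2, h/2 + 1/2; h + 1/2; ξ²)`, with the principal
power and with `₂F₁` the sum of the hypergeometric series (so it is meant for `|ξ| < 1`; on the
triangle `0 < u < u'`, `z = z' + i v`, `|v| < u' - u`, one has `0 < ξ < 1`). -/
def G (h : ℝ) (u : ℝ) (z : ℂ) (u' : ℝ) (z' : ℂ) : ℂ :=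
  (xi u z u' z' / 2) ^ (h : ℂ) *
    ordinaryHypergeometric ((h : ℂ) / 2) ((h : ℂ) / 2 + 1 / 2) ((h : ℂ) + 1 / 2)
      (xi u z u' z' ^ 2)

/-- The constant `(-2i / 4^h) Γ(2h) / (Γ(h) Γ(h))`. -/
def propConst (h : ℝ) : ℂ :=
  -2 * Complex.I / (4 : ℂ) ^ (h : ℂ) *
    (Complex.Gamma (2 * h) / (Complex.Gamma h * Complex.Gamma h))

/-- The modified propagator `Ĝ_h(x, x', w)`, with principal powers. -/
def Ghat (h : ℝ) (u : ℝ) (z : ℂ) (u' : ℝ) (z' : ℂ) (w : ℂ) : ℂ :=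
  propConst h * ((u' : ℂ) / ((u' : ℂ) ^ 2 + (z' - w) ^ 2)) ^ (1 - (h : ℂ)) *
    ((u : ℂ) / ((u : ℂ) ^ 2 + (z - w) ^ 2)) ^ (h : ℂ)

/-- The combination of `G_h` and `G_{1-h}` that defines the modified propagator, away from
`h = 1/2, 3/2, 5/2, …`. At `h = 1, 2, 3, …` the value `0` of Mathlib's Gamma function at its poles
makes the first summand `0`, which is its true value: `Γ(1 - 2h)` has a simple pole there and
`1 / Γ(1 - h)²` a double zero. -/
def GtildeGeneric (h : ℝ) (u : ℝ) (z : ℂ) (u' : ℝ) (z' : ℂ) : ℂ :=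
  propConst h *
    ((4 : ℂ) ^ (h : ℂ) * (Complex.Gamma (1 - 2 * h) / Complex.Gamma (1 - h) ^ 2) * G h u z u' z' +
      (4 : ℂ) ^ (1 - (h : ℂ)) * (Complex.Gamma (2 * h - 1) / Complex.Gamma h ^ 2) *
        G (1 - h) u z u' z')

open Classical in
/-- The modified propagator `G̃_h(x, x')`. For `h = 1/2, 3/2, 5/2, …` the two summands have poles in
`h` that cancel each other, and the combination is understood as its limit. -/
def Gtilde (h : ℝ) (u : ℝ) (z : ℂ) (u' : ℝ) (z' : ℂ) : ℂ :=
  if ∃ n : ℕ, h = n + 1 / 2 then limUnder (𝓝[≠] h) (fun k : ℝ => GtildeGeneric k u z u' z')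
  else GtildeGeneric h u z u' z'

/-- The inner integrand in `u`, i.e. `u⁻²` times the integral of `Ĝ_h f` over the `Π`-shaped
contour. -/
def contourTerm (h : ℝ) (u₀ z₀ : ℝ) (f : ℂ × ℂ → ℂ) (ε : ℝ) (w : ℂ) (u : ℝ) : ℂ :=
  1 / (u : ℂ) ^ 2 * piContourInt z₀ w ε (fun z => Ghat h u z u₀ z₀ w * f (u, z))

end AdS

end

/-! ### Primitives of holomorphic functions and their limits along paths. -/

noncomputable section

/-! Put w = z₀ + it, z = z₀ + e + iy and s = t - y. By `Ghat_eq_kern`, Ĝ_h is then a constant times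
u^h times `kern`, a function of s that is analytic off cuts issuing from the branch points S = u₀ -
y, -b = -(u₀ + y) and ±u - ie. The reflection z ↦ 2z₀ - z exchanges the halves t > 0 and t < 0 of
the outer integral, so it suffices to treat t > 0. There the Π-contour contributes two vertical
sides e = ±ε, run through in opposite directions, and a horizontal side of length 2ε.

The horizontal side is dominated by |x|^(-a) for some a < 1, so its contribution vanishes in the
limit (`Controlled.tendsto_horiz`). On a vertical side Fubini lets the w-integral be done first: for
fixed (u, y) the variable s runs from 0 to S. The branch point near the path is u - ie, on the side
opposite to e, so the path can be moved to an arc on the side of e (`integral_kern_shift`). On the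
arcs there is a bound uniform in e, integrable in (u, y, τ) (`exists_kern_arcPath_le`,
`integrable_arc_bound`), and dominated convergence gives the limit ε → 0
(`Controlled.tendsto_integral_arcTerm`). What remains is the integral over the upper arc minus that
over the lower arc at e = 0.

If u > S, nothing singular lies between the arcs and the difference vanishes
(`integral_kern_eq_of_lt`). This is why only the triangle survives. If u < S, the difference is the
integral over a path from S back to S around the branch point u. Taking for it the circle of
Apollonius of u and -u through S, parametrized by a Möbius map, turns the integrand into (x +
iv)^(h-1) (1 + v²)^(-h) with x = 1/ξ (`kern_mobiusPath`, `integral_kern_sub`). Its integral over the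
real line is `mehlerInt`.

It remains to recognize `mehlerInt` as a multiple of the combination of G_h and G_{1-h}. As
functions of x all three solve the same Legendre equation, and Wronskians determine the linear
relation: the one of G_h and G_{1-h} is read off at x → ∞, the other two at x → 1, where `mehlerInt`
is regular and the series are logarithmic (`mehlerInt_connection`). The value at x = 1 comes from
the mean value property on the unit disc (`mehlerInt_one`), and Legendre's duplication formula puts
the constants in the stated form (`legendreFn_eq`). Half-integral h follow by continuity in h
(`Gtilde_eq`). -/

/-- A holomorphic function on an open set that is star-shaped about `0` has a primitive. -/
theorem StarConvex.exists_hasDerivAt_of_differentiableOn {U : Set ℂ} (hU : IsOpen U)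
    (hs : StarConvex ℝ 0 U) {g : ℂ → ℂ} (hg : DifferentiableOn ℂ g U) :
    ∃ F : ℂ → ℂ, ∀ z ∈ U, HasDerivAt F (g z) z := by
  refine ⟨fun z => ∫ t in (0 : ℝ)..1, g (t * z) * z, fun z hz => ?_⟩
  have hmem : ∀ w ∈ U, ∀ t ∈ Icc (0 : ℝ) 1, (t : ℂ) * w ∈ U := fun w hw t ht => by
    have := hs.smul_mem hw ht.1 ht.2
    rwa [Complex.real_smul] at this
  have hg' : DifferentiableOn ℂ (deriv g) U := hg.deriv hU
  have hseg : IsCompact ((fun t : ℝ => (t : ℂ) * z) '' Icc 0 1) :=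
    isCompact_Icc.image (by fun_prop)
  -- A closed thickening of the segment from 0 to z contains the segments from 0 to all nearby w,
  -- since tw is within r of tz. Compactness then bounds g and g' for all these w at once.
  obtain ⟨r, hr, hrU⟩ := hseg.exists_cthickening_subset_open hU (by
    rintro _ ⟨t, ht, rfl⟩; exact hmem z hz t ht)
  set Kc := Metric.cthickening r ((fun t : ℝ => (t : ℂ) * z) '' Icc 0 1) with hKc
  have hKcomp : IsCompact Kc := hseg.cthickening
  have hin : ∀ w ∈ Metric.ball z r, ∀ t ∈ Icc (0 : ℝ) 1, (t : ℂ) * w ∈ Kc := by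
    intro w hw t ht
    refine Metric.mem_cthickening_of_dist_le _ ((t : ℂ) * z) _ _ ⟨t, ht, rfl⟩ ?_
    rw [dist_eq_norm, ← mul_sub, norm_mul, Complex.norm_real, Real.norm_of_nonneg ht.1]
    have : ‖w - z‖ ≤ r := by rw [← dist_eq_norm]; exact (Metric.mem_ball.1 hw).le
    nlinarith [ht.1, ht.2, norm_nonneg (w - z)]
  obtain ⟨A, hA⟩ := hKcomp.exists_bound_of_continuousOn (hg.continuousOn.mono hrU)
  obtain ⟨B, hB⟩ := hKcomp.exists_bound_of_continuousOn (hg'.continuousOn.mono hrU)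
  have hcont : ∀ w ∈ Metric.ball z r, ContinuousOn (fun t : ℝ => g (t * w)) (Icc 0 1) :=
    fun w hw => hg.continuousOn.comp (by fun_prop) fun t ht => hrU (hin w hw t ht)
  have hcont' : ∀ w ∈ Metric.ball z r, ContinuousOn (fun t : ℝ => deriv g (t * w)) (Icc 0 1) :=
    fun w hw => hg'.continuousOn.comp (by fun_prop) fun t ht => hrU (hin w hw t ht)
  have hzb : z ∈ Metric.ball z r := Metric.mem_ball_self hr
  have hint : IntervalIntegrable (fun t : ℝ => g (t * z) + t * z * deriv g (t * z))
      volume 0 1 := by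
    apply ContinuousOn.intervalIntegrable
    rw [uIcc_of_le zero_le_one]
    exact (hcont z hzb).add ((by fun_prop : ContinuousOn (fun t : ℝ => (t : ℂ) * z) _).mul
      (hcont' z hzb))
  have key := (intervalIntegral.hasDerivAt_integral_of_dominated_loc_of_deriv_le
    (F := fun w (t : ℝ) => g (t * w) * w)
    (F' := fun w (t : ℝ) => g (t * w) + t * w * deriv g (t * w))
    (x₀ := z) (s := Metric.ball z r) (a := (0 : ℝ)) (b := 1) (μ := volume)
    (bound := fun _ => A + (‖z‖ + r) * B) (Metric.ball_mem_nhds z hr) ?_ ?_ ?_ ?_ ?_ ?_).2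
  · refine key.congr_deriv ?_
    -- The z-derivative of the integrand, g(tz) + tz g'(tz), is also the t-derivative of t g(tz), so
    -- its integral is g(z).
    have : ∀ t ∈ uIcc (0 : ℝ) 1, HasDerivAt (fun t : ℝ => (t : ℂ) * g (t * z))
        (g (t * z) + t * z * deriv g (t * z)) t := by
      intro t ht
      rw [uIcc_of_le zero_le_one] at ht
      have h1 : HasDerivAt (fun t : ℝ => (t : ℂ)) 1 t := Complex.ofRealCLM.hasDerivAt
      have h2 : HasDerivAt g (deriv g (t * z)) ((t : ℂ) * z) :=
        (hg.differentiableAt (hU.mem_nhds (hmem z hz t ht))).hasDerivAt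
      have h3 := h1.mul (h2.comp t (h1.mul_const z))
      refine h3.congr_deriv ?_
      simp only [Function.comp]; ring
    rw [intervalIntegral.integral_eq_sub_of_hasDerivAt this hint]
    simp
  · filter_upwards [Metric.ball_mem_nhds z hr] with w hw
    apply ContinuousOn.aestronglyMeasurable _ measurableSet_uIoc
    rw [uIoc_of_le zero_le_one]
    exact ((hcont w hw).mul continuousOn_const).mono Ioc_subset_Icc_self
  · apply ContinuousOn.intervalIntegrable
    rw [uIcc_of_le zero_le_one]
    exact (hcont z hzb).mul continuousOn_const
  · exact (intervalIntegrable_iff.1 hint).aestronglyMeasurable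
  · refine Eventually.of_forall fun t ht w hw => ?_
    rw [uIoc_of_le zero_le_one] at ht
    have ht' := Ioc_subset_Icc_self ht
    have hw' : ‖w‖ ≤ ‖z‖ + r := by
      have : ‖w - z‖ ≤ r := by rw [← dist_eq_norm]; exact (Metric.mem_ball.1 hw).le
      calc ‖w‖ = ‖z + (w - z)‖ := by ring_nf
        _ ≤ _ := (norm_add_le _ _).trans (by gcongr)
    have h1 := hA _ (hin w hw t ht')
    have h2 := hB _ (hin w hw t ht')
    refine (norm_add_le _ _).trans (add_le_add h1 ?_)
    rw [norm_mul, norm_mul, Complex.norm_real, Real.norm_of_nonneg ht'.1]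
    gcongr
    nlinarith [ht'.1, ht'.2, norm_nonneg w]
  · exact intervalIntegrable_const
  · refine Eventually.of_forall fun t ht w hw => ?_
    rw [uIoc_of_le zero_le_one] at ht
    have h2 : HasDerivAt g (deriv g (t * w)) ((t : ℂ) * w) :=
      (hg.differentiableAt (hU.mem_nhds (hrU (hin w hw t (Ioc_subset_Icc_self ht))))).hasDerivAt
    have h3 := (h2.comp w ((hasDerivAt_id w).const_mul (t : ℂ))).mul (hasDerivAt_id w)
    refine h3.congr_deriv ?_
    simp; ring

/-- Along a path in the domain of a primitive `F` of `g`, the values of `F` tend to the path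
integral of `g` as the parameter tends to its endpoint. -/
theorem tendsto_primitive_comp_path {U : Set ℂ} {g F : ℂ → ℂ}
    (hF : ∀ z ∈ U, HasDerivAt F (g z) z) {γ γ' : ℝ → ℂ}
    (hγ : ∀ τ ∈ Ico (0 : ℝ) 1, HasDerivAt γ (γ' τ) τ) (hU : ∀ τ ∈ Ico (0 : ℝ) 1, γ τ ∈ U)
    (hint : IntegrableOn (fun τ => g (γ τ) * γ' τ) (Ioo 0 1)) :
    Tendsto (fun τ => F (γ τ)) (𝓝[<] 1)
      (𝓝 (F (γ 0) + ∫ τ in Ioo (0 : ℝ) 1, g (γ τ) * γ' τ)) := by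
  have hint' : IntervalIntegrable (fun τ => g (γ τ) * γ' τ) volume 0 1 := by
    rw [intervalIntegrable_iff_integrableOn_Ioo_of_le zero_le_one]; exact hint
  have h1 : ∀ τ ∈ Ioo (0 : ℝ) 1, F (γ τ) = F (γ 0) + ∫ t in (0 : ℝ)..τ, g (γ t) * γ' t := by
    intro τ hτ
    rw [intervalIntegral.integral_eq_sub_of_hasDerivAt (f := fun t => F (γ t))]
    · ring
    · intro t ht
      rw [uIcc_of_le hτ.1.le] at ht
      have ht' : t ∈ Ico (0 : ℝ) 1 := ⟨ht.1, ht.2.trans_lt hτ.2⟩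
      have := (hF _ (hU t ht')).scomp t (hγ t ht')
      refine this.congr_deriv ?_
      simp [mul_comm]
    · exact hint'.mono_set (by
        rw [uIcc_of_le hτ.1.le, uIcc_of_le zero_le_one]
        exact Icc_subset_Icc_right hτ.2.le)
  have h2 : Tendsto (fun τ => F (γ 0) + ∫ t in (0 : ℝ)..τ, g (γ t) * γ' t) (𝓝[<] 1)
      (𝓝 (F (γ 0) + ∫ t in (0 : ℝ)..1, g (γ t) * γ' t)) := by
    refine tendsto_const_nhds.add ?_
    have hc := intervalIntegral.continuousOn_primitive_interval (a := (0 : ℝ)) (b := 1)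
      (f := fun τ => g (γ τ) * γ' τ) (μ := volume) (by
        rw [uIcc_of_le zero_le_one, integrableOn_Icc_iff_integrableOn_Ioo]; exact hint)
    have := hc 1 (by simp)
    refine this.mono_left ?_
    rw [uIcc_of_le zero_le_one]
    exact nhdsWithin_le_of_mem (mem_of_superset (Ioo_mem_nhdsLT zero_lt_one) Ioo_subset_Icc_self)
  rw [intervalIntegral.integral_of_le zero_le_one, integral_Ioc_eq_integral_Ioo] at h2
  refine h2.congr' ?_
  filter_upwards [Ioo_mem_nhdsLT (zero_lt_one : (0 : ℝ) < 1)] with τ hτ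
  exact (h1 τ hτ).symm

/-- If `g = O(η ^ (h - 1))` on the segment between `z₁` and `z₂`, where `z₁ - z₂ = O(η)`, then the
difference of the values of a primitive of `g` at `z₁` and `z₂` tends to `0` with `η`. -/
theorem tendsto_primitive_sub {ι : Type*} {l : Filter ι} {U : Set ℂ} {g F : ℂ → ℂ}
    (hF : ∀ z ∈ U, HasDerivAt F (g z) z) {z₁ z₂ : ι → ℂ} {η : ι → ℝ} {h A B : ℝ} (hh : 0 < h)
    (hη : Tendsto η l (𝓝[>] 0))
    (hseg : ∀ᶠ i in l, ∀ ζ ∈ segment ℝ (z₁ i) (z₂ i), ζ ∈ U ∧ ‖g ζ‖ ≤ A * η i ^ (h - 1))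
    (hdist : ∀ᶠ i in l, ‖z₂ i - z₁ i‖ ≤ B * η i) :
    Tendsto (fun i => F (z₂ i) - F (z₁ i)) l (𝓝 0) := by
  -- Derivative bound A η^(h-1) times distance B η gives A B η^h. This is the point where h > 0
  -- makes an endpoint singularity harmless.
  have h0 : Tendsto (fun i => A * B * η i ^ h) l (𝓝 0) := by
    have : Tendsto (fun x : ℝ => x ^ h) (𝓝[>] 0) (𝓝 0) := by
      have := (Real.continuousAt_rpow_const 0 h (Or.inr hh.le)).tendsto
      rw [Real.zero_rpow hh.ne'] at this
      exact this.mono_left nhdsWithin_le_nhds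
    simpa using (this.comp hη).const_mul (A * B)
  refine squeeze_zero_norm' ?_ h0
  filter_upwards [hseg, hdist, hη.eventually self_mem_nhdsWithin] with i h1 h2 h3
  have h3' : 0 < η i := h3
  have hA : 0 ≤ A * η i ^ (h - 1) := (norm_nonneg _).trans (h1 _ (left_mem_segment ℝ _ _)).2
  have := (convex_segment (𝕜 := ℝ) (z₁ i) (z₂ i)).norm_image_sub_le_of_norm_hasDerivWithin_le
    (f := F) (f' := g) (fun ζ hζ => (hF ζ (h1 ζ hζ).1).hasDerivWithinAt)
    (fun ζ hζ => (h1 ζ hζ).2) (left_mem_segment ℝ _ _) (right_mem_segment ℝ _ _)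
  calc _ ≤ A * η i ^ (h - 1) * ‖z₂ i - z₁ i‖ := this
    _ ≤ A * η i ^ (h - 1) * (B * η i) := by gcongr
    _ = A * B * (η i ^ (h - 1) * η i) := by ring
    _ = _ := by rw [← Real.rpow_add_one h3'.ne']; ring_nf

/-! ### The Mehler-type integral and its Legendre equation. -/

namespace AdS

/-- The integrand `(x + i v) ^ α (1 + v²) ^ (-h)`. -/
def mehlerKernel (α h x v : ℝ) : ℂ :=
  ((x : ℂ) + v * Complex.I) ^ (α : ℂ) * ((1 + v ^ 2) ^ (-h) : ℝ)

/-- The integral of `(x + i v) ^ α (1 + v²) ^ (-h)` over the real line. -/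
def mehlerInt (α h x : ℝ) : ℂ := ∫ v : ℝ, mehlerKernel α h x v

theorem normSq_add_mul_I (x v : ℝ) : ‖(x : ℂ) + v * Complex.I‖ = √(x ^ 2 + v ^ 2) := by
  rw [Complex.norm_add_mul_I]

theorem norm_mehlerKernel (α h x v : ℝ) :
    ‖mehlerKernel α h x v‖ = (x ^ 2 + v ^ 2) ^ (α / 2) * (1 + v ^ 2) ^ (-h) := by
  have h1 : (0 : ℝ) ≤ x ^ 2 + v ^ 2 := by positivity
  rw [mehlerKernel, norm_mul, Complex.norm_cpow_real, normSq_add_mul_I, Complex.norm_real,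
    Real.norm_of_nonneg (by positivity), Real.sqrt_eq_rpow, ← Real.rpow_mul h1]
  ring_nf

/-- A power is monotone in its base, increasing or decreasing with the sign of β. The sum of both
end values serves either case and spares later estimates a distinction according to the sign of h -
1. -/
theorem rpow_le_add_rpow {m M r : ℝ} (hm : 0 < m) (hmr : m ≤ r) (hrM : r ≤ M) (β : ℝ) :
    r ^ β ≤ m ^ β + M ^ β := by
  rcases le_total 0 β with hβ | hβ
  · have := Real.rpow_le_rpow (hm.le.trans hmr) hrM hβ
    have := Real.rpow_nonneg hm.le β
    linarith
  · have := Real.rpow_le_rpow_of_nonpos hm hmr hβ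
    have := Real.rpow_nonneg (hm.le.trans (hmr.trans hrM)) β
    linarith

/-- The quotient (x² + v²)/(1 + v²) stays in [m², M²], so the kernel decays like |v|^(α - 2h),
uniformly for x in a compact interval. -/
theorem norm_mehlerKernel_le {m M : ℝ} (hm : 0 < m) (hm1 : m ≤ 1) (hM : 1 ≤ M) (α h : ℝ)
    {x : ℝ} (hx : x ∈ Icc m M) (v : ℝ) :
    ‖mehlerKernel α h x v‖ ≤
      ((m ^ 2) ^ (α / 2) + (M ^ 2) ^ (α / 2)) * (1 + ‖v‖ ^ 2) ^ (-(2 * h - α) / 2) := by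
  have hv : 0 < 1 + v ^ 2 := by positivity
  have hx0 : 0 < x := hm.trans_le hx.1
  rw [norm_mehlerKernel, Real.norm_eq_abs, sq_abs]
  have e : x ^ 2 + v ^ 2 = ((x ^ 2 + v ^ 2) / (1 + v ^ 2)) * (1 + v ^ 2) := by field_simp
  have hr1 : m ^ 2 ≤ (x ^ 2 + v ^ 2) / (1 + v ^ 2) := by
    rw [le_div_iff₀ hv]
    have : m ^ 2 ≤ x ^ 2 := by gcongr; exact hx.1
    have : m ^ 2 ≤ 1 := by nlinarith
    nlinarith [sq_nonneg v]
  have hr2 : (x ^ 2 + v ^ 2) / (1 + v ^ 2) ≤ M ^ 2 := by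
    rw [div_le_iff₀ hv]
    have : x ^ 2 ≤ M ^ 2 := by gcongr; exact hx.2
    have : 1 ≤ M ^ 2 := by nlinarith
    nlinarith [sq_nonneg v]
  rw [e, Real.mul_rpow (by positivity) hv.le, mul_assoc, ← Real.rpow_add hv]
  have e2 : α / 2 + -h = -(2 * h - α) / 2 := by ring
  rw [e2]
  gcongr
  exact rpow_le_add_rpow (by positivity) hr1 hr2 _

theorem integrable_one_add_sq_rpow {r : ℝ} (hr : 1 < r) :
    Integrable fun v : ℝ => (1 + ‖v‖ ^ 2) ^ (-r / 2) :=
  integrable_rpow_neg_one_add_norm_sq (by simpa using hr)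

theorem add_mul_I_mem_slitPlane {x : ℝ} (hx : 0 < x) (v : ℝ) :
    (x : ℂ) + v * Complex.I ∈ Complex.slitPlane := by
  left; simpa using hx

theorem continuous_mehlerKernel {x : ℝ} (hx : 0 < x) (α h : ℝ) :
    Continuous (mehlerKernel α h x) := by
  unfold mehlerKernel
  refine Continuous.mul ?_ ?_
  · exact Continuous.cpow (by fun_prop) continuous_const fun v => add_mul_I_mem_slitPlane hx v
  · exact Complex.continuous_ofReal.comp
      (Continuous.rpow_const (by fun_prop) fun v => Or.inl (by positivity))

theorem integrable_mehlerKernel {x : ℝ} (hx : 0 < x) {α h : ℝ} (hα : α + 1 < 2 * h) :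
    Integrable (mehlerKernel α h x) := by
  refine Integrable.mono' ((integrable_one_add_sq_rpow (r := 2 * h - α) (by linarith)).const_mul _)
    (continuous_mehlerKernel hx α h).aestronglyMeasurable
    (Eventually.of_forall fun v => norm_mehlerKernel_le (m := min x 1) (M := max x 1)
      (by positivity) (min_le_right _ _) (le_max_right _ _) α h
      ⟨min_le_left _ _, le_max_left _ _⟩ v)

theorem _root_.HasDerivAt.cpow_const_of_real {f : ℝ → ℂ} {f' : ℂ} {t : ℝ} (hf : HasDerivAt f f' t)
    {c : ℂ} (h0 : f t ∈ Complex.slitPlane) :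
    HasDerivAt (fun t => f t ^ c) (c * f t ^ (c - 1) * f') t := by
  have := ((hasDerivAt_id (f t)).cpow_const (c := c) h0).scomp t hf
  refine this.congr_deriv ?_
  simp [mul_comm]

/-- Differentiation under the integral lowers the exponent α by one and improves the decay. At x = 1
it also supplies the continuity used for the Wronskians there. -/
theorem hasDerivAt_mehlerInt {x : ℝ} (hx : 0 < x) {α h : ℝ} (hα : α + 1 < 2 * h) :
    HasDerivAt (mehlerInt α h) (α * mehlerInt (α - 1) h x) x := by
  have key := (hasDerivAt_integral_of_dominated_loc_of_deriv_le (μ := volume)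
    (F := fun y v => mehlerKernel α h y v)
    (F' := fun y v => (α : ℂ) * mehlerKernel (α - 1) h y v) (x₀ := x)
    (s := Ioo (x / 2) (x + 1)) (bound := fun v => |α| *
      (((min (x / 2) 1 ^ 2) ^ ((α - 1) / 2) + ((x + 1) ^ 2) ^ ((α - 1) / 2)) *
        (1 + ‖v‖ ^ 2) ^ (-(2 * h - (α - 1)) / 2)))
    (Ioo_mem_nhds (by linarith) (by linarith)) ?_ (integrable_mehlerKernel hx hα)
    ?_ ?_ ?_ ?_).2
  · refine key.congr_deriv ?_
    rw [integral_const_mul]; rfl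
  · filter_upwards [lt_mem_nhds hx] with y hy
    exact (continuous_mehlerKernel hy α h).aestronglyMeasurable
  · exact ((continuous_mehlerKernel hx (α - 1) h).const_smul (α : ℂ)).aestronglyMeasurable
  · refine Eventually.of_forall fun v y hy => ?_
    rw [norm_mul, Complex.norm_real, Real.norm_eq_abs]
    gcongr
    exact norm_mehlerKernel_le (by positivity) (min_le_right _ _) (by linarith) _ _
      ⟨(min_le_left _ _).trans hy.1.le, hy.2.le⟩ v
  · exact ((integrable_one_add_sq_rpow (by linarith)).const_mul _).const_mul _
  · refine Eventually.of_forall fun v y hy => ?_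
    have hy0 : 0 < y := by have := hy.1; linarith
    have h1 : HasDerivAt (fun y : ℝ => (y : ℂ) + v * Complex.I) 1 y :=
      (Complex.ofRealCLM.hasDerivAt (x := y)).add_const _
    have h2 := (h1.cpow_const_of_real (c := (α : ℂ)) (add_mul_I_mem_slitPlane hy0 v)).mul_const
      (((1 + v ^ 2) ^ (-h) : ℝ) : ℂ)
    refine h2.congr_deriv ?_
    simp only [mehlerKernel]; push_cast; ring

/-- `d/dv` of `(x + i v) ^ α (1 + v²) ^ (-h)`. -/
theorem hasDerivAt_mehlerKernel {x : ℝ} (hx : 0 < x) (α h v : ℝ) :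
    HasDerivAt (mehlerKernel α h x)
      (mehlerKernel (α - 1) (h + 1) x v *
        (α * Complex.I * (1 + v ^ 2) - 2 * h * v * (x + v * Complex.I))) v := by
  have hv : (0 : ℝ) < 1 + v ^ 2 := by positivity
  have h1 : HasDerivAt (fun v : ℝ => (x : ℂ) + v * Complex.I) Complex.I v := by
    simpa using ((Complex.ofRealCLM.hasDerivAt (x := v)).mul_const Complex.I).const_add (x : ℂ)
  have h2 := h1.cpow_const_of_real (c := (α : ℂ)) (add_mul_I_mem_slitPlane hx v)
  have h3 : HasDerivAt (fun v : ℝ => 1 + v ^ 2) (2 * v) v := by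
    simpa using (hasDerivAt_pow 2 v).const_add 1
  have h4 := (h3.rpow_const (p := -h) (Or.inl hv.ne')).ofReal_comp
  refine (h2.mul h4).congr_deriv ?_
  have hne : (x : ℂ) + v * Complex.I ≠ 0 := Complex.slitPlane_ne_zero (add_mul_I_mem_slitPlane hx v)
  have e1 : ((x : ℂ) + v * Complex.I) ^ (α : ℂ) =
      ((x : ℂ) + v * Complex.I) ^ ((α : ℂ) - 1) * (x + v * Complex.I) := by
    rw [Complex.cpow_sub _ _ hne, Complex.cpow_one, div_mul_cancel₀ _ hne]
  have e2 : (1 + v ^ 2) ^ (-h) = (1 + v ^ 2) ^ (-h - 1) * (1 + v ^ 2) := by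
    rw [← Real.rpow_add_one hv.ne']; ring_nf
  have e3 : -(h + 1) = -h - 1 := by ring
  simp only [mehlerKernel, e1, e2, e3]
  push_cast
  ring

theorem mehlerKernel_add_one {x : ℝ} (hx : 0 < x) (α h v : ℝ) :
    mehlerKernel (α + 1) h x v = mehlerKernel α h x v * (x + v * Complex.I) := by
  have hne : (x : ℂ) + v * Complex.I ≠ 0 := Complex.slitPlane_ne_zero (add_mul_I_mem_slitPlane hx v)
  simp only [mehlerKernel]; push_cast
  rw [Complex.cpow_add _ _ hne, Complex.cpow_one]; ring

theorem mehlerKernel_sub_one_right (α h x v : ℝ) :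
    mehlerKernel α h x v = mehlerKernel α (h + 1) x v * (1 + v ^ 2) := by
  have hv : (0 : ℝ) < 1 + v ^ 2 := by positivity
  have e2 : (1 + v ^ 2) ^ (-h) = (1 + v ^ 2) ^ (-(h + 1)) * (1 + v ^ 2) := by
    rw [← Real.rpow_add_one hv.ne']; ring_nf
  simp only [mehlerKernel, e2]
  push_cast; ring

theorem tendsto_mehlerKernel {x : ℝ} (hx : 0 < x) {α h : ℝ} (hα : α < 2 * h) :
    Tendsto (mehlerKernel α h x) (cocompact ℝ) (𝓝 0) := by
  have h1 : Tendsto (fun v : ℝ => (1 + ‖v‖ ^ 2) ^ (-(2 * h - α) / 2)) (cocompact ℝ) (𝓝 0) := by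
    have h2 : Tendsto (fun v : ℝ => 1 + ‖v‖ ^ 2) (cocompact ℝ) atTop :=
      tendsto_atTop_add_const_left _ _
        ((tendsto_pow_atTop two_ne_zero).comp (tendsto_norm_cocompact_atTop (E := ℝ)))
    have := (tendsto_rpow_neg_atTop (y := (2 * h - α) / 2) (by linarith)).comp h2
    simpa only [Function.comp_def, neg_div] using this
  refine squeeze_zero_norm (fun v => norm_mehlerKernel_le (m := min x 1) (M := max x 1)
      (by positivity) (min_le_right _ _) (le_max_right _ _) α h
      ⟨min_le_left _ _, le_max_left _ _⟩ v) ?_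
  simpa using h1.const_mul _

theorem integral_deriv_eq_zero {f f' : ℝ → ℂ} (hf : ∀ v, HasDerivAt f (f' v) v)
    (hi : Integrable f') (h0 : Tendsto f (cocompact ℝ) (𝓝 0)) : ∫ v, f' v = 0 := by
  have := integral_of_hasDerivAt_of_tendsto hf hi (h0.mono_left atBot_le_cocompact)
    (h0.mono_left atTop_le_cocompact)
  simpa using this

/-- The Legendre equation for `mehlerInt (h - 1) h`. -/
theorem mehlerInt_legendre {x : ℝ} (hx : 0 < x) {h : ℝ} (hh : 0 < h) :
    (1 - x ^ 2) * (h - 2) * mehlerInt (h - 3) h x - 2 * x * mehlerInt (h - 2) h x +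
      h * mehlerInt (h - 1) h x = 0 := by
  have i1 := integrable_mehlerKernel hx (α := h - 1) (h := h) (by linarith)
  have i2 := integrable_mehlerKernel hx (α := h - 2) (h := h) (by linarith)
  have i3 := integrable_mehlerKernel hx (α := h - 3) (h := h) (by linarith)
  -- The Legendre operator applied to the kernel is an exact v-derivative of -i (x + iv)^(h-2) (1 +
  -- v²)^(1-h), which vanishes at ±∞.
  have hd : ∀ v, HasDerivAt (fun v => -Complex.I * mehlerKernel (h - 2) (h - 1) x v)
      ((1 - x ^ 2) * (h - 2) * mehlerKernel (h - 3) h x v - 2 * x * mehlerKernel (h - 2) h x v +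
        h * mehlerKernel (h - 1) h x v) v := by
    intro v
    have := (hasDerivAt_mehlerKernel hx (h - 2) (h - 1) v).const_mul (-Complex.I)
    refine this.congr_deriv ?_
    have e1 : mehlerKernel (h - 2) h x v = mehlerKernel (h - 3) h x v * (x + v * Complex.I) := by
      rw [← mehlerKernel_add_one hx]; ring_nf
    have e2 : mehlerKernel (h - 1) h x v =
        mehlerKernel (h - 3) h x v * (x + v * Complex.I) * (x + v * Complex.I) := by
      rw [← e1, ← mehlerKernel_add_one hx]; ring_nf
    have e3 : h - 2 - 1 = h - 3 := by ring
    rw [e1, e2, e3, sub_add_cancel]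
    push_cast
    linear_combination (mehlerKernel (h - 3) h x v * (- (h - 2) * (1 + v ^ 2) + 2 * (h - 1) * v ^ 2 * Complex.I ^ 0
      - h * v ^ 2 + 0 * Complex.I)) * Complex.I_sq
  have h0 : Tendsto (fun v => -Complex.I * mehlerKernel (h - 2) (h - 1) x v) (cocompact ℝ)
      (𝓝 0) := by
    simpa using (tendsto_mehlerKernel hx (α := h - 2) (h := h - 1) (by linarith)).const_mul
      (-Complex.I)
  have := integral_deriv_eq_zero hd
    (((i3.const_mul _).sub (i2.const_mul _)).add (i1.const_mul _)) h0
  rw [integral_add (f := fun v => (1 - (x : ℂ) ^ 2) * (h - 2) * mehlerKernel (h - 3) h x v -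
      2 * x * mehlerKernel (h - 2) h x v) ((i3.const_mul _).sub (i2.const_mul _)) (i1.const_mul _),
    integral_sub (i3.const_mul _) (i2.const_mul _), integral_const_mul, integral_const_mul,
    integral_const_mul] at this
  exact this

/-- At x = 1 the difference of the two integrands is the derivative of a multiple of (1 + iv)^h (1 +
v²)^(-h). The recursion carries the value at x = 1 from h + 1 down to h, where the circle argument
may fail. -/
theorem two_mul_mehlerInt_one {h : ℝ} (hh : 0 < h) :
    2 * mehlerInt h (h + 1) 1 = mehlerInt (h - 1) h 1 := by
  have i1 := integrable_mehlerKernel one_pos (α := h) (h := h + 1) (by linarith)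
  have i2 := integrable_mehlerKernel one_pos (α := h - 1) (h := h) (by linarith)
  have hd : ∀ v, HasDerivAt (fun v => -Complex.I / h * mehlerKernel h h 1 v)
      (2 * mehlerKernel h (h + 1) 1 v - mehlerKernel (h - 1) h 1 v) v := by
    intro v
    have := (hasDerivAt_mehlerKernel one_pos h h v).const_mul (-Complex.I / h)
    refine this.congr_deriv ?_
    have e1 : mehlerKernel h (h + 1) 1 v =
        mehlerKernel (h - 1) (h + 1) 1 v * ((1 : ℝ) + v * Complex.I) := by
      rw [← mehlerKernel_add_one one_pos]; ring_nf
    have hne : (h : ℂ) ≠ 0 := by exact_mod_cast hh.ne'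
    rw [e1, mehlerKernel_sub_one_right (h - 1) h]
    field_simp
    push_cast
    linear_combination (mehlerKernel (h - 1) (h + 1) 1 v * (v ^ 2 - 1) ) * Complex.I_sq
  have h0 : Tendsto (fun v => -Complex.I / h * mehlerKernel h h 1 v) (cocompact ℝ) (𝓝 0) := by
    simpa using (tendsto_mehlerKernel one_pos (α := h) (h := h) (by linarith)).const_mul
      (-Complex.I / h)
  have := integral_deriv_eq_zero hd ((i1.const_mul _).sub i2) h0
  rw [integral_sub (i1.const_mul _) i2, integral_const_mul, sub_eq_zero] at this
  exact this

end AdS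

theorem Complex.ofReal_mul_cpow {r : ℝ} (hr : 0 < r) (z w : ℂ) :
    ((r : ℂ) * z) ^ w = (r : ℂ) ^ w * z ^ w := by
  have hrc : (r : ℂ) ≠ 0 := by exact_mod_cast hr.ne'
  rcases eq_or_ne z 0 with rfl | hz
  · rcases eq_or_ne w 0 with rfl | hw
    · simp
    · simp [hw]
  · rw [Complex.cpow_def_of_ne_zero (mul_ne_zero hrc hz), Complex.cpow_def_of_ne_zero hrc,
      Complex.cpow_def_of_ne_zero hz, Complex.log_ofReal_mul hr hz, ← Complex.exp_add,
      Complex.ofReal_log hr.le, add_mul]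

/-! ### The value of the integral at x = 1, and continuity in h. -/

namespace AdS

/-- Half-angle substitution θ = 2 arctan v, which turns averages over the unit circle into integrals
over the real line. -/
theorem exp_two_arctan_mul_I (v : ℝ) :
    Complex.exp ((2 * Real.arctan v : ℝ) * Complex.I) = 2 * ((1 + v * Complex.I) / (1 + v ^ 2)) - 1 := by
  have hv : (0 : ℝ) < 1 + v ^ 2 := by positivity
  have hc : ((1 : ℂ) + v ^ 2) ≠ 0 := by exact_mod_cast hv.ne'
  have hs : √(1 + v ^ 2) ^ 2 = 1 + v ^ 2 := Real.sq_sqrt hv.le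
  have hs0 : √(1 + v ^ 2) ≠ 0 := by positivity
  rw [Complex.exp_mul_I, ← Complex.ofReal_cos, ← Complex.ofReal_sin, Real.cos_two_mul,
    Real.sin_two_mul, Real.cos_arctan, Real.sin_arctan]
  have e1 : 2 * (1 / √(1 + v ^ 2)) ^ 2 - 1 = 2 / (1 + v ^ 2) - 1 := by
    rw [div_pow, hs]; ring
  have e2 : 2 * (v / √(1 + v ^ 2)) * (1 / √(1 + v ^ 2)) = 2 * v / (1 + v ^ 2) := by
    have : 2 * (v / √(1 + v ^ 2)) * (1 / √(1 + v ^ 2)) = 2 * v / √(1 + v ^ 2) ^ 2 := by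
      field_simp
    rw [this, hs]
  rw [e1, e2]
  push_cast
  field_simp
  ring

theorem image_two_arctan : (fun v : ℝ => 2 * Real.arctan v) '' univ = Ioo (-Real.pi) Real.pi := by
  have : (fun v : ℝ => 2 * Real.arctan v) = (fun y => 2 * y) ∘ Real.arctan := rfl
  rw [this, image_univ, range_comp, Real.range_arctan, image_mul_left_Ioo (by norm_num)]
  congr 1 <;> ring

/-- With θ = 2 arctan v the integral becomes π times the average of ((1 + z)/2)^(h-1) over the unit
circle, which by the mean value property is the value 2^(1-h) at the centre. -/
theorem mehlerInt_one_of_one_lt {h : ℝ} (hh : 1 < h) :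
    mehlerInt (h - 1) h 1 = Real.pi * ((2 : ℝ) ^ (1 - h) : ℝ) := by
  set q : ℂ → ℂ := fun z => ((1 + z) / 2) ^ ((h - 1 : ℝ) : ℂ) with hq
  have hre : ∀ z ∈ Metric.ball (0 : ℂ) 1, 0 < ((1 + z) / 2).re := by
    intro z hz
    have h1 : ‖z‖ < 1 := by simpa using hz
    have h2 := (abs_le.1 (Complex.abs_re_le_norm z)).1
    have : ((1 + z) / 2).re = (1 + z.re) / 2 := by simp
    rw [this]; linarith
  have hd : DiffContOnCl ℂ q (Metric.ball 0 |(1 : ℝ)|) := by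
    rw [abs_one]
    constructor
    · intro z hz
      apply DifferentiableAt.differentiableWithinAt
      exact DifferentiableAt.cpow_const (by fun_prop) (Or.inl (hre z hz))
    · intro z hz
      -- The base vanishes only at z = -1. Continuity there is what requires the exponent h - 1 to
      -- be positive.
      by_cases h0 : (1 + z) / 2 = 0
      · have : ContinuousAt (fun z : ℂ => z ^ ((h - 1 : ℝ) : ℂ)) ((1 + z) / 2) := by
          rw [h0]
          exact Complex.continuousAt_cpow_const_of_re_pos (Or.inl le_rfl) (by simpa using hh)
        exact (this.comp (f := fun z : ℂ => (1 + z) / 2) (by fun_prop)).continuousWithinAt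
      · have hz' : ‖z‖ ≤ 1 := by
          have := Metric.closure_ball_subset_closedBall hz
          simpa using this
        have h2 := (abs_le.1 (Complex.abs_re_le_norm z)).1
        have hre0 : 0 ≤ ((1 + z) / 2).re := by
          have : ((1 + z) / 2).re = (1 + z.re) / 2 := by simp
          rw [this]; linarith
        have hs : (1 + z) / 2 ∈ Complex.slitPlane := by
          rcases hre0.lt_or_eq with h3 | h3
          · exact Or.inl h3
          · right; intro h4; exact h0 (Complex.ext h3.symm h4)
        have : ContinuousAt (fun z : ℂ => ((1 + z) / 2) ^ ((h - 1 : ℝ) : ℂ)) z :=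
          ContinuousAt.cpow (by fun_prop) continuousAt_const hs
        exact this.continuousWithinAt
  have h1 := hd.circleAverage
  have hq0 : q 0 = ((2 : ℝ) ^ (1 - h) : ℝ) := by
    have : (1 + 0 : ℂ) / 2 = ((1 / 2 : ℝ) : ℂ) := by norm_num
    rw [hq]; simp only []
    rw [this, ← Complex.ofReal_cpow (by norm_num), one_div, Real.inv_rpow (by norm_num),
      ← Real.rpow_neg (by norm_num)]
    ring_nf
  rw [hq0, Real.circleAverage_def] at h1
  have hper : Function.Periodic (fun θ : ℝ => q (circleMap 0 1 θ)) (2 * Real.pi) := fun θ => by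
    simp only [periodic_circleMap 0 1 θ]
  -- The period is moved to (-π, π), which is exactly the range of 2 arctan.
  have h2 := hper.intervalIntegral_add_eq 0 (-Real.pi)
  rw [zero_add, show -Real.pi + 2 * Real.pi = Real.pi by ring,
    intervalIntegral.integral_of_le (a := -Real.pi) (by linarith [Real.pi_pos]), integral_Ioc_eq_integral_Ioo,
    ← image_two_arctan, integral_image_eq_integral_abs_deriv_smul (s := univ)
      (f := fun v : ℝ => 2 * Real.arctan v) (f' := fun v => 2 * (1 / (1 + v ^ 2)))
      MeasurableSet.univ (fun v _ => ((Real.hasDerivAt_arctan v).const_mul 2).hasDerivWithinAt)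
      (fun a _ b _ hab => Real.arctan_injective (by simpa using hab))] at h2
  have h3 : ∀ v : ℝ, |2 * (1 / (1 + v ^ 2))| • q (circleMap 0 1 (2 * Real.arctan v)) =
      2 * mehlerKernel (h - 1) h 1 v := by
    intro v
    have hv : (0 : ℝ) < 1 + v ^ 2 := by positivity
    have hc : ((1 : ℂ) + v ^ 2) ≠ 0 := by exact_mod_cast hv.ne'
    rw [abs_of_pos (by positivity), hq]
    simp only [circleMap_zero, Complex.ofReal_one, one_mul]
    rw [exp_two_arctan_mul_I]
    have : ((1 : ℂ) + (2 * ((1 + v * Complex.I) / (1 + v ^ 2)) - 1)) / 2 =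
        (((1 + v ^ 2)⁻¹ : ℝ) : ℂ) * (1 + v * Complex.I) := by
      push_cast; field_simp; ring
    rw [this, Complex.real_smul, Complex.ofReal_mul_cpow (by positivity), ← Complex.ofReal_cpow (by positivity)]
    have e : ((1 + v ^ 2)⁻¹ : ℝ) ^ (h - 1) = (1 + v ^ 2) ^ (-h) * (1 + v ^ 2) := by
      rw [Real.inv_rpow hv.le, ← Real.rpow_neg hv.le, ← Real.rpow_add_one hv.ne']; ring_nf
    rw [e, mehlerKernel]
    push_cast
    field_simp
  simp only [h3, setIntegral_univ, integral_const_mul] at h2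
  rw [h2, Complex.real_smul] at h1
  rw [← h1]
  have : (Real.pi : ℂ) ≠ 0 := by exact_mod_cast Real.pi_pos.ne'
  push_cast
  rw [mehlerInt]
  field_simp

theorem mehlerInt_one {h : ℝ} (hh : 0 < h) :
    mehlerInt (h - 1) h 1 = Real.pi * ((2 : ℝ) ^ (1 - h) : ℝ) := by
  have h1 := mehlerInt_one_of_one_lt (h := h + 1) (by linarith)
  rw [← two_mul_mehlerInt_one hh]
  rw [add_sub_cancel_right] at h1
  rw [h1]
  have : (2 : ℝ) ^ (1 - h) = 2 * (2 : ℝ) ^ (1 - (h + 1)) := by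
    rw [mul_comm, ← Real.rpow_add_one two_ne_zero]; ring_nf
  rw [this]; push_cast; ring

/-- Needed for the half-integral h, where the propagator is defined as a limit. For k between h/2
and 2h and x ≥ 1 one integrable function dominates all the kernels. -/
theorem continuousAt_mehlerInt {x : ℝ} (hx : 1 ≤ x) {h : ℝ} (hh : 0 < h) :
    ContinuousAt (fun k : ℝ => mehlerInt (k - 1) k x) h := by
  have hx0 : 0 < x := by linarith
  have hnear : ∀ᶠ k : ℝ in 𝓝 h, k ∈ Ioo (h / 2) (2 * h) :=
    Ioo_mem_nhds (by linarith) (by linarith)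
  apply continuousAt_of_dominated (bound := fun v => x ^ (2 * (2 * h) : ℝ) *
    (1 + ‖v‖ ^ 2) ^ (-(h / 2 + 1) / 2))
  · exact Eventually.of_forall fun k => (continuous_mehlerKernel hx0 _ _).aestronglyMeasurable
  · filter_upwards [hnear] with k hk
    refine Eventually.of_forall fun v => ?_
    have hv : 0 < 1 + v ^ 2 := by positivity
    have hv1 : 1 ≤ 1 + v ^ 2 := by nlinarith [sq_nonneg v]
    rw [norm_mehlerKernel, Real.norm_eq_abs, sq_abs]
    have e : x ^ 2 + v ^ 2 = ((x ^ 2 + v ^ 2) / (1 + v ^ 2)) * (1 + v ^ 2) := by field_simp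
    have hr1 : 1 ≤ (x ^ 2 + v ^ 2) / (1 + v ^ 2) := by
      rw [le_div_iff₀ hv]; nlinarith
    have hr2 : (x ^ 2 + v ^ 2) / (1 + v ^ 2) ≤ x ^ 2 := by
      rw [div_le_iff₀ hv]; nlinarith [sq_nonneg v, mul_nonneg (sq_nonneg v) (by nlinarith : 0 ≤ x ^ 2 - 1)]
    rw [e, Real.mul_rpow (by positivity) hv.le, mul_assoc, ← Real.rpow_add hv]
    gcongr ?_ * ?_
    · calc ((x ^ 2 + v ^ 2) / (1 + v ^ 2)) ^ ((k - 1) / 2)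
          ≤ ((x ^ 2 + v ^ 2) / (1 + v ^ 2)) ^ (2 * h) :=
            Real.rpow_le_rpow_of_exponent_le hr1 (by linarith [hk.2])
        _ ≤ (x ^ 2) ^ (2 * h) := by gcongr
        _ = x ^ (2 * (2 * h) : ℝ) := by
          rw [← Real.rpow_natCast, ← Real.rpow_mul hx0.le]; norm_num
    · exact Real.rpow_le_rpow_of_exponent_le hv1 (by linarith [hk.1])
  · exact (integrable_one_add_sq_rpow (by linarith)).const_mul _
  · refine Eventually.of_forall fun v => ?_
    have hv : (0 : ℝ) < 1 + v ^ 2 := by positivity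
    have hne : (x : ℂ) + v * Complex.I ≠ 0 :=
      Complex.slitPlane_ne_zero (add_mul_I_mem_slitPlane hx0 v)
    unfold mehlerKernel
    refine ContinuousAt.mul ?_ ?_
    · exact ContinuousAt.const_cpow (by fun_prop) (Or.inl hne)
    · exact Complex.continuous_ofReal.continuousAt.comp
        (ContinuousAt.rpow continuousAt_const (by fun_prop) (Or.inl hv.ne'))

end AdS

/-! ### Abel's theorem and series in inverse powers of x. -/

theorem summable_natCast_add_one_pow_mul_geometric (k : ℕ) {r : ℝ} (h0 : 0 ≤ r) (hr : r < 1) :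
    Summable fun n : ℕ => ((n : ℝ) + 1) ^ k * r ^ n := by
  rcases h0.eq_or_lt with rfl | h0
  · refine summable_of_hasFiniteSupport ((Set.finite_singleton 0).subset fun n hn => ?_)
    by_contra hne
    exact hn (by simp [show n ≠ 0 from hne])
  have := (summable_nat_add_iff 1).2 (summable_pow_mul_geometric_of_norm_lt_one k
    (r := r) (by rwa [Real.norm_of_nonneg h0.le]))
  refine (this.mul_left r⁻¹).congr fun n => ?_
  push_cast
  rw [pow_succ]
  field_simp

/-- **Abel's theorem** in the form `(1 - t) ∑ b n t ^ n → lim b n` as `t → 1⁻`. -/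
theorem tendsto_one_sub_mul_tsum {b : ℕ → ℝ} {l : ℝ} (hb : Tendsto b atTop (𝓝 l)) :
    Tendsto (fun t : ℝ => (1 - t) * ∑' n, b n * t ^ n) (𝓝[<] 1) (𝓝 l) := by
  -- The successive differences have partial sums b n and generating function (1 - t) ∑ b n t^n, so
  -- Abel's limit theorem for them is the claim.
  set f : ℕ → ℝ := fun n => b n - (if n = 0 then 0 else b (n - 1)) with hf
  have hsum : ∀ n, ∑ i ∈ Finset.range (n + 1), f i = b n := by
    intro n
    induction n with
    | zero => simp [hf]
    | succ n ih => rw [Finset.sum_range_succ, ih]; simp [hf]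
  have h1 : Tendsto (fun n => ∑ i ∈ Finset.range n, f i) atTop (𝓝 l) := by
    rw [← tendsto_add_atTop_iff_nat 1]; simpa only [hsum] using hb
  refine (Real.tendsto_tsum_powerSeries_nhdsWithin_lt h1).congr' ?_
  filter_upwards [Ioo_mem_nhdsLT (zero_lt_one : (0 : ℝ) < 1)] with t ht
  obtain ⟨B, hB⟩ := (Metric.isBounded_range_of_tendsto b hb).exists_norm_le
  have hs : Summable fun n => b n * t ^ n := by
    refine Summable.of_norm_bounded ((summable_geometric_of_lt_one ht.1.le ht.2).mul_left B)
      fun n => ?_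
    rw [norm_mul, norm_pow, Real.norm_of_nonneg ht.1.le]
    exact mul_le_mul_of_nonneg_right (hB _ ⟨n, rfl⟩) (pow_nonneg ht.1.le n)
  have hs2 : Summable fun n => (if n = 0 then 0 else b (n - 1)) * t ^ n := by
    rw [← summable_nat_add_iff 1]
    refine (hs.mul_left t).congr fun n => ?_
    simp [pow_succ]; ring
  have e : ∑' n, (if n = 0 then 0 else b (n - 1)) * t ^ n = t * ∑' n, b n * t ^ n := by
    rw [hs2.tsum_eq_zero_add, ← tsum_mul_left]
    simp only [if_true, zero_mul, zero_add, Nat.add_eq_zero_iff, one_ne_zero, and_false, if_false,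
      Nat.add_sub_cancel]
    exact tsum_congr fun n => by ring
  calc ∑' n, f n * t ^ n = ∑' n, (b n * t ^ n - (if n = 0 then 0 else b (n - 1)) * t ^ n) :=
        tsum_congr fun n => by simp only [hf]; ring
    _ = _ := by rw [hs.tsum_sub hs2, e]; ring

namespace AdS

/-- Sequences of at most polynomial growth. -/
def PolyGrowth (c : ℕ → ℝ) : Prop := ∃ (C : ℝ) (k : ℕ), ∀ n, |c n| ≤ C * ((n : ℝ) + 1) ^ k

theorem PolyGrowth.summable {c : ℕ → ℝ} (hc : PolyGrowth c) {r : ℝ} (h0 : 0 ≤ r) (hr : r < 1) :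
    Summable fun n => |c n| * r ^ n := by
  obtain ⟨C, k, h⟩ := hc
  refine Summable.of_nonneg_of_le (fun n => by positivity) (fun n => ?_)
    ((summable_natCast_add_one_pow_mul_geometric k h0 hr).mul_left C)
  rw [← mul_assoc]
  gcongr
  exact h n

theorem PolyGrowth.linear_mul {c : ℕ → ℝ} (hc : PolyGrowth c) (α : ℝ) :
    PolyGrowth fun n => (α - 2 * n) * c n := by
  obtain ⟨C, k, h⟩ := hc
  refine ⟨(|α| + 2) * C, k + 1, fun n => ?_⟩
  rw [abs_mul]
  have h1 : |α - 2 * n| ≤ (|α| + 2) * ((n : ℝ) + 1) := by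
    calc |α - 2 * n| ≤ |α| + |2 * (n : ℝ)| := abs_sub _ _
      _ = |α| + 2 * n := by rw [abs_of_nonneg (by positivity : (0 : ℝ) ≤ 2 * n)]
      _ ≤ _ := by nlinarith [abs_nonneg α, (Nat.cast_nonneg n : (0 : ℝ) ≤ n)]
  calc _ ≤ ((|α| + 2) * ((n : ℝ) + 1)) * (C * ((n : ℝ) + 1) ^ k) := by
        gcongr; exact h n
    _ = _ := by ring

theorem PolyGrowth.of_tendsto {c : ℕ → ℝ} {l : ℝ} (hc : Tendsto c atTop (𝓝 l)) :
    PolyGrowth c := by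
  obtain ⟨B, hB⟩ := (Metric.isBounded_range_of_tendsto c hc).exists_norm_le
  exact ⟨B, 0, fun n => by simpa using hB _ ⟨n, rfl⟩⟩

/-- The generalized power series `∑ c n x ^ (α - 2 n)`. -/
def invSeries (c : ℕ → ℝ) (α x : ℝ) : ℝ := ∑' n : ℕ, c n * x ^ (α - 2 * n)

theorem rpow_sub_two_mul {x : ℝ} (hx : 0 < x) (α : ℝ) (n : ℕ) :
    x ^ (α - 2 * n) = x ^ α * ((x ^ 2)⁻¹) ^ n := by
  rw [Real.rpow_sub hx, Real.rpow_mul hx.le, Real.rpow_natCast, inv_pow, div_eq_mul_inv]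
  norm_num

theorem invSeries_eq {x : ℝ} (hx : 0 < x) (c : ℕ → ℝ) (α : ℝ) :
    invSeries c α x = x ^ α * ∑' n, c n * ((x ^ 2)⁻¹) ^ n := by
  rw [invSeries, ← tsum_mul_left]
  exact tsum_congr fun n => by rw [rpow_sub_two_mul hx]; ring

theorem inv_sq_lt_one {x : ℝ} (hx : 1 < x) : (x ^ 2)⁻¹ < 1 :=
  inv_lt_one_of_one_lt₀ (by nlinarith)

theorem PolyGrowth.summable_invSeries {c : ℕ → ℝ} (hc : PolyGrowth c) (α : ℝ) {x : ℝ}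
    (hx : 1 < x) : Summable fun n : ℕ => c n * x ^ (α - 2 * n) := by
  have hx0 : 0 < x := by linarith
  refine Summable.of_norm_bounded
    ((hc.summable (by positivity) (inv_sq_lt_one hx)).mul_left (x ^ α)) fun n => ?_
  rw [rpow_sub_two_mul hx0, norm_mul, Real.norm_eq_abs, Real.norm_of_nonneg (by positivity)]
  exact le_of_eq (by ring)

theorem PolyGrowth.hasDerivAt_invSeries {c : ℕ → ℝ} (hc : PolyGrowth c) (α : ℝ) {x : ℝ}
    (hx : 1 < x) :
    HasDerivAt (invSeries c α) (invSeries (fun n => (α - 2 * n) * c n) (α - 1) x) x := by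
  obtain ⟨y, hy1, hyx⟩ := exists_between hx
  have hy0 : 0 < y := by linarith
  refine hasDerivAt_tsum_of_isPreconnected (t := Ioo y (x + 1))
    (g := fun (n : ℕ) x => c n * x ^ (α - 2 * n))
    (g' := fun (n : ℕ) x => (α - 2 * n) * c n * x ^ (α - 1 - 2 * n)) (y₀ := x) (y := x)
    (u := fun n => (y ^ (α - 1) + (x + 1) ^ (α - 1)) * (|(α - 2 * n) * c n| * ((y ^ 2)⁻¹) ^ n))
    (((hc.linear_mul α).summable (by positivity) (inv_sq_lt_one hy1)).mul_left _)
    isOpen_Ioo isPreconnected_Ioo ?_ ?_ ⟨hyx, by linarith⟩ (hc.summable_invSeries α hx)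
    ⟨hyx, by linarith⟩
  · intro n z hz
    have hz0 : 0 < z := hy0.trans hz.1
    refine ((Real.hasDerivAt_rpow_const (p := α - 2 * n) (Or.inl hz0.ne')).const_mul
      (c n)).congr_deriv ?_
    rw [show α - 1 - 2 * (n : ℝ) = α - 2 * n - 1 by ring]; ring
  · intro n z hz
    have hz0 : 0 < z := hy0.trans hz.1
    rw [rpow_sub_two_mul hz0, norm_mul, Real.norm_eq_abs, Real.norm_of_nonneg (by positivity)]
    have h1 : z ^ (α - 1) ≤ y ^ (α - 1) + (x + 1) ^ (α - 1) :=
      rpow_le_add_rpow hy0 hz.1.le hz.2.le _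
    have h2 : ((z ^ 2)⁻¹) ^ n ≤ ((y ^ 2)⁻¹) ^ n := by
      have := hz.1.le
      gcongr
    have h3 : (0 : ℝ) ≤ z ^ (α - 1) := by positivity
    have h4 : (0 : ℝ) ≤ ((z ^ 2)⁻¹) ^ n := by positivity
    calc |(α - 2 * n) * c n| * (z ^ (α - 1) * ((z ^ 2)⁻¹) ^ n)
        ≤ |(α - 2 * n) * c n| * ((y ^ (α - 1) + (x + 1) ^ (α - 1)) * ((y ^ 2)⁻¹) ^ n) := by
          gcongr
      _ = _ := by ring

/-- With t = x⁻² one has x² - 1 = x²(1 - t), and t tends to 1 from below as x tends to 1 from above,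
so Abel's theorem applies. The power of x in front tends to 1. -/
theorem tendsto_sq_sub_one_mul_invSeries {c : ℕ → ℝ} {l : ℝ} (hc : Tendsto c atTop (𝓝 l))
    (α : ℝ) : Tendsto (fun x => (x ^ 2 - 1) * invSeries c α x) (𝓝[>] 1) (𝓝 l) := by
  have h1 : Tendsto (fun x : ℝ => (x ^ 2)⁻¹) (𝓝[>] 1) (𝓝[<] 1) := by
    refine tendsto_nhdsWithin_iff.2 ⟨?_, ?_⟩
    · have : ContinuousAt (fun x : ℝ => (x ^ 2)⁻¹) 1 :=
        ContinuousAt.inv₀ (by fun_prop) (by norm_num)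
      have h2 := this.tendsto
      norm_num at h2
      exact h2.mono_left nhdsWithin_le_nhds
    · filter_upwards [self_mem_nhdsWithin] with x hx using inv_sq_lt_one hx
  have h2 := (tendsto_one_sub_mul_tsum hc).comp h1
  have h3 : Tendsto (fun x : ℝ => x ^ (α + 2)) (𝓝[>] 1) (𝓝 1) := by
    have := (Real.continuousAt_rpow_const 1 (α + 2) (Or.inl one_ne_zero)).tendsto
    rw [Real.one_rpow] at this
    exact this.mono_left nhdsWithin_le_nhds
  have h4 := h3.mul h2
  rw [one_mul] at h4
  refine h4.congr' ?_
  filter_upwards [self_mem_nhdsWithin] with x hx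
  have hx0 : 0 < x := zero_lt_one.trans hx
  rw [invSeries_eq hx0, Function.comp_apply, Real.rpow_add hx0]
  norm_num
  field_simp

theorem PolyGrowth.tendsto_invSeries_atTop {c : ℕ → ℝ} (hc : PolyGrowth c) (α : ℝ) :
    Tendsto (fun x => x ^ (-α) * invSeries c α x) atTop (𝓝 (c 0)) := by
  have h1 : Tendsto (fun x : ℝ => ∑' n, c n * ((x ^ 2)⁻¹) ^ n) atTop
      (𝓝 (∑' n, if n = 0 then c 0 else 0)) := by
    refine tendsto_tsum_of_dominated_convergence (bound := fun n => |c n| * (1 / 4 : ℝ) ^ n)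
      (hc.summable (by norm_num) (by norm_num)) ?_ ?_
    · intro n
      rcases eq_or_ne n 0 with rfl | hn
      · simp
      · rw [if_neg hn]
        have : Tendsto (fun x : ℝ => (x ^ 2)⁻¹) atTop (𝓝 0) :=
          (tendsto_pow_atTop two_ne_zero).inv_tendsto_atTop
        simpa [hn] using (this.pow n).const_mul (c n)
    · filter_upwards [eventually_ge_atTop 2] with x hx n
      rw [norm_mul, Real.norm_eq_abs, Real.norm_of_nonneg (by positivity)]
      have : (x ^ 2)⁻¹ ≤ 1 / 4 := by
        rw [one_div]; gcongr; nlinarith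
      gcongr
  rw [tsum_ite_eq] at h1
  refine h1.congr' ?_
  filter_upwards [eventually_gt_atTop 0] with x hx
  rw [invSeries_eq hx, ← mul_assoc, ← Real.rpow_add hx]
  simp

end AdS

/-! ### The hypergeometric coefficients and the propagators as Legendre solutions. -/

theorem ascPochhammer_eval_eq_prod_add {R : Type*} [CommSemiring R] (s : R) (n : ℕ) :
    (ascPochhammer R n).eval s = ∏ j ∈ Finset.range n, (s + j) := by
  induction n with
  | zero => simp
  | succ n ih => rw [ascPochhammer_succ_eval, ih, Finset.prod_range_succ]

/-- The coefficients of `₂F₁ (a, b; a + b)` are asymptotic to `Γ (a + b) / (Γ a Γ b) / n`. -/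
theorem tendsto_mul_ordinaryHypergeometricCoefficient (a b : ℝ) :
    Tendsto (fun n : ℕ => (n : ℝ) * ordinaryHypergeometricCoefficient a b (a + b) n) atTop
      (𝓝 (Real.Gamma (a + b) / (Real.Gamma a * Real.Gamma b))) := by
  rw [← tendsto_add_atTop_iff_nat 1]
  have hz : ∀ c m : ℕ, ∀ s : ℝ, s = -(m : ℝ) → m ≤ c → (ascPochhammer ℝ (c + 1)).eval s = 0 := by
    intro c m s hs hm
    rw [ascPochhammer_eval_eq_prod_add]
    exact Finset.prod_eq_zero (i := m) (Finset.mem_range.2 (by omega)) (by rw [hs]; ring)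
  -- Here a or b is a nonpositive integer: the coefficients vanish eventually, and the right-hand
  -- side is 0 because division by 0 gives 0. Otherwise the coefficient is a quotient of terms of
  -- Gauss's limit sequences for Γ.
  by_cases hG : Real.Gamma a * Real.Gamma b = 0
  · rw [hG, div_zero]
    have : ∃ m : ℕ, a = -(m : ℝ) ∨ b = -(m : ℝ) := by
      rcases mul_eq_zero.1 hG with h | h
      · obtain ⟨m, hm⟩ := (Real.Gamma_eq_zero_iff a).1 h; exact ⟨m, Or.inl hm⟩
      · obtain ⟨m, hm⟩ := (Real.Gamma_eq_zero_iff b).1 h; exact ⟨m, Or.inr hm⟩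
    obtain ⟨m, hm⟩ := this
    refine tendsto_const_nhds.congr' ?_
    filter_upwards [eventually_ge_atTop m] with n hn
    rcases hm with h | h
    · simp [ordinaryHypergeometricCoefficient, hz n m a h hn]
    · simp [ordinaryHypergeometricCoefficient, hz n m b h hn]
  · have h1 := (Real.GammaSeq_tendsto_Gamma (a + b)).div
      ((Real.GammaSeq_tendsto_Gamma a).mul (Real.GammaSeq_tendsto_Gamma b)) hG
    refine h1.congr' ?_
    filter_upwards [eventually_gt_atTop 0] with n hn
    have hn' : (0 : ℝ) < n := by exact_mod_cast hn
    have hf : (n.factorial : ℝ) ≠ 0 := by positivity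
    simp only [Pi.div_apply, Real.GammaSeq, ordinaryHypergeometricCoefficient,
      ascPochhammer_eval_eq_prod_add, Nat.factorial_succ]
    rw [Real.rpow_add hn']
    have h2 : (n : ℝ) ^ a ≠ 0 := by positivity
    have h3 : (n : ℝ) ^ b ≠ 0 := by positivity
    have h4 : (n : ℝ) + 1 ≠ 0 := by positivity
    simp only [div_eq_mul_inv, mul_inv, inv_inv]
    push_cast
    field_simp

namespace AdS

/-- The coefficients of `₂F₁ (h / 2, h / 2 + 1 / 2; h + 1 / 2)`. -/
def hgCoeff (h : ℝ) (n : ℕ) : ℝ := ordinaryHypergeometricCoefficient (h / 2) (h / 2 + 1 / 2) (h + 1 / 2) n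

theorem hgCoeff_zero (h : ℝ) : hgCoeff h 0 = 1 := by
  simp [hgCoeff, ordinaryHypergeometricCoefficient]

/-- The recurrence that makes the series solve the Legendre equation. It is stated without division;
the hypothesis excludes a newly vanishing denominator parameter. -/
theorem hgCoeff_succ {h : ℝ} {n : ℕ} (hn : h + 1 / 2 + n ≠ 0) :
    hgCoeff h (n + 1) * ((2 * n + 2) * (2 * h + 2 * n + 1)) =
      hgCoeff h n * ((h + 2 * n) * (h + 2 * n + 1)) := by
  have h1 : ((n.factorial : ℕ) : ℝ) ≠ 0 := by positivity
  have h2 : (n : ℝ) + 1 ≠ 0 := by positivity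
  simp only [hgCoeff, ordinaryHypergeometricCoefficient, ascPochhammer_succ_eval,
    Nat.factorial_succ]
  push_cast
  rw [mul_inv ((ascPochhammer ℝ n).eval (h + 1 / 2))]
  have e : 2 * h + 2 * (n : ℝ) + 1 = 2 * (h + 1 / 2 + n) := by ring
  rw [e]
  generalize ((ascPochhammer ℝ n).eval (h + 1 / 2))⁻¹ = q
  generalize h + 1 / 2 + (n : ℝ) = D at hn
  field_simp
  ring

/-- The limit of `n * hgCoeff h n`. -/
def hgLim (h : ℝ) : ℝ := Real.Gamma (h + 1 / 2) / (Real.Gamma (h / 2) * Real.Gamma (h / 2 + 1 / 2))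

theorem tendsto_mul_hgCoeff (h : ℝ) :
    Tendsto (fun n : ℕ => (n : ℝ) * hgCoeff h n) atTop (𝓝 (hgLim h)) := by
  have := tendsto_mul_ordinaryHypergeometricCoefficient (h / 2) (h / 2 + 1 / 2)
  rw [show h / 2 + (h / 2 + 1 / 2) = h + 1 / 2 by ring] at this
  exact this

theorem tendsto_hgCoeff (h : ℝ) : Tendsto (hgCoeff h) atTop (𝓝 0) := by
  have h1 := (tendsto_mul_hgCoeff h).mul
    (tendsto_inv_atTop_zero.comp (tendsto_natCast_atTop_atTop (R := ℝ)))
  rw [mul_zero] at h1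
  refine h1.congr' ?_
  filter_upwards [eventually_gt_atTop 0] with n hn
  have hn' : (n : ℝ) ≠ 0 := by positivity
  simp only [Function.comp_apply]
  field_simp

theorem polyGrowth_hgCoeff (h : ℝ) : PolyGrowth (hgCoeff h) := .of_tendsto (tendsto_hgCoeff h)

/-- `2 ^ h` times the propagator `(ξ / 2) ^ h ₂F₁ (h / 2, h / 2 + 1 / 2; h + 1 / 2; ξ²)` as a
function of `x = 1 / ξ`. -/
def propFun (h x : ℝ) : ℝ := invSeries (hgCoeff h) (-h) x

/-- The derivative of `propFun`. -/
def propFunDeriv (h x : ℝ) : ℝ := invSeries (fun n => (-h - 2 * n) * hgCoeff h n) (-h - 1) x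

theorem hasDerivAt_propFun (h : ℝ) {x : ℝ} (hx : 1 < x) :
    HasDerivAt (propFun h) (propFunDeriv h x) x :=
  (polyGrowth_hgCoeff h).hasDerivAt_invSeries (-h) hx

/-- The Legendre equation for `propFun`. -/
theorem hasDerivAt_mul_propFunDeriv {h : ℝ} (hh : ∀ n : ℕ, h + 1 / 2 + n ≠ 0) {x : ℝ}
    (hx : 1 < x) :
    HasDerivAt (fun x => (x ^ 2 - 1) * propFunDeriv h x) (h * (h - 1) * propFun h x) x := by
  have hx0 : 0 < x := by linarith
  set c := hgCoeff h with hc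
  set c1 : ℕ → ℝ := fun n => (-h - 2 * n) * c n with hc1
  set c2 : ℕ → ℝ := fun n => (-h - 1 - 2 * n) * c1 n with hc2
  have hp := polyGrowth_hgCoeff h
  have hp1 : PolyGrowth c1 := hp.linear_mul _
  have hp2 : PolyGrowth c2 := hp1.linear_mul _
  have h1 := hp1.hasDerivAt_invSeries (-h - 1) hx
  have h2 : HasDerivAt (fun x : ℝ => x ^ 2 - 1) (2 * x) x := by
    simpa using (hasDerivAt_pow 2 x).sub_const 1
  refine (h2.mul h1).congr_deriv ?_
  change 2 * x * invSeries c1 (-h - 1) x + (x ^ 2 - 1) * invSeries c2 (-h - 1 - 1) x =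
    h * (h - 1) * invSeries c (-h) x
  simp only [invSeries_eq hx0]
  set t := (x ^ 2)⁻¹ with ht
  have ht0 : 0 ≤ t := by positivity
  have ht1 : t < 1 := inv_sq_lt_one hx
  have sm : ∀ {c : ℕ → ℝ}, PolyGrowth c → Summable fun n => c n * t ^ n := fun {c} hc =>
    Summable.of_norm (by simpa [abs_mul, abs_of_nonneg ht0] using hc.summable ht0 ht1)
  have s0 := sm hp
  have s1 := sm hp1
  have s2 := sm hp2
  -- After the common factor x^(-h) is removed, the equation is an identity of power series in t =
  -- x⁻². The constant terms match directly, the others by the recurrence.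
  have key : 2 * ∑' n, c1 n * t ^ n + (1 - t) * ∑' n, c2 n * t ^ n =
      h * (h - 1) * ∑' n, c n * t ^ n := by
    have e : t * ∑' n, c2 n * t ^ n = ∑' n, c2 n * t ^ (n + 1) := by
      rw [← tsum_mul_left]; exact tsum_congr fun n => by ring
    have s2' : Summable fun n => c2 n * t ^ (n + 1) :=
      (s2.mul_left t).congr fun n => by ring
    rw [sub_mul, one_mul, e, s0.tsum_eq_zero_add, s1.tsum_eq_zero_add, s2.tsum_eq_zero_add,
      mul_add, mul_add, ← tsum_mul_left, ← tsum_mul_left]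
    have t0 := ((summable_nat_add_iff 1).2 s0).mul_left (h * (h - 1))
    have t1 := ((summable_nat_add_iff 1).2 s1).mul_left 2
    have t2 := (summable_nat_add_iff 1).2 s2
    have e0 : ∑' n, 2 * (c1 (n + 1) * t ^ (n + 1)) + (∑' n, c2 (n + 1) * t ^ (n + 1) -
        ∑' n, c2 n * t ^ (n + 1)) = ∑' n, h * (h - 1) * (c (n + 1) * t ^ (n + 1)) := by
      rw [← t2.tsum_sub s2', ← t1.tsum_add (t2.sub s2')]
      refine tsum_congr fun n => ?_
      have hr := hgCoeff_succ (hh n)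
      rw [← hc] at hr
      simp only [hc1, hc2]
      push_cast
      linear_combination t ^ (n + 1) * hr
    have e1 : 2 * (c1 0 * t ^ 0) + c2 0 * t ^ 0 = h * (h - 1) * (c 0 * t ^ 0) := by
      simp only [hc1, hc2]; push_cast; ring
    linear_combination e0 + e1
  have e1 : x ^ (-h - 1) = x ^ (-h) * x⁻¹ := by
    rw [Real.rpow_sub hx0, Real.rpow_one]; rfl
  have e2 : x ^ (-h - 1 - 1) = x ^ (-h) * t := by
    rw [Real.rpow_sub hx0, Real.rpow_sub hx0, Real.rpow_one, ht]; field_simp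
  have e3 : x ^ 2 - 1 = x ^ 2 * (1 - t) := by rw [ht]; field_simp
  rw [e1, e2, e3]
  have e4 : x ^ 2 * t = 1 := by rw [ht]; field_simp
  have e5 : x * x⁻¹ = 1 := by field_simp
  linear_combination x ^ (-h) * key + (2 * x ^ (-h) * ∑' n, c1 n * t ^ n) * e5 +
    (1 - t) * x ^ (-h) * (∑' n, c2 n * t ^ n) * e4

theorem tendsto_mul_propFun (h : ℝ) :
    Tendsto (fun x => (x ^ 2 - 1) * propFun h x) (𝓝[>] 1) (𝓝 0) :=
  tendsto_sq_sub_one_mul_invSeries (tendsto_hgCoeff h) _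

/-- The coefficients (-h - 2n) c_n of the derivative tend to -2 `hgLim h`. This is the strength of
the logarithmic singularity at x = 1, the boundary datum that enters the Wronskians there. -/
theorem tendsto_mul_propFunDeriv (h : ℝ) :
    Tendsto (fun x => (x ^ 2 - 1) * propFunDeriv h x) (𝓝[>] 1) (𝓝 (-2 * hgLim h)) := by
  refine tendsto_sq_sub_one_mul_invSeries ?_ _
  have := ((tendsto_hgCoeff h).const_mul (-h)).add ((tendsto_mul_hgCoeff h).const_mul (-2))
  rw [mul_zero, zero_add] at this
  exact this.congr fun n => by ring

theorem tendsto_propFun_atTop (h : ℝ) :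
    Tendsto (fun x => x ^ h * propFun h x) atTop (𝓝 1) := by
  have := (polyGrowth_hgCoeff h).tendsto_invSeries_atTop (-h)
  rw [neg_neg, hgCoeff_zero] at this
  exact this

theorem tendsto_propFunDeriv_atTop (h : ℝ) :
    Tendsto (fun x => x ^ (h + 1) * propFunDeriv h x) atTop (𝓝 (-h)) := by
  have := ((polyGrowth_hgCoeff h).linear_mul (-h)).tendsto_invSeries_atTop (-h - 1)
  simp only [hgCoeff_zero] at this
  rw [show -(-h - 1) = h + 1 by ring] at this
  simpa [propFunDeriv] using this

/-! ### Wronskians and the connection formula. -/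

/-- The Wronskian of two solutions of the Legendre equation, times `x² - 1`, is constant. -/
theorem wronskian_eq {y₁ y₂ p₁ p₂ : ℝ → ℂ} {c : ℂ}
    (h₁ : ∀ x ∈ Ioi (1 : ℝ), HasDerivAt y₁ (p₁ x / (x ^ 2 - 1)) x)
    (h₂ : ∀ x ∈ Ioi (1 : ℝ), HasDerivAt y₂ (p₂ x / (x ^ 2 - 1)) x)
    (k₁ : ∀ x ∈ Ioi (1 : ℝ), HasDerivAt p₁ (c * y₁ x) x)
    (k₂ : ∀ x ∈ Ioi (1 : ℝ), HasDerivAt p₂ (c * y₂ x) x) {l : Filter ℝ} [l.NeBot]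
    (hl : ∀ᶠ x in l, 1 < x) {w : ℂ}
    (hw : Tendsto (fun x => y₁ x * p₂ x - y₂ x * p₁ x) l (𝓝 w)) {x : ℝ} (hx : 1 < x) :
    y₁ x * p₂ x - y₂ x * p₁ x = w := by
  have hd : ∀ x ∈ Ioi (1 : ℝ), HasDerivAt (fun x => y₁ x * p₂ x - y₂ x * p₁ x) 0 x := by
    intro x hx
    refine (((h₁ x hx).mul (k₂ x hx)).sub ((h₂ x hx).mul (k₁ x hx))).congr_deriv ?_
    ring
  have hconst := fun y (hy : y ∈ Ioi (1 : ℝ)) =>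
    isOpen_Ioi.is_const_of_deriv_eq_zero isPreconnected_Ioi
      (fun x hx => (hd x hx).differentiableAt.differentiableWithinAt)
      (fun x hx => (hd x hx).deriv) hy (mem_Ioi.2 hx)
  refine tendsto_nhds_unique ?_ hw
  refine tendsto_const_nhds.congr' ?_
  filter_upwards [hl] with y hy
  exact (hconst y hy).symm

end AdS

namespace AdS

theorem tendsto_mehlerInt_one {α h : ℝ} (hα : α + 1 < 2 * h) :
    Tendsto (mehlerInt α h) (𝓝[>] 1) (𝓝 (mehlerInt α h 1)) :=
  (hasDerivAt_mehlerInt one_pos hα).continuousAt.tendsto.mono_left nhdsWithin_le_nhds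

/-- The leading terms x^(-h) and x^(h-1) and their derivatives multiply to x⁻², which compensates
the factor x² - 1 and leaves -(1 - h) + h. -/
theorem tendsto_wronskian_propFun (h : ℝ) :
    Tendsto (fun x : ℝ => propFun h x * ((x ^ 2 - 1) * propFunDeriv (1 - h) x) -
      propFun (1 - h) x * ((x ^ 2 - 1) * propFunDeriv h x)) atTop (𝓝 (2 * h - 1)) := by
  have h0 : Tendsto (fun x : ℝ => 1 - (x ^ 2)⁻¹) atTop (𝓝 1) := by
    simpa using ((tendsto_pow_atTop (α := ℝ) two_ne_zero).inv_tendsto_atTop).const_sub 1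
  have h1 := h0.mul ((tendsto_propFun_atTop h).mul (tendsto_propFunDeriv_atTop (1 - h)))
  have h2 := h0.mul ((tendsto_propFun_atTop (1 - h)).mul (tendsto_propFunDeriv_atTop h))
  have h3 := h1.sub h2
  rw [show 1 * (1 * -(1 - h)) - 1 * (1 * -h) = 2 * h - 1 by ring] at h3
  refine h3.congr' ?_
  filter_upwards [eventually_gt_atTop 0] with x hx
  have e1 : x ^ h * x ^ (1 - h + 1) = x ^ 2 := by
    rw [← Real.rpow_add hx, ← Real.rpow_natCast]; congr 1; push_cast; ring
  have e2 : x ^ (1 - h) * x ^ (h + 1) = x ^ 2 := by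
    rw [← Real.rpow_add hx, ← Real.rpow_natCast]; congr 1; push_cast; ring
  have e3 : (1 - (x ^ 2)⁻¹) * x ^ 2 = x ^ 2 - 1 := by field_simp
  linear_combination (1 - (x ^ 2)⁻¹) * propFun h x * propFunDeriv (1 - h) x * e1 -
    (1 - (x ^ 2)⁻¹) * propFun (1 - h) x * propFunDeriv h x * e2 +
    (propFun h x * propFunDeriv (1 - h) x - propFun (1 - h) x * propFunDeriv h x) * e3

/-- The connection formula expressing the solution of the Legendre equation that is regular at `1`
by the two solutions with pure power behaviour at infinity. -/
theorem mehlerInt_connection {h : ℝ} (hh : 0 < h) (hn : ∀ n : ℕ, h ≠ n + 1 / 2) {x : ℝ}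
    (hx : 1 < x) :
    (2 * h - 1) * mehlerInt (h - 1) h x = 2 * mehlerInt (h - 1) h 1 *
      (hgLim h * propFun (1 - h) x - hgLim (1 - h) * propFun h x) := by
  have hne : ∀ x ∈ Ioi (1 : ℝ), ((x : ℂ) ^ 2 - 1) ≠ 0 := fun x hx => by
    have : x ^ 2 - 1 ≠ 0 := by have : 1 < x := hx; nlinarith
    exact_mod_cast this
  have c1 : ∀ n : ℕ, h + 1 / 2 + n ≠ 0 := fun n => by positivity
  -- The denominator parameter of G_{1-h} degenerates exactly for h = 3/2, 5/2, …, hence the shift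
  -- to n + 1.
  have c2 : ∀ n : ℕ, 1 - h + 1 / 2 + n ≠ 0 := fun n hc => hn (n + 1) (by push_cast; linarith)
  -- the solutions and their quasi-derivatives
  set p₀ : ℝ → ℂ := fun x => ((x : ℂ) ^ 2 - 1) * (((h : ℂ) - 1) * mehlerInt (h - 2) h x) with hp₀
  set p₁ : ℝ → ℂ := fun x => ((x : ℂ) ^ 2 - 1) * (propFunDeriv h x : ℂ) with hp₁
  set p₂ : ℝ → ℂ := fun x => ((x : ℂ) ^ 2 - 1) * (propFunDeriv (1 - h) x : ℂ) with hp₂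
  have d0 : ∀ x ∈ Ioi (1 : ℝ), HasDerivAt (mehlerInt (h - 1) h) (p₀ x / (x ^ 2 - 1)) x := by
    intro x hx
    have hx0 : 0 < x := zero_lt_one.trans hx
    refine (hasDerivAt_mehlerInt hx0 (by linarith)).congr_deriv ?_
    rw [hp₀, mul_div_cancel_left₀ _ (hne x hx), show h - 1 - 1 = h - 2 by ring]
    push_cast; ring
  have k0 : ∀ x ∈ Ioi (1 : ℝ), HasDerivAt p₀ ((h : ℂ) * (h - 1) * mehlerInt (h - 1) h x) x := by
    intro x hx
    have hx0 : 0 < x := zero_lt_one.trans hx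
    have h1 : HasDerivAt (fun x : ℝ => (x : ℂ) ^ 2 - 1) (2 * (x : ℂ)) x := by
      simpa using ((Complex.ofRealCLM.hasDerivAt (x := x)).pow 2).sub_const 1
    have h2 := (hasDerivAt_mehlerInt hx0 (α := h - 2) (h := h) (by linarith)).const_mul
      ((h : ℂ) - 1)
    refine (h1.mul h2).congr_deriv ?_
    have := mehlerInt_legendre hx0 hh
    rw [show h - 2 - 1 = h - 3 by ring]
    push_cast
    linear_combination (-(h : ℂ) + 1) * this
  have dG : ∀ g : ℝ, ∀ x ∈ Ioi (1 : ℝ), HasDerivAt (fun x => (propFun g x : ℂ))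
      (((x : ℂ) ^ 2 - 1) * (propFunDeriv g x : ℂ) / ((x : ℂ) ^ 2 - 1)) x := by
    intro g x hx
    refine (hasDerivAt_propFun g hx).ofReal_comp.congr_deriv ?_
    rw [mul_div_cancel_left₀ _ (hne x hx)]
  have kG : ∀ g : ℝ, (∀ n : ℕ, g + 1 / 2 + n ≠ 0) → g * (g - 1) = h * (h - 1) →
      ∀ x ∈ Ioi (1 : ℝ), HasDerivAt (fun x : ℝ => ((x : ℂ) ^ 2 - 1) * (propFunDeriv g x : ℂ))
        ((h : ℂ) * (h - 1) * (propFun g x : ℂ)) x := by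
    intro g hg hgh x hx
    have := (hasDerivAt_mul_propFunDeriv hg hx).ofReal_comp
    rw [hgh] at this
    push_cast at this
    exact this
  have W12 : (propFun h x : ℂ) * p₂ x - propFun (1 - h) x * p₁ x = 2 * h - 1 := by
    refine wronskian_eq (dG h) (dG (1 - h)) (kG h c1 rfl) (kG (1 - h) c2 (by ring))
      (eventually_gt_atTop 1) ?_ hx
    have := (Complex.continuous_ofReal.tendsto _).comp (tendsto_wronskian_propFun h)
    push_cast at this
    refine this.congr fun y => ?_
    simp only [Function.comp_apply]; push_cast; ring
  -- The Wronskian with the regular solution is evaluated at x → 1, where only its value there times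
  -- the logarithmic coefficient of the other solution survives.
  have W0 : ∀ g : ℝ, (∀ n : ℕ, g + 1 / 2 + n ≠ 0) → g * (g - 1) = h * (h - 1) →
      mehlerInt (h - 1) h x * (((x : ℂ) ^ 2 - 1) * (propFunDeriv g x : ℂ)) - propFun g x * p₀ x =
        mehlerInt (h - 1) h 1 * ((-2 * hgLim g : ℝ) : ℂ) := by
    intro g hg hgh
    refine wronskian_eq (l := 𝓝[>] 1) d0 (dG g) k0 (kG g hg hgh) self_mem_nhdsWithin ?_ hx
    have t1 := (tendsto_mehlerInt_one (α := h - 1) (h := h) (by linarith)).mul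
      ((Complex.continuous_ofReal.tendsto _).comp (tendsto_mul_propFunDeriv g))
    have t2 := ((Complex.continuous_ofReal.tendsto _).comp (tendsto_mul_propFun g)).mul
      ((tendsto_mehlerInt_one (α := h - 2) (h := h) (by linarith)).const_mul ((h : ℂ) - 1))
    have t3 := t1.sub t2
    rw [Complex.ofReal_zero, zero_mul, sub_zero] at t3
    refine t3.congr fun y => ?_
    simp only [Function.comp_apply, hp₀]; push_cast; ring
  have w1 := W0 h c1 rfl
  have w2 := W0 (1 - h) c2 (by ring)
  push_cast at w1 w2
  -- A 3 × 3 determinant with the row of the three solutions repeated vanishes. Expanding it along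
  -- one copy of that row gives the relation with Wronskians as coefficients.
  linear_combination (-mehlerInt (h - 1) h x) * W12 + propFun h x * w2 - propFun (1 - h) x * w1

/-- The Legendre function `P_{h-1}` on `(1, ∞)`. -/
def legendreFn (h x : ℝ) : ℂ :=
  ((2 ^ h / (2 * Real.pi) : ℝ) : ℂ) * mehlerInt (h - 1) h x

/-- Legendre's duplication formula, used at h/2 for the denominator of `hgLim` and at h - 1/2 for
Γ(2h - 1). -/
theorem two_mul_hgLim_div {h : ℝ} (hh : h ≠ 1 / 2) :
    2 * (2 : ℝ) ^ (1 - h) * hgLim h / (2 * h - 1) =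
      4 ^ (1 - h) * (Real.Gamma (2 * h - 1) / Real.Gamma h ^ 2) := by
  have h0 : h - 1 / 2 ≠ 0 := sub_ne_zero.2 hh
  have h0' : 2 * h - 1 ≠ 0 := fun h1 => h0 (by linarith)
  have e1 : Real.Gamma (h + 1 / 2) = (h - 1 / 2) * Real.Gamma (h - 1 / 2) := by
    rw [← Real.Gamma_add_one h0]; congr 1; ring
  have e2 := Real.Gamma_mul_Gamma_add_half (h / 2)
  have e3 := Real.Gamma_mul_Gamma_add_half (h - 1 / 2)
  rw [show 2 * (h / 2) = h by ring] at e2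
  rw [show h - 1 / 2 + 1 / 2 = h by ring, show 2 * (h - 1 / 2) = 2 * h - 1 by ring,
    show 1 - (2 * h - 1) = 2 * (1 - h) by ring, Real.rpow_mul two_pos.le] at e3
  norm_num at e3
  have hs : √Real.pi ≠ 0 := by have := Real.pi_pos; positivity
  have h2 : (2 : ℝ) ^ (1 - h) ≠ 0 := by positivity
  rw [hgLim, e2, e1]
  -- The pole convention Γ = 0. It is met when the lemma is applied to 1 - h with h a positive
  -- integer; then both sides are 0.
  by_cases hG : Real.Gamma h = 0
  · simp [hG]
  have e4 : (4 : ℝ) ^ (1 - h) * Real.Gamma (2 * h - 1) =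
      Real.Gamma (h - 1 / 2) * Real.Gamma h / √Real.pi := by
    rw [eq_div_iff hs, e3]; ring
  rw [← mul_div_assoc (4 ^ (1 - h) : ℝ), e4]
  field_simp

theorem legendreFn_eq {h : ℝ} (hh : 0 < h) (hn : ∀ n : ℕ, h ≠ n + 1 / 2) {x : ℝ} (hx : 1 < x) :
    legendreFn h x =
      ((4 ^ h * (Real.Gamma (1 - 2 * h) / Real.Gamma (1 - h) ^ 2) * (2 ^ (-h) * propFun h x) +
      4 ^ (1 - h) * (Real.Gamma (2 * h - 1) / Real.Gamma h ^ 2) *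
        (2 ^ (-(1 - h)) * propFun (1 - h) x) : ℝ) : ℂ) := by
  have hhalf : h ≠ 1 / 2 := by simpa using hn 0
  have h0' : 2 * h - 1 ≠ 0 := fun h1 => hhalf (by linarith)
  have h0c : (2 * (h : ℂ) - 1) ≠ 0 := by exact_mod_cast h0'
  have e1 := two_mul_hgLim_div hhalf
  have e2 := two_mul_hgLim_div (h := 1 - h) (fun h1 => hhalf (by linarith))
  rw [show 1 - (1 - h) = h by ring, show 2 * (1 - h) - 1 = 1 - 2 * h by ring] at e2
  have key : mehlerInt (h - 1) h x = 2 * mehlerInt (h - 1) h 1 *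
      (hgLim h * propFun (1 - h) x - hgLim (1 - h) * propFun h x) / (2 * h - 1) := by
    rw [eq_div_iff h0c, ← mehlerInt_connection hh hn hx]; ring
  rw [legendreFn, key, mehlerInt_one hh, ← e1, ← e2]
  have f1 : (2 : ℝ) ^ (1 - h) * 2 ^ h = 2 := by
    rw [← Real.rpow_add two_pos]; norm_num
  have f2 : (2 : ℝ) ^ (1 - h) * 2 ^ (-(1 - h)) = 1 := by
    rw [← Real.rpow_add two_pos]; norm_num
  have f3 : (2 : ℝ) ^ h * 2 ^ (-h) = 1 := by
    rw [← Real.rpow_add two_pos]; norm_num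
  have f4 : 1 - 2 * h ≠ 0 := fun h1 => hhalf (by linarith)
  have hpi : (Real.pi : ℝ) ≠ 0 := Real.pi_pos.ne'
  rw [← Complex.ofReal_ofNat]
  norm_cast
  have g1 : 2 * (2 : ℝ) ^ h * hgLim (1 - h) / (1 - 2 * h) * (2 ^ (-h) * propFun h x) =
      2 * hgLim (1 - h) * propFun h x / (1 - 2 * h) := by
    linear_combination 2 * hgLim (1 - h) * propFun h x / (1 - 2 * h) * f3
  have g2 : 2 * (2 : ℝ) ^ (1 - h) * hgLim h / (2 * h - 1) * (2 ^ (-(1 - h)) * propFun (1 - h) x) =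
      2 * hgLim h * propFun (1 - h) x / (2 * h - 1) := by
    linear_combination 2 * hgLim h * propFun (1 - h) x / (2 * h - 1) * f2
  rw [g1, g2]
  have g3 : (2 : ℝ) ^ h = 2 / 2 ^ (1 - h) := by
    rw [eq_div_iff (by positivity), mul_comm, f1]
  rw [g3]
  have h2 : (2 : ℝ) ^ (1 - h) ≠ 0 := by positivity
  rw [show 1 - 2 * h = -(2 * h - 1) by ring]
  field_simp
  ring

end AdS

/-! ### Identification of the modified propagator with a Legendre function. -/

namespace AdS

theorem ordinaryHypergeometric_ofReal (h t : ℝ) :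
    ordinaryHypergeometric ((h : ℂ) / 2) ((h : ℂ) / 2 + 1 / 2) ((h : ℂ) + 1 / 2) (t : ℂ) =
      ((∑' n, hgCoeff h n * t ^ n : ℝ) : ℂ) := by
  rw [ordinaryHypergeometric_eq_tsum, Complex.ofReal_tsum]
  refine tsum_congr fun n => ?_
  simp only [hgCoeff, ordinaryHypergeometricCoefficient, ascPochhammer_eval_eq_prod_add,
    smul_eq_mul]
  push_cast
  rfl

theorem G_eq_propFun {h u z₀ u₀ : ℝ} {z : ℂ} {x : ℝ} (hx : 1 < x)
    (hxi : xi u z u₀ z₀ = (x⁻¹ : ℝ)) :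
    G h u z u₀ z₀ = ((2 ^ (-h) * propFun h x : ℝ) : ℂ) := by
  have hx0 : 0 < x := by linarith
  have e1 : ((x⁻¹ : ℝ) : ℂ) / 2 = (((2 * x)⁻¹ : ℝ) : ℂ) := by push_cast; field_simp
  have e2 : ((x⁻¹ : ℝ) : ℂ) ^ 2 = (((x ^ 2)⁻¹ : ℝ) : ℂ) := by push_cast; field_simp
  rw [G, hxi, e1, e2, ordinaryHypergeometric_ofReal, ← Complex.ofReal_cpow (by positivity),
    ← Complex.ofReal_mul, propFun, invSeries_eq hx0, Real.inv_rpow (by positivity),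
    ← Real.rpow_neg (by positivity), Real.mul_rpow two_pos.le hx0.le, mul_assoc]

theorem GtildeGeneric_eq {h : ℝ} (hh : 0 < h) (hn : ∀ n : ℕ, h ≠ n + 1 / 2) {u z₀ u₀ : ℝ}
    {z : ℂ} {x : ℝ} (hx : 1 < x) (hxi : xi u z u₀ z₀ = (x⁻¹ : ℝ)) :
    GtildeGeneric h u z u₀ z₀ = propConst h * legendreFn h x := by
  rw [GtildeGeneric, legendreFn_eq hh hn hx, G_eq_propFun hx hxi, G_eq_propFun hx hxi]
  have g1 : Complex.Gamma (1 - 2 * h) = (Real.Gamma (1 - 2 * h) : ℝ) := by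
    rw [← Complex.Gamma_ofReal]; push_cast; rfl
  have g2 : Complex.Gamma (1 - h) = (Real.Gamma (1 - h) : ℝ) := by
    rw [← Complex.Gamma_ofReal]; push_cast; rfl
  have g3 : Complex.Gamma (2 * h - 1) = (Real.Gamma (2 * h - 1) : ℝ) := by
    rw [← Complex.Gamma_ofReal]; push_cast; rfl
  have g4 : (4 : ℂ) ^ (h : ℂ) = ((4 ^ h : ℝ) : ℂ) := by
    rw [Complex.ofReal_cpow (by norm_num)]; push_cast; rfl
  have g5 : (4 : ℂ) ^ (1 - (h : ℂ)) = ((4 ^ (1 - h) : ℝ) : ℂ) := by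
    rw [Complex.ofReal_cpow (by norm_num)]; push_cast; rfl
  rw [g1, g2, g3, g4, g5, Complex.Gamma_ofReal]
  push_cast
  rfl

theorem continuousAt_propConst {h : ℝ} (hh : 0 < h) : ContinuousAt propConst h := by
  have hd : ∀ r : ℝ, 0 < r → ContinuousAt Complex.Gamma r := fun r hr =>
    (Complex.differentiableAt_Gamma _ fun m hm => by
      have : r = -(m : ℝ) := by exact_mod_cast hm
      have : (0 : ℝ) ≤ m := by positivity
      linarith).continuousAt
  have h1 : ContinuousAt (fun k : ℝ => Complex.Gamma (2 * k)) h := by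
    have := hd (2 * h) (by linarith)
    push_cast at this
    exact ContinuousAt.comp (f := fun k : ℝ => (2 * k : ℂ)) this (by fun_prop)
  have h2 : ContinuousAt (fun k : ℝ => Complex.Gamma k) h :=
    ContinuousAt.comp (f := fun k : ℝ => (k : ℂ)) (hd h hh) (by fun_prop)
  have h3 : ContinuousAt (fun k : ℝ => (4 : ℂ) ^ (k : ℂ)) h :=
    ContinuousAt.const_cpow (by fun_prop) (Or.inl (by norm_num))
  have hG : Complex.Gamma h ≠ 0 := by
    rw [Complex.Gamma_ofReal]; exact_mod_cast (Real.Gamma_pos_of_pos hh).ne'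
  unfold propConst
  refine ContinuousAt.mul (ContinuousAt.div continuousAt_const h3 ?_)
    (ContinuousAt.div h1 (h2.mul h2) (mul_ne_zero hG hG))
  simp

theorem continuousAt_legendreFn {x : ℝ} (hx : 1 ≤ x) {h : ℝ} (hh : 0 < h) :
    ContinuousAt (fun k => legendreFn k x) h := by
  unfold legendreFn
  refine ContinuousAt.mul ?_ (continuousAt_mehlerInt hx hh)
  refine Complex.continuous_ofReal.continuousAt.comp ?_
  exact ContinuousAt.div_const (ContinuousAt.rpow continuousAt_const continuousAt_id
    (Or.inl two_ne_zero)) _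

theorem eventually_not_half_integer {h : ℝ} (hh : 0 < h) :
    ∀ᶠ k : ℝ in 𝓝[≠] h, 0 < k ∧ ∀ n : ℕ, k ≠ n + 1 / 2 := by
  have h1 : ∀ᶠ k : ℝ in 𝓝[≠] h, 0 < k := nhdsWithin_le_nhds (lt_mem_nhds hh)
  have h2 : ∀ᶠ k : ℝ in 𝓝[≠] h, ∀ n : ℕ, k ≠ n + 1 / 2 := by
    have hfin : ∀ᶠ k : ℝ in 𝓝 h, k < h + 1 := gt_mem_nhds (by linarith)
    obtain ⟨N, hN⟩ := exists_nat_gt (h + 1)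
    have hF : (((fun n : ℕ => (n : ℝ) + 1 / 2) '' Set.Iio N) \ {h}).Finite :=
      ((Set.finite_Iio N).image _).sdiff
    have h3 : ∀ᶠ k : ℝ in 𝓝 h, k ∉ ((fun n : ℕ => (n : ℝ) + 1 / 2) '' Set.Iio N) \ {h} :=
      hF.isClosed.isOpen_compl.mem_nhds (by simp)
    filter_upwards [nhdsWithin_le_nhds hfin, nhdsWithin_le_nhds h3, self_mem_nhdsWithin]
      with k k1 k2 k3 n hn
    refine k2 ⟨⟨n, ?_, hn.symm⟩, k3⟩
    have : (n : ℝ) < N := by linarith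
    exact_mod_cast this
  exact h1.and h2

/-- At half-integral h the limit exists because the Legendre side is continuous in h and agrees with
the generic combination in a punctured neighbourhood. -/
theorem Gtilde_eq {h : ℝ} (hh : 0 < h) {u z₀ u₀ : ℝ} {z : ℂ} {x : ℝ} (hx : 1 < x)
    (hxi : xi u z u₀ z₀ = (x⁻¹ : ℝ)) :
    Gtilde h u z u₀ z₀ = propConst h * legendreFn h x := by
  unfold Gtilde
  split_ifs with hc
  · refine Tendsto.limUnder_eq ?_
    have h1 : Tendsto (fun k => propConst k * legendreFn k x) (𝓝[≠] h)
        (𝓝 (propConst h * legendreFn h x)) :=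
      ((continuousAt_propConst hh).mul (continuousAt_legendreFn hx.le hh)).tendsto.mono_left
        nhdsWithin_le_nhds
    refine h1.congr' ?_
    filter_upwards [eventually_not_half_integer hh] with k hk
    exact (GtildeGeneric_eq hk.1 hk.2 hx hxi).symm
  · exact GtildeGeneric_eq hh (fun n hn => hc ⟨n, hn⟩) hx hxi

/-- The inverse of the invariant `ξ` at `z = z₀ + i y`. -/
def xiInv (u₀ u y : ℝ) : ℝ := (u ^ 2 + u₀ ^ 2 - y ^ 2) / (2 * u * u₀)

theorem one_lt_xiInv {u₀ u y : ℝ} (hu₀ : 0 < u₀) (hu : 0 < u) (hy : |y| < u₀ - u) :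
    1 < xiInv u₀ u y := by
  have : y ^ 2 < (u₀ - u) ^ 2 := sq_lt_sq' (by linarith [(abs_lt.1 hy).1]) (abs_lt.1 hy).2
  rw [xiInv, lt_div_iff₀ (by positivity)]
  nlinarith

theorem xi_eq {u₀ u y z₀ : ℝ} :
    xi u (z₀ + Complex.I * y) u₀ z₀ = ((xiInv u₀ u y)⁻¹ : ℝ) := by
  rw [xi, xiInv, inv_div]
  push_cast
  congr 1
  rw [add_sub_cancel_left, mul_pow, Complex.I_sq]; ring

theorem Gtilde_eq_legendreFn {h : ℝ} (hh : 0 < h) {u₀ u y : ℝ} (z₀ : ℝ) (hu₀ : 0 < u₀)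
    (hu : 0 < u) (hy : |y| < u₀ - u) :
    Gtilde h u (z₀ + Complex.I * y) u₀ z₀ = propConst h * legendreFn h (xiInv u₀ u y) :=
  Gtilde_eq hh (one_lt_xiInv hu₀ hu hy) xi_eq

end AdS

/-! ### The kernel of the w-integral, and path independence. -/

namespace AdS

/-- The product equals ((S + b)/2)² - (s - (S - b)/2)². It can be a nonpositive real only if s is
real, and it is positive for real s strictly between -b and S. Hence principal powers of the product
are analytic off the two outer rays. -/
theorem sub_mul_add_mem_slitPlane {S b : ℝ} {s : ℂ}
    (hs : s.im ≠ 0 ∨ -b < s.re ∧ s.re < S) : (S - s) * (b + s) ∈ Complex.slitPlane := by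
  rw [Complex.mem_slitPlane_iff]
  have hre : ((S - s) * (b + s)).re = (S - s.re) * (b + s.re) + s.im ^ 2 := by
    simp [Complex.mul_re]; ring
  have him : ((S - s) * (b + s)).im = s.im * (S - b - 2 * s.re) := by
    simp [Complex.mul_im]; ring
  rw [hre, him]
  by_cases h0 : s.im = 0
  · left
    rcases hs with h | h
    · exact absurd h0 h
    · rw [h0]; nlinarith [mul_pos (sub_pos.2 h.2) (by linarith [h.1] : 0 < b + s.re)]
  · by_cases h1 : S - b - 2 * s.re = 0
    · left
      have : s.re = (S - b) / 2 := by linarith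
      rw [this]
      have : 0 < s.im ^ 2 := by positivity
      nlinarith [sq_nonneg (S + b)]
    · exact Or.inr (mul_ne_zero h0 h1)

/-- The integrand of the `w`-integral at fixed `(u, z)`, in the variable `s = -i (w - z)` shifted
by `e`. Here `S` and `-b` are the endpoints of the integration in `w`. -/
def kern (h u S b e : ℝ) (s : ℂ) : ℂ :=
  ((S - s) * (b + s)) ^ ((h - 1 : ℝ) : ℂ) *
    ((u - (s + e * Complex.I)) * (u + (s + e * Complex.I))) ^ ((-h : ℝ) : ℂ)

theorem differentiableAt_kern {h u S b e : ℝ} {s : ℂ}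
    (h1 : s.im ≠ 0 ∨ -b < s.re ∧ s.re < S) (h2 : s.im + e ≠ 0 ∨ -u < s.re ∧ s.re < u) :
    DifferentiableAt ℂ (kern h u S b e) s := by
  have m1 := sub_mul_add_mem_slitPlane h1
  have m2 : ((u : ℂ) - (s + e * Complex.I)) * (u + (s + e * Complex.I)) ∈ Complex.slitPlane :=
    sub_mul_add_mem_slitPlane (by simpa using h2)
  unfold kern
  exact (DifferentiableAt.cpow_const (f := fun s : ℂ => (S - s) * (b + s)) (by fun_prop) m1).mul
    (DifferentiableAt.cpow_const (f := fun s : ℂ => (u - (s + e * Complex.I)) *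
      (u + (s + e * Complex.I))) (by fun_prop) m2)

theorem norm_kern (h u S b e : ℝ) (s : ℂ) :
    ‖kern h u S b e s‖ = ‖(S : ℂ) - s‖ ^ (h - 1) * ‖(b : ℂ) + s‖ ^ (h - 1) *
      (‖(u : ℂ) - (s + e * Complex.I)‖ * ‖(u : ℂ) + (s + e * Complex.I)‖) ^ (-h) := by
  rw [kern, norm_mul, Complex.norm_cpow_real, Complex.norm_cpow_real, norm_mul, norm_mul,
    Real.mul_rpow (norm_nonneg _) (norm_nonneg _)]

/-- Near the endpoint S only the factor S - ζ degenerates. This provides the η^(h-1) bound that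
`tendsto_primitive_sub` needs. -/
theorem norm_kern_le {h u S b e c m M η : ℝ} (hh : 0 < h) (hb : 0 < b)
    (hm : 0 < m) (hη : 0 < η) (hc : 0 < c) {ζ : ℂ} (h1 : m * η ≤ ‖(S : ℂ) - ζ‖)
    (h2 : ‖(S : ℂ) - ζ‖ ≤ M * η) (hre : 0 ≤ ζ.re) (hζ : ‖ζ‖ ≤ 2 * S)
    (hΦ : c ≤ ‖(u : ℂ) - (ζ + e * Complex.I)‖ * ‖(u : ℂ) + (ζ + e * Complex.I)‖) :
    ‖kern h u S b e ζ‖ ≤ ((m ^ (h - 1) + M ^ (h - 1)) * (b ^ (h - 1) + (b + 2 * S) ^ (h - 1)) *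
      c ^ (-h)) * η ^ (h - 1) := by
  have hM : 0 < M := by
    by_contra hM
    have := mul_pos hm hη
    nlinarith
  have hb1 : b ≤ ‖(b : ℂ) + ζ‖ := by
    refine le_trans ?_ (Complex.re_le_norm _)
    simpa using hre
  have hb2 : ‖(b : ℂ) + ζ‖ ≤ b + 2 * S := by
    refine (norm_add_le _ _).trans ?_
    rw [Complex.norm_real, Real.norm_of_nonneg hb.le]; linarith
  have e1 : ‖(S : ℂ) - ζ‖ ^ (h - 1) ≤ (m ^ (h - 1) + M ^ (h - 1)) * η ^ (h - 1) := by
    have := rpow_le_add_rpow (by positivity) h1 h2 (h - 1)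
    rwa [Real.mul_rpow hm.le hη.le, Real.mul_rpow hM.le hη.le, ← add_mul] at this
  have e2 := rpow_le_add_rpow hb hb1 hb2 (h - 1)
  have e3 := Real.rpow_le_rpow_of_nonpos hc hΦ (by linarith : -h ≤ 0)
  have hS : 0 ≤ b + 2 * S := hb.le.trans (hb1.trans hb2)
  rw [norm_kern]
  calc _ ≤ ((m ^ (h - 1) + M ^ (h - 1)) * η ^ (h - 1)) * (b ^ (h - 1) + (b + 2 * S) ^ (h - 1)) *
        c ^ (-h) := by gcongr
    _ = _ := by ring

/-- An arc from `0` to `S` in the upper (`σ = 1`) or lower (`σ = -1`) half-plane. -/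
def arcPath (σ S τ : ℝ) : ℂ := S * (τ + σ * τ * (1 - τ) * Complex.I)

/-- The derivative of `arcPath`. -/
def arcPathDeriv (σ S τ : ℝ) : ℂ := S * (1 + σ * (1 - 2 * τ) * Complex.I)

theorem arcPath_re (σ S τ : ℝ) : (arcPath σ S τ).re = S * τ := by simp [arcPath]

theorem arcPath_im (σ S τ : ℝ) : (arcPath σ S τ).im = S * (σ * τ * (1 - τ)) := by
  have : arcPath σ S τ = ((S * τ : ℝ) : ℂ) + ((S * (σ * τ * (1 - τ)) : ℝ) : ℂ) * Complex.I := by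
    rw [arcPath]; push_cast; ring
  rw [this]; simp

theorem hasDerivAt_arcPath (σ S τ : ℝ) : HasDerivAt (arcPath σ S) (arcPathDeriv σ S τ) τ := by
  have h0 : HasDerivAt (fun τ : ℝ => (τ : ℂ)) 1 τ := Complex.ofRealCLM.hasDerivAt
  have := ((h0.add (((h0.const_mul (σ : ℂ)).mul (h0.const_sub 1)).mul_const Complex.I)).const_mul
    (S : ℂ))
  refine this.congr_deriv ?_
  rw [arcPathDeriv]; ring

theorem arcPath_zero (σ S : ℝ) : arcPath σ S 0 = 0 := by simp [arcPath]

theorem continuous_arcPath (σ S : ℝ) : Continuous (arcPath σ S) := by unfold arcPath; fun_prop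

theorem continuous_arcPathDeriv (σ S : ℝ) : Continuous (arcPathDeriv σ S) := by
  unfold arcPathDeriv; fun_prop

/-- Bounds for points of the lens between the arcs `arcPath 1 S` and `arcPath (-1) S`. -/
theorem lens_bounds {S τ : ℝ} (hS : 0 < S) (hτ : τ ∈ Ioo (0 : ℝ) 1) {ζ : ℂ} (hre : ζ.re = S * τ)
    (him : |ζ.im| ≤ S * (τ * (1 - τ))) :
    S * (1 - τ) ≤ ‖(S : ℂ) - ζ‖ ∧ ‖(S : ℂ) - ζ‖ ≤ 2 * S * (1 - τ) ∧ 0 ≤ ζ.re ∧ ‖ζ‖ ≤ 2 * S := by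
  obtain ⟨h0, h1⟩ := hτ
  have h2 : 0 < S * τ := mul_pos hS h0
  have h3 : 0 < S * (1 - τ) := mul_pos hS (by linarith)
  have e1 : ((S : ℂ) - ζ).re = S * (1 - τ) := by simp [hre]; ring
  have e2 : |((S : ℂ) - ζ).im| ≤ S * (1 - τ) := by
    simp only [Complex.sub_im, Complex.ofReal_im, zero_sub, abs_neg]
    nlinarith
  refine ⟨?_, ?_, by rw [hre]; exact h2.le, ?_⟩
  · rw [← e1]; exact Complex.re_le_norm _
  · refine (Complex.norm_le_abs_re_add_abs_im _).trans ?_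
    rw [e1, abs_of_pos h3]; linarith
  · refine (Complex.norm_le_abs_re_add_abs_im _).trans ?_
    rw [hre, abs_of_pos h2]; nlinarith

theorem mul_lt_of_mem_Icc {a r S : ℝ} (h0 : 0 ≤ a) (h1 : a ≤ 1) (hS : 0 < S) (hr : r < S) :
    a * r < S := by
  rcases le_total r 0 with h | h
  · exact (mul_nonpos_of_nonneg_of_nonpos h0 h).trans_lt hS
  · exact (mul_le_of_le_one_left h h1).trans_lt hr

theorem neg_lt_mul_of_mem_Icc {a r S : ℝ} (h0 : 0 ≤ a) (h1 : a ≤ 1) (hS : 0 < S) (hr : -S < r) :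
    -S < a * r := by
  have := mul_lt_of_mem_Icc h0 h1 hS (by linarith : -r < S)
  linarith

theorem segment_re_im {z₁ z₂ ζ : ℂ} (hζ : ζ ∈ segment ℝ z₁ z₂) :
    ∃ θ ∈ Icc (0 : ℝ) 1, ζ.re = (1 - θ) * z₁.re + θ * z₂.re ∧
      ζ.im = (1 - θ) * z₁.im + θ * z₂.im := by
  obtain ⟨a, b, ha, hb, hab, rfl⟩ := hζ
  obtain rfl : a = 1 - b := by linarith
  exact ⟨b, ⟨hb, by linarith⟩, by simp, by simp⟩

theorem integrableOn_of_norm_le_rpow {f : ℝ → ℂ} {C h : ℝ} (hh : 0 < h)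
    (hf : ContinuousOn f (Ioo 0 1)) (hC : ∀ τ ∈ Ioo (0 : ℝ) 1, ‖f τ‖ ≤ C * (1 - τ) ^ (h - 1)) :
    IntegrableOn f (Ioo 0 1) := by
  have h1 : IntegrableOn (fun τ : ℝ => C * (1 - τ) ^ (h - 1)) (Ioo 0 1) := by
    have := (intervalIntegral.intervalIntegrable_rpow' (a := 0) (b := 1) (r := h - 1)
      (by linarith)).comp_sub_left 1
    rw [sub_self, sub_zero] at this
    exact (((intervalIntegrable_iff_integrableOn_Ioo_of_le zero_le_one).1 this.symm)).const_mul C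
  exact Integrable.mono' h1 (hf.aestronglyMeasurable measurableSet_Ioo)
    ((ae_restrict_iff' measurableSet_Ioo).2 (Eventually.of_forall hC))

theorem norm_arcPathDeriv_le {σ S τ : ℝ} (hσ : |σ| ≤ 1) (hS : 0 < S) (hτ : τ ∈ Ioo (0 : ℝ) 1) :
    ‖arcPathDeriv σ S τ‖ ≤ 2 * S := by
  rw [arcPathDeriv, norm_mul, Complex.norm_real, Real.norm_of_nonneg hS.le, mul_comm]
  gcongr
  refine (norm_add_le _ _).trans ?_
  have : (σ : ℂ) * (1 - 2 * τ) = ((σ * (1 - 2 * τ) : ℝ) : ℂ) := by push_cast; ring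
  rw [norm_mul, Complex.norm_I, mul_one, norm_one, this, Complex.norm_real, Real.norm_eq_abs,
    abs_mul]
  have h2 : |1 - 2 * τ| ≤ 1 := abs_le.2 ⟨by linarith [hτ.2], by linarith [hτ.1]⟩
  nlinarith [abs_nonneg σ, abs_nonneg (1 - 2 * τ)]

/-- Path independence of the integral of `kern` for the arcs `arcPath σ₁ S` and `arcPath σ₂ S`,
if the lens between them contains no singularities. -/
theorem integral_kern_arcPath_eq {h u S b e c σ₁ σ₂ : ℝ} (hh : 0 < h) (hS : 0 < S) (hb : 0 < b)
    (hc : 0 < c) (h₁ : |σ₁| ≤ 1) (h₂ : |σ₂| ≤ 1) {U : Set ℂ} (hU : IsOpen U)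
    (hstar : StarConvex ℝ 0 U) (hd : DifferentiableOn ℂ (kern h u S b e) U) (h0 : (0 : ℂ) ∈ U)
    (hlens : ∀ τ ∈ Ioo (0 : ℝ) 1, ∀ θ ∈ Icc (0 : ℝ) 1, ∀ ζ : ℂ, ζ.re = S * τ →
      ζ.im = S * (((1 - θ) * σ₁ + θ * σ₂) * τ * (1 - τ)) →
      ζ ∈ U ∧ c ≤ ‖(u : ℂ) - (ζ + e * Complex.I)‖ * ‖(u : ℂ) + (ζ + e * Complex.I)‖) :
    ∫ τ in Ioo (0 : ℝ) 1, kern h u S b e (arcPath σ₁ S τ) * arcPathDeriv σ₁ S τ =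
      ∫ τ in Ioo (0 : ℝ) 1, kern h u S b e (arcPath σ₂ S τ) * arcPathDeriv σ₂ S τ := by
  obtain ⟨F, hF⟩ := hstar.exists_hasDerivAt_of_differentiableOn hU hd
  set A := ((S ^ (h - 1) + (2 * S) ^ (h - 1)) * (b ^ (h - 1) + (b + 2 * S) ^ (h - 1)) * c ^ (-h))
    with hA
  have hbound : ∀ τ ∈ Ioo (0 : ℝ) 1, ∀ θ ∈ Icc (0 : ℝ) 1, ∀ ζ : ℂ, ζ.re = S * τ →
      ζ.im = S * (((1 - θ) * σ₁ + θ * σ₂) * τ * (1 - τ)) →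
      ζ ∈ U ∧ ‖kern h u S b e ζ‖ ≤ A * (1 - τ) ^ (h - 1) := by
    intro τ hτ θ hθ ζ hre him
    obtain ⟨hζU, hζc⟩ := hlens τ hτ θ hθ ζ hre him
    have hσ : |(1 - θ) * σ₁ + θ * σ₂| ≤ 1 := by
      rw [abs_le] at *
      constructor <;> nlinarith [hθ.1, hθ.2, h₁.1, h₁.2, h₂.1, h₂.2]
    have hτ2 : 0 < τ * (1 - τ) := mul_pos hτ.1 (by linarith [hτ.2])
    have him' : |ζ.im| ≤ S * (τ * (1 - τ)) := by
      rw [him, abs_mul, abs_of_pos hS, mul_assoc, abs_mul, abs_of_pos hτ2]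
      exact mul_le_mul_of_nonneg_left (mul_le_of_le_one_left hτ2.le hσ) hS.le
    obtain ⟨l1, l2, l3, l4⟩ := lens_bounds hS hτ hre him'
    exact ⟨hζU, norm_kern_le hh hb hS (by linarith [hτ.2]) hc l1 l2 l3 l4 hζc⟩
  have hpath : ∀ θ ∈ Icc (0 : ℝ) 1, ∀ σ, σ = (1 - θ) * σ₁ + θ * σ₂ → |σ| ≤ 1 →
      Tendsto (fun τ => F (arcPath σ S τ)) (𝓝[<] 1)
        (𝓝 (F 0 + ∫ τ in Ioo (0 : ℝ) 1, kern h u S b e (arcPath σ S τ) * arcPathDeriv σ S τ)) := by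
    intro θ hθ σ hσ hσ1
    have hmem : ∀ τ ∈ Ioo (0 : ℝ) 1, arcPath σ S τ ∈ U ∧
        ‖kern h u S b e (arcPath σ S τ)‖ ≤ A * (1 - τ) ^ (h - 1) := fun τ hτ =>
      hbound τ hτ θ hθ _ (arcPath_re _ _ _) (by rw [arcPath_im, hσ])
    have := tendsto_primitive_comp_path (γ := arcPath σ S) (γ' := arcPathDeriv σ S) hF
      (fun τ _ => hasDerivAt_arcPath σ S τ) ?_ ?_
    · rwa [arcPath_zero] at this
    · intro τ hτ
      rcases hτ.1.eq_or_lt with h | h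
      · rw [← h, arcPath_zero]; exact h0
      · exact (hmem τ ⟨h, hτ.2⟩).1
    · refine integrableOn_of_norm_le_rpow (C := A * (2 * S)) hh ?_ ?_
      · exact (hd.continuousOn.comp (continuous_arcPath σ S).continuousOn
          fun τ hτ => (hmem τ hτ).1).mul (continuous_arcPathDeriv σ S).continuousOn
      · intro τ hτ
        rw [norm_mul]
        have h1 := (hmem τ hτ).2
        calc _ ≤ (A * (1 - τ) ^ (h - 1)) * (2 * S) :=
              mul_le_mul h1 (norm_arcPathDeriv_le hσ1 hS hτ) (norm_nonneg _)
                ((norm_nonneg _).trans h1)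
          _ = _ := by ring
  have t1 := hpath 0 (by simp) σ₁ (by ring) h₁
  have t2 := hpath 1 (by simp) σ₂ (by ring) h₂
  have t3 := t2.sub t1
  have hη : Tendsto (fun τ : ℝ => 1 - τ) (𝓝[<] 1) (𝓝[>] 0) := by
    refine tendsto_nhdsWithin_iff.2 ⟨?_, ?_⟩
    · have : ContinuousAt (fun τ : ℝ => 1 - τ) 1 := by fun_prop
      have h2 := this.tendsto
      rw [sub_self] at h2
      exact h2.mono_left nhdsWithin_le_nhds
    · filter_upwards [self_mem_nhdsWithin] with τ hτ
      have : τ < 1 := hτ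
      exact sub_pos.2 this
  have hev : ∀ᶠ τ in 𝓝[<] (1 : ℝ), τ ∈ Ioo (0 : ℝ) 1 := Ioo_mem_nhdsLT zero_lt_one
  -- Both integrals are limits of one primitive. At equal τ the arcs are joined by a vertical
  -- segment inside the lens, of length at most 2S(1 - τ), so the two limits agree.
  have t4 := tendsto_primitive_sub (l := 𝓝[<] (1 : ℝ)) hF (z₁ := arcPath σ₁ S) (z₂ := arcPath σ₂ S)
    (η := fun τ => 1 - τ) (A := A) (B := 2 * S) hh hη ?_ ?_
  · have := tendsto_nhds_unique t3 t4
    linear_combination -this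
  · filter_upwards [hev] with τ hτ ζ hζ
    obtain ⟨θ, hθ, hre, him⟩ := segment_re_im hζ
    rw [arcPath_re, arcPath_re] at hre
    rw [arcPath_im, arcPath_im] at him
    exact hbound τ hτ θ hθ ζ (by rw [hre]; ring) (by rw [him]; ring)
  · filter_upwards [hev] with τ hτ
    have : arcPath σ₂ S τ - arcPath σ₁ S τ =
        ((S * ((σ₂ - σ₁) * τ * (1 - τ)) : ℝ) : ℂ) * Complex.I := by
      simp only [arcPath]; push_cast; ring
    rw [this, norm_mul, Complex.norm_I, mul_one, Complex.norm_real, Real.norm_eq_abs, abs_mul,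
      abs_of_pos hS, abs_mul, abs_mul, abs_of_pos hτ.1, abs_of_pos (by linarith [hτ.2] : 0 < 1 - τ)]
    have hσσ : |σ₂ - σ₁| ≤ 2 := (abs_sub _ _).trans (by linarith)
    have h3 : |σ₂ - σ₁| * τ ≤ 2 := by nlinarith [hτ.1, hτ.2, abs_nonneg (σ₂ - σ₁)]
    calc S * (|σ₂ - σ₁| * τ * (1 - τ)) ≤ S * (2 * (1 - τ)) := by
          have : 0 ≤ 1 - τ := by linarith [hτ.2]
          gcongr
      _ = _ := by ring

/-- For `e ≠ 0` the integral of `kern` over the real segment may be moved to an arc on the side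
of `e`. -/
theorem integral_kern_shift {h u S b e σ : ℝ} (hh : 0 < h) (hu : 0 < u) (hS : 0 < S) (hb : 0 < b)
    (hσ : |σ| ≤ 1) (he : e ≠ 0) (hσe : 0 ≤ σ * e) :
    ∫ τ in Ioo (0 : ℝ) 1, kern h u S b e (arcPath 0 S τ) * arcPathDeriv 0 S τ =
      ∫ τ in Ioo (0 : ℝ) 1, kern h u S b e (arcPath σ S τ) * arcPathDeriv σ S τ := by
  have he2 : 0 < e * e := mul_self_pos.2 he
  -- The domain is the part of the strip -b < Re s < S lying beyond the line Im s = -e, on which the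
  -- branch points ±u - ie lie, on the side containing 0. Being convex, it is star-shaped about 0.
  refine integral_kern_arcPath_eq (c := |e| * u) (U := {s : ℂ | -b < s.re ∧ s.re < S ∧
    0 < (s.im + e) * e}) hh hS hb (by positivity) (by simp) hσ ?_ ?_ ?_ ?_ ?_
  · exact (isOpen_lt continuous_const Complex.continuous_re).inter
      ((isOpen_lt Complex.continuous_re continuous_const).inter (isOpen_lt continuous_const
        ((Complex.continuous_im.add continuous_const).mul continuous_const)))
  · rw [starConvex_zero_iff]
    rintro s ⟨h1, h2, h3⟩ a ha0 ha1
    simp only [mem_ofPred_eq, Complex.real_smul, Complex.re_ofReal_mul, Complex.im_ofReal_mul]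
    refine ⟨neg_lt_mul_of_mem_Icc ha0 ha1 hb h1, mul_lt_of_mem_Icc ha0 ha1 hS h2, ?_⟩
    have : (a * s.im + e) * e = a * ((s.im + e) * e) + (1 - a) * (e * e) := by ring
    rw [this]
    rcases ha0.eq_or_lt with rfl | ha0
    · simpa using he
    · have := mul_pos ha0 h3
      nlinarith
  · rintro s ⟨h1, h2, h3⟩
    refine (differentiableAt_kern (Or.inr ⟨h1, h2⟩)
      (Or.inl fun h0 => ?_)).differentiableWithinAt
    rw [h0] at h3; simp at h3
  · exact ⟨by simpa using hb, by simpa using hS, by simpa using he2⟩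
  · intro τ hτ θ hθ ζ hre him
    have hτ2 : 0 < τ * (1 - τ) := mul_pos hτ.1 (by linarith [hτ.2])
    have him' : 0 ≤ ζ.im * e := by
      have : ζ.im * e = S * θ * (τ * (1 - τ)) * (σ * e) := by rw [him]; ring
      rw [this]
      have := hθ.1
      positivity
    have hre0 : 0 ≤ ζ.re := by rw [hre]; have := hτ.1; positivity
    refine ⟨⟨by linarith, by rw [hre]; nlinarith [hτ.2], by nlinarith⟩, ?_⟩
    have k1 : |e| ≤ ‖(u : ℂ) - (ζ + e * Complex.I)‖ := by
      refine le_trans ?_ (Complex.abs_im_le_norm _)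
      have : ((u : ℂ) - (ζ + e * Complex.I)).im = -(ζ.im + e) := by simp
      rw [this, abs_neg, ← sq_le_sq]
      nlinarith [sq_nonneg ζ.im]
    have k2 : u ≤ ‖(u : ℂ) + (ζ + e * Complex.I)‖ := by
      refine le_trans ?_ (Complex.re_le_norm _)
      simpa using hre0
    gcongr

/-- For `u > S` the lens between the upper and the lower arc contains no singularities. -/
theorem integral_kern_eq_of_lt {h u S b : ℝ} (hh : 0 < h) (hS : 0 < S) (hSb : S ≤ b)
    (hu : S < u) :
    ∫ τ in Ioo (0 : ℝ) 1, kern h u S b 0 (arcPath 1 S τ) * arcPathDeriv 1 S τ =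
      ∫ τ in Ioo (0 : ℝ) 1, kern h u S b 0 (arcPath (-1) S τ) * arcPathDeriv (-1) S τ := by
  have hu0 : 0 < u := hS.trans hu
  refine integral_kern_arcPath_eq (c := (u - S) * u) (U := {s : ℂ | -S < s.re ∧ s.re < S})
    hh hS (hS.trans_le hSb) (mul_pos (by linarith) hu0) (by simp) (by simp) ?_ ?_ ?_ ?_ ?_
  · exact (isOpen_lt continuous_const Complex.continuous_re).inter
      (isOpen_lt Complex.continuous_re continuous_const)
  · rw [starConvex_zero_iff]
    rintro s ⟨h1, h2⟩ a ha0 ha1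
    simp only [mem_ofPred_eq, Complex.real_smul, Complex.re_ofReal_mul]
    exact ⟨neg_lt_mul_of_mem_Icc ha0 ha1 hS h1, mul_lt_of_mem_Icc ha0 ha1 hS h2⟩
  · rintro s ⟨h1, h2⟩
    exact (differentiableAt_kern (Or.inr ⟨by linarith, h2⟩)
      (Or.inr ⟨by linarith, by linarith⟩)).differentiableWithinAt
  · exact ⟨by simpa using hS, by simpa using hS⟩
  · intro τ hτ θ hθ ζ hre him
    have hre0 : 0 ≤ ζ.re := by rw [hre]; have := hτ.1; positivity
    have hreS : ζ.re < S := by rw [hre]; nlinarith [hτ.2]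
    refine ⟨⟨by linarith, hreS⟩, ?_⟩
    have k1 : u - S ≤ ‖(u : ℂ) - (ζ + (0 : ℝ) * Complex.I)‖ := by
      refine le_trans ?_ (Complex.re_le_norm _)
      simp; linarith
    have k2 : u ≤ ‖(u : ℂ) + (ζ + (0 : ℝ) * Complex.I)‖ := by
      refine le_trans ?_ (Complex.re_le_norm _)
      simpa using hre0
    gcongr

end AdS

/-! ### The Apollonius circle around the branch point u. -/

theorem Complex.mul_cpow_of_arg_add_mem {x y : ℂ} (hx : x ≠ 0) (hy : y ≠ 0)
    (h : x.arg + y.arg ∈ Ioc (-Real.pi) Real.pi) (w : ℂ) : (x * y) ^ w = x ^ w * y ^ w := by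
  rw [Complex.cpow_def_of_ne_zero (mul_ne_zero hx hy), Complex.cpow_def_of_ne_zero hx,
    Complex.cpow_def_of_ne_zero hy, (Complex.log_mul_eq_add_log_iff hx hy).2 h, ← Complex.exp_add,
    add_mul]

namespace AdS

/-- For v ≠ 0 the arguments of x + iv and of (k + iv)⁻² have opposite signs, so their sum stays in
(-π, π) and the principal power is multiplicative although the second argument may exceed π/2 in
modulus. -/
theorem mul_inv_sq_cpow {x k : ℝ} (hx : 0 < x) (hk : 0 < k) (v : ℝ) (w : ℂ) :
    (((x : ℂ) + v * Complex.I) * (((k : ℂ) + v * Complex.I) ^ 2)⁻¹) ^ w =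
      ((x : ℂ) + v * Complex.I) ^ w * ((((k : ℂ) + v * Complex.I) ^ 2)⁻¹) ^ w := by
  have hx0 := Complex.slitPlane_ne_zero (add_mul_I_mem_slitPlane hx v)
  have hk0 := Complex.slitPlane_ne_zero (add_mul_I_mem_slitPlane hk v)
  set q := (((k : ℂ) + v * Complex.I) ^ 2)⁻¹ with hq
  have hN : 0 < Complex.normSq (((k : ℂ) + v * Complex.I) ^ 2) :=
    Complex.normSq_pos.2 (pow_ne_zero 2 hk0)
  have him : q.im = -(2 * k * v) / Complex.normSq (((k : ℂ) + v * Complex.I) ^ 2) := by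
    rw [hq, Complex.inv_im]
    congr 2
    simp [sq, Complex.mul_im]; ring
  have him2 : ((x : ℂ) + v * Complex.I).im = v := by simp
  have hre2 : 0 < ((x : ℂ) + v * Complex.I).re := by simpa using hx
  have hb := abs_lt.1 (Complex.abs_arg_lt_pi_div_two_iff.2 (Or.inl hre2))
  have hqa := Complex.neg_pi_lt_arg q
  have hqb := Complex.arg_le_pi q
  refine Complex.mul_cpow_of_arg_add_mem hx0 (inv_ne_zero (pow_ne_zero 2 hk0)) ?_ w
  have hpi := Real.pi_pos
  rcases lt_trichotomy v 0 with hv | hv | hv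
  · have h1 : ((x : ℂ) + v * Complex.I).arg < 0 := Complex.arg_neg_iff.2 (by rw [him2]; exact hv)
    have h2 : 0 ≤ q.arg := Complex.arg_nonneg_iff.2 (by
      rw [him]; apply div_nonneg _ hN.le; nlinarith)
    exact ⟨by linarith [hb.1], by linarith⟩
  · subst hv
    have h1 : q.arg = 0 := by
      rw [hq]
      have : (((k : ℂ) + (0 : ℝ) * Complex.I) ^ 2)⁻¹ = (((k ^ 2)⁻¹ : ℝ) : ℂ) := by
        push_cast; ring
      rw [this, Complex.arg_ofReal_of_nonneg (by positivity)]
    rw [h1]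
    exact ⟨by linarith [hb.1], by linarith [hb.2]⟩
  · have h1 : 0 ≤ ((x : ℂ) + v * Complex.I).arg :=
      Complex.arg_nonneg_iff.2 (by rw [him2]; exact hv.le)
    have h2 : q.arg < 0 := Complex.arg_neg_iff.2 (by
      rw [him]; apply div_neg_of_neg_of_pos _ hN; nlinarith)
    exact ⟨by linarith, by linarith [hb.2]⟩

/-- The circle through `S` with respect to which `u` and `-u` are mirror images. -/
def mobiusPath (S u v : ℝ) : ℂ :=
  (u + S * (v * Complex.I)) / (((S / u : ℝ) : ℂ) + v * Complex.I)

theorem hasDerivAt_mobiusPath {S u : ℝ} (hu : 0 < u) (hS : 0 < S) (v : ℝ) :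
    HasDerivAt (mobiusPath S u) (((S ^ 2 - u ^ 2) / u : ℝ) * Complex.I *
      ((((S / u : ℝ) : ℂ) + v * Complex.I) ^ 2)⁻¹) v := by
  have hc := Complex.slitPlane_ne_zero (add_mul_I_mem_slitPlane (div_pos hS hu) v)
  have h0 : HasDerivAt (fun v : ℝ => (v : ℂ) * Complex.I) Complex.I v := by
    simpa using (Complex.ofRealCLM.hasDerivAt (x := v)).mul_const Complex.I
  have huc : (u : ℂ) ≠ 0 := by exact_mod_cast hu.ne'
  have := ((h0.const_mul (S : ℂ)).const_add (u : ℂ)).div (h0.const_add (((S / u : ℝ) : ℂ))) hc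
  refine this.congr_deriv ?_
  rw [div_eq_mul_inv]
  congr 1
  push_cast
  field_simp
  ring

/-- With c = S/u + iv, the first product becomes a positive constant times (x + iv) c⁻², the second
a positive constant times (1 + v²) c⁻²: the latter has constant argument up to c⁻² because ±u are
mirror images in the circle. -/
theorem kern_mobiusPath {h u S b : ℝ} (hu : 0 < u) (huS : u < S) (hb : 0 < b) (v : ℝ) :
    kern h u S b 0 (mobiusPath S u v) * (((S ^ 2 - u ^ 2) / u : ℝ) * Complex.I *
      ((((S / u : ℝ) : ℂ) + v * Complex.I) ^ 2)⁻¹) =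
    Complex.I * ((u ^ (-h) * (b + S) ^ (h - 1) : ℝ) : ℂ) *
      mehlerKernel (h - 1) h ((b * S + u ^ 2) / (u * (b + S))) v := by
  have hS : 0 < S := hu.trans huS
  set x := (b * S + u ^ 2) / (u * (b + S)) with hx
  have hx0 : 0 < x := by positivity
  set D := (S ^ 2 - u ^ 2) / u with hD
  have hSu : 0 < S ^ 2 - u ^ 2 := by nlinarith
  have hD0 : 0 < D := by positivity
  have hv : 0 < 1 + v ^ 2 := by positivity
  set c := (((S / u : ℝ) : ℂ) + v * Complex.I) with hc
  have hc0 : c ≠ 0 := Complex.slitPlane_ne_zero (add_mul_I_mem_slitPlane (div_pos hS hu) v)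
  have huc : (u : ℂ) ≠ 0 := by exact_mod_cast hu.ne'
  have hcu : c * u = S + v * Complex.I * u := by
    rw [hc]; push_cast; field_simp
  have hbS : ((b : ℂ) + S) ≠ 0 := by
    have : b + S ≠ 0 := by positivity
    exact_mod_cast this
  have hDu : (D : ℂ) * u = S ^ 2 - u ^ 2 := by rw [hD]; push_cast; field_simp
  have hxu : (x : ℂ) * (u * (b + S)) = b * S + u ^ 2 := by rw [hx]; push_cast; field_simp
  have e1 : ((S : ℂ) - mobiusPath S u v) * (b + mobiusPath S u v) =
      ((D * (b + S) : ℝ) : ℂ) * (((x : ℂ) + v * Complex.I) * (c ^ 2)⁻¹) := by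
    have a1 : (S : ℂ) - mobiusPath S u v = D / c := by
      rw [mobiusPath, ← hc, eq_div_iff hc0, sub_mul, div_mul_cancel₀ _ hc0]
      apply mul_right_cancel₀ huc
      linear_combination (S : ℂ) * hcu - hDu
    have a2 : (b : ℂ) + mobiusPath S u v = (b + S) * (x + v * Complex.I) / c := by
      rw [mobiusPath, ← hc, eq_div_iff hc0, add_mul, div_mul_cancel₀ _ hc0]
      apply mul_right_cancel₀ huc
      linear_combination (b : ℂ) * hcu - hxu
    rw [a1, a2]; push_cast; field_simp
  have e2 : ((u : ℂ) - (mobiusPath S u v + (0 : ℝ) * Complex.I)) *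
      (u + (mobiusPath S u v + (0 : ℝ) * Complex.I)) =
      (((S ^ 2 - u ^ 2) * (1 + v ^ 2) : ℝ) : ℂ) * (c ^ 2)⁻¹ := by
    have a1 : (u : ℂ) - mobiusPath S u v = (S - u) * (1 - v * Complex.I) / c := by
      rw [mobiusPath, ← hc, eq_div_iff hc0, sub_mul, div_mul_cancel₀ _ hc0]
      linear_combination hcu
    have a2 : (u : ℂ) + mobiusPath S u v = (S + u) * (1 + v * Complex.I) / c := by
      rw [mobiusPath, ← hc, eq_div_iff hc0, add_mul, div_mul_cancel₀ _ hc0]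
      linear_combination hcu
    rw [Complex.ofReal_zero, zero_mul, add_zero, a1, a2]
    push_cast
    field_simp
    linear_combination (-(v : ℂ) ^ 2 * ((S:ℂ)^2 - u^2)) * Complex.I_sq
  have hq0 : (c ^ 2)⁻¹ ≠ 0 := inv_ne_zero (pow_ne_zero 2 hc0)
  -- The exponents h - 1 and -h and the 1 from the derivative of the path add to 0, so c disappears.
  have e3 : ((c ^ 2)⁻¹) ^ ((h - 1 : ℝ) : ℂ) * ((c ^ 2)⁻¹) ^ ((-h : ℝ) : ℂ) * (c ^ 2)⁻¹ = 1 := by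
    rw [← Complex.cpow_add _ _ hq0]
    have : ((h - 1 : ℝ) : ℂ) + ((-h : ℝ) : ℂ) = -1 := by push_cast; ring
    rw [this, Complex.cpow_neg_one, inv_mul_cancel₀ hq0]
  have e4 : (D * (b + S)) ^ (h - 1) * ((S ^ 2 - u ^ 2) * (1 + v ^ 2)) ^ (-h) * D =
      u ^ (-h) * (b + S) ^ (h - 1) * (1 + v ^ 2) ^ (-h) := by
    have : S ^ 2 - u ^ 2 = u * D := by rw [hD]; field_simp
    rw [this, Real.mul_rpow hD0.le (by positivity), Real.mul_rpow (by positivity) hv.le,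
      Real.mul_rpow hu.le hD0.le]
    have e5 : D ^ (h - 1) * D * D ^ (-h) = 1 := by
      rw [← Real.rpow_add_one hD0.ne', ← Real.rpow_add hD0]; ring_nf; simp
    linear_combination (b + S) ^ (h - 1) * u ^ (-h) * (1 + v ^ 2) ^ (-h) * e5
  rw [kern, e1, e2, Complex.ofReal_mul_cpow (by positivity),
    mul_inv_sq_cpow hx0 (div_pos hS hu), ← hc, Complex.ofReal_mul_cpow (by positivity),
    ← Complex.ofReal_cpow (by positivity), ← Complex.ofReal_cpow (by positivity), mehlerKernel]
  have e4c := congrArg (fun r : ℝ => (r : ℂ)) e4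
  simp only [Complex.ofReal_mul] at e4c ⊢
  linear_combination (((x : ℂ) + v * Complex.I) ^ ((h - 1 : ℝ) : ℂ) * Complex.I) * e4c +
    ((((D * (b + S)) ^ (h - 1) : ℝ) : ℂ) * ((((S ^ 2 - u ^ 2) * (1 + v ^ 2)) ^ (-h) : ℝ) : ℂ) * D *
      ((x : ℂ) + v * Complex.I) ^ ((h - 1 : ℝ) : ℂ) * Complex.I) * e3

end AdS

namespace AdS

theorem mobiusPath_re_im {S u : ℝ} (hu : 0 < u) (hS : 0 < S) (v : ℝ) :
    (mobiusPath S u v).re = S * (1 + v ^ 2) / ((S / u) ^ 2 + v ^ 2) ∧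
    (mobiusPath S u v).im = (S ^ 2 - u ^ 2) / u * v / ((S / u) ^ 2 + v ^ 2) := by
  have hk : 0 < S / u := div_pos hS hu
  have hc := Complex.slitPlane_ne_zero (add_mul_I_mem_slitPlane hk v)
  have hd : 0 < (S / u) ^ 2 + v ^ 2 := by positivity
  have hdc : (((S / u) ^ 2 + v ^ 2 : ℝ) : ℂ) =
      (((S / u : ℝ) : ℂ) + v * Complex.I) * (((S / u : ℝ) : ℂ) - v * Complex.I) := by
    push_cast; linear_combination ((v : ℂ) ^ 2) * Complex.I_sq
  have huc : (u : ℂ) ≠ 0 := by exact_mod_cast hu.ne'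
  have : mobiusPath S u v = ((S * (1 + v ^ 2) / ((S / u) ^ 2 + v ^ 2) : ℝ) : ℂ) +
      (((S ^ 2 - u ^ 2) / u * v / ((S / u) ^ 2 + v ^ 2) : ℝ) : ℂ) * Complex.I := by
    have hd0 : (((S / u) ^ 2 + v ^ 2 : ℝ) : ℂ) ≠ 0 := by exact_mod_cast hd.ne'
    rw [Complex.ofReal_div, Complex.ofReal_div, div_mul_eq_mul_div, ← add_div, mobiusPath,
      div_eq_div_iff hc hd0, hdc]
    push_cast
    field_simp
    linear_combination (-((u : ℂ) * S ^ 2 * v ^ 2) - u ^ 2 * S * v ^ 3 * Complex.I) * Complex.I_sq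
  generalize S * (1 + v ^ 2) / ((S / u) ^ 2 + v ^ 2) = a at this ⊢
  generalize (S ^ 2 - u ^ 2) / u * v / ((S / u) ^ 2 + v ^ 2) = b at this ⊢
  rw [this]; simp

theorem starConvex_im_ne_zero_or {u : ℝ} (hu : 0 < u) :
    StarConvex ℝ 0 {s : ℂ | s.im ≠ 0 ∨ |s.re| < u} := by
  rw [starConvex_zero_iff]
  intro s hs a ha0 ha1
  simp only [mem_ofPred_eq, Complex.real_smul, Complex.re_ofReal_mul, Complex.im_ofReal_mul] at hs ⊢
  rcases ha0.eq_or_lt with rfl | ha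
  · exact Or.inr (by simpa using hu)
  rcases hs with h | h
  · exact Or.inl (mul_ne_zero ha.ne' h)
  · refine Or.inr ?_
    rw [abs_mul, abs_of_nonneg ha0]
    exact (mul_le_of_le_one_left (abs_nonneg _) ha1).trans_lt h

/-- At finite v the circle meets the real axis only at v = 0, in the point u²/S < u, and so passes
between -u and u. On the doubly slit plane the kernel has a primitive. -/
theorem mobiusPath_mem {S u : ℝ} (hu : 0 < u) (huS : u < S) (v : ℝ) :
    mobiusPath S u v ∈ {s : ℂ | s.im ≠ 0 ∨ |s.re| < u} := by
  have hS := hu.trans huS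
  obtain ⟨h1, h2⟩ := mobiusPath_re_im hu hS v
  rcases eq_or_ne v 0 with rfl | hv
  · right
    have : S * (1 + 0 ^ 2) / ((S / u) ^ 2 + 0 ^ 2) = u * (u / S) := by field_simp; ring
    rw [h1, this, abs_of_pos (by positivity)]
    exact mul_lt_of_lt_one_right hu ((div_lt_one hS).2 huS)
  · left
    rw [h2]
    have h3 : 0 < S ^ 2 - u ^ 2 := by nlinarith
    have h4 : 0 < S / u := by positivity
    have : 0 < (S / u) ^ 2 + v ^ 2 := by positivity
    positivity

/-- The position of `mobiusPath S u v` and of `arcPath 1 S (1 - 1 / v)` for large `v`. -/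
theorem eventually_mobiusPath_arcPath {u S σ : ℝ} (hu : 0 < u) (huS : u < S)
    (hσ : σ = 1 ∨ σ = -1) : ∃ m M : ℝ, 0 < m ∧ 0 < M ∧
    ∀ᶠ v : ℝ in atTop, 0 < v⁻¹ ∧ v⁻¹ * M ≤ (S - u) / 2 ∧
      m * v⁻¹ ≤ σ * (arcPath σ S (1 - v⁻¹)).im ∧ m * v⁻¹ ≤ σ * (mobiusPath S u (σ * v)).im ∧
      ‖(S : ℂ) - arcPath σ S (1 - v⁻¹)‖ ≤ M * v⁻¹ ∧ ‖(S : ℂ) - mobiusPath S u (σ * v)‖ ≤ M * v⁻¹ := by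
  have hS := hu.trans huS
  have hσ2 : σ * σ = 1 := by rcases hσ with rfl | rfl <;> norm_num
  set D := (S ^ 2 - u ^ 2) / u with hD
  have hSu : 0 < S ^ 2 - u ^ 2 := by nlinarith
  have hD0 : 0 < D := by positivity
  set k := S / u with hk
  have hk0 : 0 < k := by positivity
  have hkS : S * (k ^ 2 - 1) = D * k := by rw [hD, hk]; field_simp
  -- D governs the height of the circle near S, S that of the arc. The factor 1/2 covers the losses
  -- 1 - η ≥ 1/2 on the arc and k ≤ v on the circle.
  set m := min D S / 2 with hm
  have hm0 : 0 < m := by positivity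
  have hmD : m ≤ D / 2 := by rw [hm]; linarith [min_le_left D S]
  have hmS : m ≤ S / 2 := by rw [hm]; linarith [min_le_right D S]
  set M := 2 * (D + S) with hM
  have hM0 : 0 < M := by positivity
  refine ⟨m, M, hm0, hM0, ?_⟩
  have hsmall : ∀ᶠ v : ℝ in atTop, v⁻¹ * M < (S - u) / 2 := by
    have := (tendsto_inv_atTop_zero (𝕜 := ℝ)).mul_const M
    rw [zero_mul] at this
    exact this.eventually (gt_mem_nhds (by linarith))
  filter_upwards [hsmall, eventually_ge_atTop 2, eventually_ge_atTop k] with v h1 h2 h3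
  have hv0 : 0 < v := by linarith
  set η := v⁻¹ with hηd
  have hη0 : 0 < η := inv_pos.2 hv0
  have hvη : v * η = 1 := mul_inv_cancel₀ hv0.ne'
  have hη2 : η ≤ 1 / 2 := by nlinarith
  have hkη : k * η ≤ 1 := by nlinarith
  obtain ⟨r1, r2⟩ := mobiusPath_re_im hu hS (σ * v)
  have hσv : (σ * v) ^ 2 = v ^ 2 := by rw [mul_pow, sq σ, hσ2, one_mul]
  rw [← hk, hσv] at r1
  rw [← hk, ← hD, hσv] at r2
  have hden : 0 < k ^ 2 + v ^ 2 := by positivity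
  have a1 : (arcPath σ S (1 - η)).re = S * (1 - η) := arcPath_re _ _ _
  have a2 : (arcPath σ S (1 - η)).im = σ * (S * (1 - η) * η) := by rw [arcPath_im]; ring
  have b2 : σ * (mobiusPath S u (σ * v)).im = D * v / (k ^ 2 + v ^ 2) := by
    rw [r2, ← mul_div_assoc]; congr 1; linear_combination D * v * hσ2
  have b3 : D * v / (k ^ 2 + v ^ 2) ≤ D * η := by
    rw [div_le_iff₀ hden]
    have : D * η * (k ^ 2 + v ^ 2) = D * η * k ^ 2 + D * v * (v * η) := by ring
    rw [this, hvη]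
    have : 0 ≤ D * η * k ^ 2 := by positivity
    linarith
  have b4 : D / 2 * η ≤ D * v / (k ^ 2 + v ^ 2) := by
    rw [le_div_iff₀ hden]
    have e : D / 2 * η * (k ^ 2 + v ^ 2) ≤ D / 2 * η * (v ^ 2 + v ^ 2) := by gcongr
    have e' : D / 2 * η * (v ^ 2 + v ^ 2) = D * v * (v * η) := by ring
    rw [e', hvη] at e; linarith
  have habs : ∀ x : ℝ, |x| = |σ * x| := fun x => by
    rw [abs_mul]; rcases hσ with rfl | rfl <;> simp
  refine ⟨hη0, h1.le, ?_, ?_, ?_, ?_⟩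
  · rw [a2, ← mul_assoc, hσ2, one_mul]; nlinarith
  · rw [b2]; nlinarith
  · refine (Complex.norm_le_abs_re_add_abs_im _).trans ?_
    have e1 : ((S : ℂ) - arcPath σ S (1 - η)).re = S * η := by
      rw [Complex.sub_re, a1, Complex.ofReal_re]; ring
    have e2 : |((S : ℂ) - arcPath σ S (1 - η)).im| = S * (1 - η) * η := by
      rw [Complex.sub_im, Complex.ofReal_im, zero_sub, abs_neg, habs, a2, ← mul_assoc, hσ2,
        one_mul, abs_of_nonneg]
      have : 0 ≤ 1 - η := by linarith
      positivity
    rw [e1, e2, abs_of_pos (by positivity)]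
    rw [hM]; linarith [mul_pos hS hη0, mul_pos hD0 hη0, mul_pos (mul_pos hS hη0) hη0]
  · refine (Complex.norm_le_abs_re_add_abs_im _).trans ?_
    have e1 : ((S : ℂ) - mobiusPath S u (σ * v)).re = D * k / (k ^ 2 + v ^ 2) := by
      rw [Complex.sub_re, r1, Complex.ofReal_re, eq_div_iff hden.ne', sub_mul,
        div_mul_cancel₀ _ hden.ne']
      linear_combination hkS
    have e2 : |((S : ℂ) - mobiusPath S u (σ * v)).im| = D * v / (k ^ 2 + v ^ 2) := by
      rw [Complex.sub_im, Complex.ofReal_im, zero_sub, abs_neg, habs, b2, abs_of_pos]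
      positivity
    have e3 : D * k / (k ^ 2 + v ^ 2) ≤ D * v / (k ^ 2 + v ^ 2) := by gcongr
    rw [e1, e2, abs_of_pos (by positivity)]
    rw [hM]; linarith [mul_pos hS hη0, mul_pos hD0 hη0]

/-- Both ways of approaching `S`, along `mobiusPath S u` and along an arc, on the same side of the
real axis. -/
theorem tendsto_primitive_mobiusPath {h u S b σ : ℝ} (hh : 0 < h) (hu : 0 < u) (huS : u < S)
    (hb : 0 < b) (hσ : σ = 1 ∨ σ = -1) {F : ℂ → ℂ}
    (hF : ∀ s ∈ {s : ℂ | s.im ≠ 0 ∨ |s.re| < u}, HasDerivAt F (kern h u S b 0 s) s)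
    (hint : IntegrableOn
      (fun τ => kern h u S b 0 (arcPath σ S τ) * arcPathDeriv σ S τ) (Ioo 0 1)) :
    Tendsto (fun v => F (mobiusPath S u (σ * v))) atTop
      (𝓝 (F 0 + ∫ τ in Ioo (0 : ℝ) 1,
        kern h u S b 0 (arcPath σ S τ) * arcPathDeriv σ S τ)) := by
  have hS := hu.trans huS
  have hσ2 : σ * σ = 1 := by rcases hσ with rfl | rfl <;> norm_num
  have hσ0 : σ ≠ 0 := by rintro rfl; simp at hσ2
  have t1 := tendsto_primitive_comp_path (γ := arcPath σ S) (γ' := arcPathDeriv σ S) hF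
      (fun τ _ => hasDerivAt_arcPath σ S τ) (by
        intro τ hτ
        rcases hτ.1.eq_or_lt with h | h
        · rw [← h, arcPath_zero]; right; simpa using hu
        · left; rw [arcPath_im]
          have := hτ.2
          exact mul_ne_zero hS.ne' (mul_ne_zero (mul_ne_zero hσ0 h.ne') (by linarith))) hint
  rw [arcPath_zero] at t1
  have hη : Tendsto (fun v : ℝ => v⁻¹) atTop (𝓝[>] 0) := tendsto_inv_atTop_nhdsGT_zero
  have hη1 : Tendsto (fun v : ℝ => 1 - v⁻¹) atTop (𝓝[<] 1) := by
    refine tendsto_nhdsWithin_iff.2 ⟨?_, ?_⟩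
    · simpa using tendsto_inv_atTop_zero.const_sub (1 : ℝ)
    · filter_upwards [eventually_gt_atTop 0] with v hv
      have : 0 < v⁻¹ := inv_pos.2 hv
      simpa using hv
  have t2 := t1.comp hη1
  obtain ⟨m, M, hm0, hM0, hpos⟩ := eventually_mobiusPath_arcPath hu huS hσ
  have t3 := tendsto_primitive_sub (l := atTop) hF (z₁ := fun v => arcPath σ S (1 - v⁻¹))
    (z₂ := fun v => mobiusPath S u (σ * v)) (η := fun v => v⁻¹) (h := h) (B := 2 * M)
    (A := (m ^ (h - 1) + M ^ (h - 1)) * (b ^ (h - 1) + (b + 2 * S) ^ (h - 1)) *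
      ((S - u) / 2 * u) ^ (-h)) hh hη ?_ ?_
  · simpa using t3.add t2
  · filter_upwards [hpos] with v hv ζ hζ
    obtain ⟨p0, p1, p2, p3, p4, p5⟩ := hv
    have hn : ‖(S : ℂ) - ζ‖ ≤ M * v⁻¹ := by
      have := (convex_closedBall (S : ℂ) (M * v⁻¹)).segment_subset
        (by rwa [Metric.mem_closedBall, dist_comm, dist_eq_norm] :
          arcPath σ S (1 - v⁻¹) ∈ Metric.closedBall (S : ℂ) (M * v⁻¹))
        (by rwa [Metric.mem_closedBall, dist_comm, dist_eq_norm]) hζ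
      rwa [Metric.mem_closedBall, dist_comm, dist_eq_norm] at this
    obtain ⟨θ, hθ, -, him⟩ := segment_re_im hζ
    have him' : m * v⁻¹ ≤ σ * ζ.im := by
      rw [him]; nlinarith [hθ.1, hθ.2]
    have hmv : 0 < m * v⁻¹ := mul_pos hm0 p0
    have hlow : m * v⁻¹ ≤ ‖(S : ℂ) - ζ‖ := by
      refine le_trans ?_ (Complex.abs_im_le_norm _)
      rw [Complex.sub_im, Complex.ofReal_im, zero_sub, abs_neg]
      refine him'.trans ?_
      rcases hσ with rfl | rfl
      · rw [one_mul]; exact le_abs_self _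
      · rw [neg_one_mul]; exact neg_le_abs _
    have hre : |S - ζ.re| ≤ M * v⁻¹ := by
      refine le_trans ?_ hn
      simpa using Complex.abs_re_le_norm ((S : ℂ) - ζ)
    have hre' := abs_le.1 hre
    have hMv : M * v⁻¹ ≤ (S - u) / 2 := by rw [mul_comm]; exact p1
    refine ⟨Or.inl fun h0 => ?_, norm_kern_le hh hb hm0 p0
      (mul_pos (by linarith) hu) hlow hn (by linarith [hre'.1, hre'.2]) ?_ ?_⟩
    · rw [h0] at him'; simp at him'; linarith
    · have : ζ = S - (S - ζ) := by ring
      rw [this]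
      refine (norm_sub_le _ _).trans ?_
      rw [Complex.norm_real, Real.norm_of_nonneg hS.le]; linarith
    · have k1 : (S - u) / 2 ≤ ‖(u : ℂ) - (ζ + (0 : ℝ) * Complex.I)‖ := by
        rw [norm_sub_rev]
        refine le_trans ?_ (Complex.re_le_norm _)
        simp; linarith
      have k2 : u ≤ ‖(u : ℂ) + (ζ + (0 : ℝ) * Complex.I)‖ := by
        refine le_trans ?_ (Complex.re_le_norm _)
        simp; linarith
      have : 0 ≤ (S - u) / 2 := by linarith
      gcongr
  · filter_upwards [hpos] with v hv
    obtain ⟨-, -, -, -, p4, p5⟩ := hv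
    have : mobiusPath S u (σ * v) - arcPath σ S (1 - v⁻¹) =
      ((S : ℂ) - arcPath σ S (1 - v⁻¹)) - ((S : ℂ) - mobiusPath S u (σ * v)) := by ring
    rw [this]
    refine (norm_sub_le _ _).trans ?_
    linarith

/-- The difference of the integrals of `kern` over the upper and the lower arc, if the singularity
`u` lies between them. -/
theorem integral_kern_sub {h u S b : ℝ} (hh : 0 < h) (hu : 0 < u) (huS : u < S) (hSb : S ≤ b)
    (hint : ∀ σ : ℝ, σ = 1 ∨ σ = -1 → IntegrableOn
      (fun τ => kern h u S b 0 (arcPath σ S τ) * arcPathDeriv σ S τ) (Ioo 0 1)) :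
    (∫ τ in Ioo (0 : ℝ) 1, kern h u S b 0 (arcPath 1 S τ) * arcPathDeriv 1 S τ) -
      ∫ τ in Ioo (0 : ℝ) 1, kern h u S b 0 (arcPath (-1) S τ) * arcPathDeriv (-1) S τ =
    Complex.I * ((u ^ (-h) * (b + S) ^ (h - 1) : ℝ) : ℂ) *
      mehlerInt (h - 1) h ((b * S + u ^ 2) / (u * (b + S))) := by
  have hS := hu.trans huS
  have hb := hS.trans_le hSb
  have hUo : IsOpen {s : ℂ | s.im ≠ 0 ∨ |s.re| < u} :=
    (isOpen_ne_fun Complex.continuous_im continuous_const).union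
      (isOpen_lt Complex.continuous_re.abs continuous_const)
  have hd : DifferentiableOn ℂ (kern h u S b 0) {s : ℂ | s.im ≠ 0 ∨ |s.re| < u} := by
    intro s hs
    refine (differentiableAt_kern ?_ ?_).differentiableWithinAt
    · exact hs.imp_right fun h => ⟨by linarith [(abs_lt.1 h).1], by linarith [(abs_lt.1 h).2]⟩
    · rw [add_zero]
      exact hs.imp_right fun h => abs_lt.1 h
  obtain ⟨F, hF⟩ := (starConvex_im_ne_zero_or hu).exists_hasDerivAt_of_differentiableOn hUo hd
  -- The circle reaches S from above as v → ∞ and from below as v → -∞. At these ends the primitive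
  -- has the limits belonging to the upper and lower arcs, so the difference of the arc integrals is
  -- the integral over the circle.
  have t1 := tendsto_primitive_mobiusPath hh hu huS hb (Or.inl rfl) hF (hint 1 (Or.inl rfl))
  have t2 := tendsto_primitive_mobiusPath hh hu huS hb (Or.inr rfl) hF (hint (-1) (Or.inr rfl))
  simp only [one_mul] at t1
  have t2' := t2.comp tendsto_neg_atBot_atTop
  simp only [Function.comp_def, neg_mul, one_mul, neg_neg] at t2'
  have hx : 0 < (b * S + u ^ 2) / (u * (b + S)) := by positivity
  have key := integral_of_hasDerivAt_of_tendsto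
    (f' := fun v => Complex.I * ((u ^ (-h) * (b + S) ^ (h - 1) : ℝ) : ℂ) *
      mehlerKernel (h - 1) h ((b * S + u ^ 2) / (u * (b + S))) v)
    (fun v => ?_) ((integrable_mehlerKernel hx (by linarith)).const_mul _) t2' t1
  · rw [integral_const_mul] at key
    rw [mehlerInt, key]; ring
  · have := (hF _ (mobiusPath_mem hu huS v)).scomp v (hasDerivAt_mobiusPath hu hS v)
    refine this.congr_deriv ?_
    rw [← kern_mobiusPath hu huS hb v, smul_eq_mul, mul_comm]

end AdS

/-! ### Domination of the integrands. -/

namespace AdS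

/-- The weight in `u` with respect to which the integrands are dominated. -/
def weight (a h u₀ u : ℝ) : ℝ := if u ≤ 3 * u₀ then u ^ (a - h - 2) else u ^ (-h - 2)

theorem weight_nonneg {a h u₀ u : ℝ} (hu : 0 ≤ u) : 0 ≤ weight a h u₀ u := by
  rw [weight]; split_ifs <;> positivity

/-- Interpolation: with two lower bounds for the same quantity, the negative power may be
distributed between them. Each singularity then receives an exponent small enough to be integrable.
-/
theorem mul_rpow_neg_mul_rpow_le {A p q r s : ℝ} (hp : 0 < p) (hq : 0 < q) (hpA : p ≤ A)
    (hqA : q ≤ A) (hr : 0 ≤ r) (hs : 0 ≤ s) : A ^ (-(r + s)) ≤ p ^ (-r) * q ^ (-s) := by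
  have hA := hp.trans_le hpA
  rw [neg_add, Real.rpow_add hA]
  exact mul_le_mul (Real.rpow_le_rpow_of_nonpos hp hpA (by linarith))
    (Real.rpow_le_rpow_of_nonpos hq hqA (by linarith)) (by positivity) (by positivity)

theorem norm_kern_arcPath_le {h u₀ u S b e σ τ : ℝ} (hu₀ : 0 < u₀) (hS : S ∈ Ioo 0 u₀)
    (hb : b ∈ Icc u₀ (2 * u₀)) (hσ : |σ| ≤ 1) (hτ : τ ∈ Ioo (0 : ℝ) 1) :
    ‖kern h u S b e (arcPath σ S τ) * arcPathDeriv σ S τ‖ ≤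
      2 * (1 + 2 ^ (h - 1)) * (u₀ ^ (h - 1) + (4 * u₀) ^ (h - 1)) *
      (S ^ h * (1 - τ) ^ (h - 1) * (‖(u : ℂ) - (arcPath σ S τ + e * Complex.I)‖ *
        ‖(u : ℂ) + (arcPath σ S τ + e * Complex.I)‖) ^ (-h)) := by
  have hτ2 : 0 < τ * (1 - τ) := mul_pos hτ.1 (by linarith [hτ.2])
  have h1τ : 0 < 1 - τ := by linarith [hτ.2]
  have hS0 := hS.1
  obtain ⟨l1, l2, l3, l4⟩ := lens_bounds (ζ := arcPath σ S τ) hS.1 hτ (arcPath_re _ _ _) (by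
    rw [arcPath_im, abs_mul, abs_of_pos hS.1, mul_assoc, abs_mul, abs_of_pos hτ2]
    exact mul_le_mul_of_nonneg_left (mul_le_of_le_one_left hτ2.le hσ) hS0.le)
  have hb1 : u₀ ≤ ‖(b : ℂ) + arcPath σ S τ‖ := by
    refine le_trans ?_ (Complex.re_le_norm _)
    rw [Complex.add_re, Complex.ofReal_re]; linarith [hb.1]
  have hb2 : ‖(b : ℂ) + arcPath σ S τ‖ ≤ 4 * u₀ := by
    refine (norm_add_le _ _).trans ?_
    rw [Complex.norm_real, Real.norm_of_nonneg (hu₀.le.trans hb.1)]; linarith [hb.2, hS.2]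
  have e1 := rpow_le_add_rpow (by positivity) l1 l2 (h - 1)
  have e2 := rpow_le_add_rpow hu₀ hb1 hb2 (h - 1)
  have e3 := norm_arcPathDeriv_le hσ hS.1 hτ
  rw [norm_mul, norm_kern]
  have hP : 0 ≤ (‖(u : ℂ) - (arcPath σ S τ + e * Complex.I)‖ *
        ‖(u : ℂ) + (arcPath σ S τ + e * Complex.I)‖) ^ (-h) := by positivity
  generalize (‖(u : ℂ) - (arcPath σ S τ + e * Complex.I)‖ *
        ‖(u : ℂ) + (arcPath σ S τ + e * Complex.I)‖) ^ (-h) = P at hP ⊢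
  calc _ ≤ (((S * (1 - τ)) ^ (h - 1) + (2 * S * (1 - τ)) ^ (h - 1)) *
        (u₀ ^ (h - 1) + (4 * u₀) ^ (h - 1)) * P) * (2 * S) := by gcongr
    _ = _ := by
      rw [mul_assoc 2 S, Real.mul_rpow zero_le_two (by positivity), Real.mul_rpow hS0.le h1τ.le,
        Real.rpow_sub_one hS0.ne' h]
      field_simp

/-- The shift by ie points away from the real axis on the side of the arc, so the height of the arc
bounds the distance from u below, uniformly in e. -/
theorem arc_dist_bounds {u S e σ τ : ℝ} (hS : 0 < S) (hσ : σ = 1 ∨ σ = -1) (he : 0 ≤ σ * e)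
    (hτ : τ ∈ Ioo (0 : ℝ) 1) :
    |u - S * τ| ≤ ‖(u : ℂ) - (arcPath σ S τ + e * Complex.I)‖ ∧
    S * (τ * (1 - τ)) ≤ ‖(u : ℂ) - (arcPath σ S τ + e * Complex.I)‖ ∧
    u + S * τ ≤ ‖(u : ℂ) + (arcPath σ S τ + e * Complex.I)‖ := by
  have h1τ : 0 < 1 - τ := by linarith [hτ.2]
  have hτ0 := hτ.1
  refine ⟨?_, ?_, ?_⟩
  · refine le_trans (le_of_eq ?_) (Complex.abs_re_le_norm _)
    simp [arcPath_re]
  · refine le_trans ?_ (Complex.abs_im_le_norm _)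
    have : ((u : ℂ) - (arcPath σ S τ + e * Complex.I)).im =
        -(S * (σ * τ * (1 - τ)) + e) := by simp [arcPath_im]
    rw [this, abs_neg]
    rcases hσ with rfl | rfl
    · refine le_trans ?_ (le_abs_self _); linarith
    · refine le_trans ?_ (neg_le_abs _); linarith
  · refine le_trans (le_of_eq ?_) (Complex.re_le_norm _)
    simp [arcPath_re]

set_option maxHeartbeats 1000000 in
/-- Domination of the integrand on the arcs. -/
theorem exists_kern_arcPath_le {h a u₀ : ℝ} (hh : 0 < h) (ha : 0 < a) (hah : a ≤ 2 * h)
    (hu₀ : 0 < u₀) : ∃ C : ℝ, 0 ≤ C ∧ ∀ u S b e σ τ : ℝ, 0 < u → u ≠ S → S ∈ Ioo 0 u₀ →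
      b ∈ Icc u₀ (2 * u₀) → (σ = 1 ∨ σ = -1) → 0 ≤ σ * e → τ ∈ Ioo (0 : ℝ) 1 →
      u ^ (h - 2) * ‖kern h u S b e (arcPath σ S τ) * arcPathDeriv σ S τ‖ ≤
        C * weight a h u₀ u * (S ^ (h - a) * τ ^ (-a) +
          |u - S| ^ (-(a / 2)) * (1 - τ) ^ (a / 2 - 1) + (1 - τ) ^ (h - 1)) := by
  set K := 2 * (1 + 2 ^ (h - 1)) * (u₀ ^ (h - 1) + (4 * u₀) ^ (h - 1)) with hK
  have hK0 : 0 ≤ K := by positivity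
  -- The exponent h is split as (h - l) + l between two lower bounds for AB. Squares occur in the
  -- second one, so l = a/2 produces the power τ^(-a).
  set l := a / 2 with hl
  have hl0 : 0 < l := by positivity
  have hhl : 0 ≤ h - l := by linarith
  set c₁ : ℝ := 2 ^ h * u₀ ^ h with hc₁
  set c₂ : ℝ := (1 / 4) ^ (-(h - l)) * (1 / 2) ^ (-l) * ((1 / 2) ^ (h - 1) + 1 ^ (h - 1)) with hc₂
  set c₃ : ℝ := (1 / 2) ^ (-(h - l)) * (1 / 8) ^ (-l) * (3 * u₀) ^ (h - l) with hc₃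
  have hc₁0 : 0 ≤ c₁ := by positivity
  have hc₂0 : 0 ≤ c₂ := by positivity
  have hc₃0 : 0 ≤ c₃ := by positivity
  refine ⟨K * (c₁ + c₂ + c₃), by positivity, fun u S b e σ τ hu huS hS hb hσ he hτ => ?_⟩
  have hσ1 : |σ| ≤ 1 := by rcases hσ with rfl | rfl <;> simp
  have main := norm_kern_arcPath_le (h := h) (u := u) (e := e) hu₀ hS hb hσ1 hτ
  rw [← hK] at main
  obtain ⟨d1, d2, d3⟩ := arc_dist_bounds (u := u) hS.1 hσ he hτ
  set A := ‖(u : ℂ) - (arcPath σ S τ + e * Complex.I)‖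
  set B := ‖(u : ℂ) + (arcPath σ S τ + e * Complex.I)‖
  have h1τ : 0 < 1 - τ := by linarith [hτ.2]
  have hτ0 := hτ.1
  have hS0 := hS.1
  have hSτ : 0 < S * τ := by positivity
  have hA0 : 0 < A := lt_of_lt_of_le (by positivity) d2
  have hw := weight_nonneg (a := a) (h := h) (u₀ := u₀) hu.le
  have hT1 : 0 ≤ S ^ (h - a) * τ ^ (-a) := by positivity
  have hT2 : 0 ≤ |u - S| ^ (-l) * (1 - τ) ^ (l - 1) := by positivity
  have hT3 : 0 ≤ (1 - τ) ^ (h - 1) := by positivity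
  have huS0 : 0 < |u - S| := abs_pos.2 (sub_ne_zero.2 huS)
  suffices hs : u ^ (h - 2) * (S ^ h * (1 - τ) ^ (h - 1) * (A * B) ^ (-h)) ≤
      (c₁ + c₂ + c₃) * weight a h u₀ u * (S ^ (h - a) * τ ^ (-a) +
          |u - S| ^ (-l) * (1 - τ) ^ (l - 1) + (1 - τ) ^ (h - 1)) by
    calc _ ≤ u ^ (h - 2) * (K * (S ^ h * (1 - τ) ^ (h - 1) * (A * B) ^ (-h))) := by gcongr
      _ = K * (u ^ (h - 2) * (S ^ h * (1 - τ) ^ (h - 1) * (A * B) ^ (-h))) := by ring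
      _ ≤ _ := mul_le_mul_of_nonneg_left hs hK0
      _ = _ := by ring
  -- Three regimes, one for each summand of the bound. For u > 3u₀ both distances are of order u,
  -- and only the endpoint singularity (1 - τ)^(h-1) remains.
  rcases lt_or_ge (3 * u₀) u with hU | hU
  · have hAB : u ^ 2 / 2 ≤ A * B := by
      have : u / 2 ≤ A := by
        refine le_trans ?_ ((le_abs_self _).trans d1)
        nlinarith [hS.2, hτ.2]
      have : u ≤ B := by linarith
      calc u ^ 2 / 2 = u / 2 * u := by ring
        _ ≤ A * B := by gcongr
    have e1 : (A * B) ^ (-h) ≤ 2 ^ h * (u ^ (-h) * u ^ (-h)) := by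
      refine (Real.rpow_le_rpow_of_nonpos (by positivity) hAB (by linarith)).trans (le_of_eq ?_)
      rw [Real.div_rpow (by positivity) (by positivity), sq, Real.mul_rpow hu.le hu.le,
        Real.rpow_neg zero_le_two, div_inv_eq_mul, mul_comm]
    have e2 : S ^ h ≤ u₀ ^ h := Real.rpow_le_rpow hS0.le hS.2.le hh.le
    have hwt : weight a h u₀ u = u ^ (h - 2) * (u ^ (-h) * u ^ (-h)) := by
      rw [weight, if_neg (not_le.2 hU), ← Real.rpow_add hu, ← Real.rpow_add hu]; ring_nf
    calc _ ≤ u ^ (h - 2) * (u₀ ^ h * (1 - τ) ^ (h - 1) * (2 ^ h * (u ^ (-h) * u ^ (-h)))) := by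
          gcongr
      _ = (c₁ + 0 + 0) * weight a h u₀ u * (0 + 0 + (1 - τ) ^ (h - 1)) := by rw [hwt, hc₁]; ring
      _ ≤ _ := by gcongr
  have hwt : weight a h u₀ u = u ^ (a - h - 2) := by rw [weight, if_pos hU]
  have hh2 : -h = -((h - l) + l) := by ring
  -- For τ < 1/2 the bounds u² and (Sτ)² for AB are interpolated. For τ ≥ 1/2 they are S(1 - τ)u and
  -- |u - S|S, and the factor S^h cancels.
  rcases lt_or_ge τ (1 / 2) with hτh | hτh
  · have hA2 : S * τ / 2 ≤ A := le_trans (by nlinarith) d2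
    have hA3 : u / 4 ≤ A := by
      rcases le_total (u / 2) (S * τ) with h5 | h5
      · linarith
      · refine le_trans ?_ ((le_abs_self _).trans d1); linarith
    have hAB1 : 1 / 4 * u ^ 2 ≤ A * B := by
      calc 1 / 4 * u ^ 2 = u / 4 * u := by ring
        _ ≤ A * B := mul_le_mul hA3 (by linarith) hu.le hA0.le
    have hAB2 : 1 / 2 * (S * τ) ^ 2 ≤ A * B := by
      calc 1 / 2 * (S * τ) ^ 2 = S * τ / 2 * (S * τ) := by ring
        _ ≤ A * B := mul_le_mul hA2 (by linarith) hSτ.le hA0.le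
    have e1 : (A * B) ^ (-h) ≤ (1 / 4 * u ^ 2) ^ (-(h - l)) * (1 / 2 * (S * τ) ^ 2) ^ (-l) := by
      rw [hh2]
      exact mul_rpow_neg_mul_rpow_le (by positivity) (by positivity) hAB1 hAB2 hhl hl0.le
    have e2 : (1 - τ) ^ (h - 1) ≤ (1 / 2) ^ (h - 1) + 1 ^ (h - 1) :=
      rpow_le_add_rpow (by norm_num) (by linarith) (by linarith) _
    have e3 : (u ^ 2) ^ (-(h - l)) * u ^ (h - 2) = u ^ (a - h - 2) := by
      rw [← Real.rpow_natCast u 2, ← Real.rpow_mul hu.le, ← Real.rpow_add hu, hl]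
      congr 1; push_cast; ring
    have e4 : ((S * τ) ^ 2) ^ (-l) * S ^ h = S ^ (h - a) * τ ^ (-a) := by
      have : 2 * -l = -a := by rw [hl]; ring
      rw [← Real.rpow_natCast (S * τ) 2, ← Real.rpow_mul hSτ.le, Nat.cast_ofNat, this,
        Real.mul_rpow hS0.le hτ0.le, sub_eq_add_neg, Real.rpow_add hS0]
      ring
    calc _ ≤ u ^ (h - 2) * (S ^ h * ((1 / 2) ^ (h - 1) + 1 ^ (h - 1)) *
          ((1 / 4 * u ^ 2) ^ (-(h - l)) * (1 / 2 * (S * τ) ^ 2) ^ (-l))) := by gcongr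
      _ = (0 + c₂ + 0) * weight a h u₀ u * (S ^ (h - a) * τ ^ (-a) + 0 + 0) := by
        rw [hwt, ← e3, ← e4, hc₂, Real.mul_rpow (by norm_num) (by positivity),
          Real.mul_rpow (by norm_num) (by positivity)]
        ring
      _ ≤ _ := by gcongr
  · have hA2 : S * (1 - τ) / 2 ≤ A := le_trans (by nlinarith [mul_nonneg (mul_pos hS0 h1τ).le (sub_nonneg.2 hτh)]) d2
    have hA3 : |u - S| / 4 ≤ A := by
      have : |u - S| ≤ |u - S * τ| + |S * (1 - τ)| := by
        have := abs_add_le (u - S * τ) (-(S * (1 - τ)))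
        rw [abs_neg] at this
        refine le_trans (le_of_eq ?_) this
        congr 1; ring
      rw [abs_of_pos (by positivity : 0 < S * (1 - τ))] at this
      linarith
    have hB : S / 2 ≤ B := by nlinarith
    have hAB1 : 1 / 2 * (S * (1 - τ) * u) ≤ A * B := by
      calc 1 / 2 * (S * (1 - τ) * u) = S * (1 - τ) / 2 * u := by ring
        _ ≤ A * B := mul_le_mul hA2 (by linarith) hu.le hA0.le
    have hAB2 : 1 / 8 * (|u - S| * S) ≤ A * B := by
      calc 1 / 8 * (|u - S| * S) = |u - S| / 4 * (S / 2) := by ring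
        _ ≤ A * B := mul_le_mul hA3 hB (by positivity) hA0.le
    have e1 : (A * B) ^ (-h) ≤ (1 / 2 * (S * (1 - τ) * u)) ^ (-(h - l)) *
        (1 / 8 * (|u - S| * S)) ^ (-l) := by
      rw [hh2]
      exact mul_rpow_neg_mul_rpow_le (by positivity) (by positivity) hAB1 hAB2 hhl hl0.le
    have e3 : u ^ (h - 2) * u ^ (-(h - l)) ≤ (3 * u₀) ^ (h - l) * u ^ (a - h - 2) := by
      have : u ^ (h - 2) * u ^ (-(h - l)) = u ^ (h - l) * u ^ (a - h - 2) := by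
        rw [← Real.rpow_add hu, ← Real.rpow_add hu, hl]; congr 1; ring
      rw [this]
      gcongr
    have e4 : S ^ h * (S ^ (-(h - l)) * S ^ (-l)) = 1 := by
      rw [← Real.rpow_add hS0, ← Real.rpow_add hS0]; ring_nf; simp
    have e5 : (1 - τ) ^ (h - 1) * (1 - τ) ^ (-(h - l)) = (1 - τ) ^ (l - 1) := by
      rw [← Real.rpow_add h1τ]; ring_nf
    calc _ ≤ u ^ (h - 2) * (S ^ h * (1 - τ) ^ (h - 1) * ((1 / 2 * (S * (1 - τ) * u)) ^ (-(h - l)) *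
        (1 / 8 * (|u - S| * S)) ^ (-l))) := by gcongr
      _ = (u ^ (h - 2) * u ^ (-(h - l))) * ((1 / 2) ^ (-(h - l)) * (1 / 8) ^ (-l)) *
          (S ^ h * (S ^ (-(h - l)) * S ^ (-l))) *
          (|u - S| ^ (-l) * ((1 - τ) ^ (h - 1) * (1 - τ) ^ (-(h - l)))) := by
        rw [Real.mul_rpow (by norm_num) (mul_pos (mul_pos hS0 h1τ) hu).le,
          Real.mul_rpow (x := 1 / 8) (by norm_num) (mul_pos huS0 hS0).le,
          Real.mul_rpow (mul_pos hS0 h1τ).le hu.le, Real.mul_rpow hS0.le h1τ.le,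
          Real.mul_rpow huS0.le hS0.le]
        ring
      _ ≤ ((3 * u₀) ^ (h - l) * u ^ (a - h - 2)) * ((1 / 2) ^ (-(h - l)) * (1 / 8) ^ (-l)) *
          1 * (|u - S| ^ (-l) * (1 - τ) ^ (l - 1)) := by rw [e4, e5]; gcongr
      _ = (0 + 0 + c₃) * weight a h u₀ u * (0 + |u - S| ^ (-l) * (1 - τ) ^ (l - 1) + 0) := by
        rw [hwt, hc₃]; ring
      _ ≤ _ := by gcongr

end AdS

namespace AdS

theorem norm_kern_ofReal {h u S b e s : ℝ} (hs : s ≤ S) (hb : 0 ≤ b + s) :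
    ‖kern h u S b e s‖ = ((S - s) * (b + s)) ^ (h - 1) *
      (‖(u : ℂ) - (s + e * Complex.I)‖ * ‖(u : ℂ) + (s + e * Complex.I)‖) ^ (-h) := by
  rw [norm_kern, Real.mul_rpow (by linarith) hb, ← Complex.ofReal_sub, ← Complex.ofReal_add,
    Complex.norm_real, Complex.norm_real, Real.norm_of_nonneg (by linarith), Real.norm_of_nonneg hb]

theorem rpow_mul_le_weight_of_lt {a h u₀ u A : ℝ} (hh : 0 < h) (hu₀ : 0 < u₀) (hu : 3 * u₀ < u)
    {c : ℝ} (hc : 0 < c) (hA : c * u ^ 2 ≤ A) :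
    u ^ (h - 2) * A ^ (-h) ≤ c ^ (-h) * weight a h u₀ u := by
  have hu0 : 0 < u := by linarith
  have hwt : weight a h u₀ u = u ^ (h - 2) * (u ^ 2) ^ (-h) := by
    rw [weight, if_neg (not_le.2 hu), ← Real.rpow_natCast u 2, ← Real.rpow_mul hu0.le,
      ← Real.rpow_add hu0]
    congr 1; push_cast; ring
  calc _ ≤ u ^ (h - 2) * (c * u ^ 2) ^ (-h) :=
        mul_le_mul_of_nonneg_left (Real.rpow_le_rpow_of_nonpos (by positivity) hA (by linarith))
          (by positivity)
    _ = _ := by rw [hwt, Real.mul_rpow hc.le (by positivity)]; ring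

/-- Domination of the integrand on a vertical segment at positive distance from the cut. -/
theorem exists_kern_ofReal_le {h a u₀ e : ℝ} (hh : 0 < h) (hah : a ≤ 2 * h)
    (hu₀ : 0 < u₀) (he : e ≠ 0) : ∃ C : ℝ, 0 ≤ C ∧ ∀ u S b s : ℝ, 0 < u → 0 ≤ s → s ≤ S → S ≤ u₀ →
      0 ≤ b → u ^ (h - 2) * ‖kern h u S b e s‖ ≤
        C * weight a h u₀ u * ((S - s) * (b + s)) ^ (h - 1) := by
  refine ⟨(1 / 2) ^ (-h) + (e ^ 2) ^ (-h) * (3 * u₀) ^ (2 * h - a), by positivity,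
    fun u S b s hu hs hsS hS hb => ?_⟩
  rw [norm_kern_ofReal hsS (by linarith)]
  have hκ : 0 ≤ ((S - s) * (b + s)) ^ (h - 1) :=
    Real.rpow_nonneg (mul_nonneg (by linarith) (by linarith)) _
  have hA1 : |e| ≤ ‖(u : ℂ) - (s + e * Complex.I)‖ := by
    refine le_trans (le_of_eq ?_) (Complex.abs_im_le_norm _); simp
  have hA2 : u - s ≤ ‖(u : ℂ) - (s + e * Complex.I)‖ := by
    refine le_trans (le_of_eq ?_) (Complex.re_le_norm _); simp
  have hB1 : |e| ≤ ‖(u : ℂ) + (s + e * Complex.I)‖ := by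
    refine le_trans (le_of_eq ?_) (Complex.abs_im_le_norm _); simp
  have hB2 : u ≤ ‖(u : ℂ) + (s + e * Complex.I)‖ := by
    refine le_trans ?_ (Complex.re_le_norm _); simpa using hs
  set A := ‖(u : ℂ) - (s + e * Complex.I)‖
  set B := ‖(u : ℂ) + (s + e * Complex.I)‖
  have hw := weight_nonneg (a := a) (h := h) (u₀ := u₀) hu.le
  suffices hs : u ^ (h - 2) * (A * B) ^ (-h) ≤
      ((1 / 2) ^ (-h) + (e ^ 2) ^ (-h) * (3 * u₀) ^ (2 * h - a)) * weight a h u₀ u by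
    calc _ = (u ^ (h - 2) * (A * B) ^ (-h)) * ((S - s) * (b + s)) ^ (h - 1) := by ring
      _ ≤ _ := mul_le_mul_of_nonneg_right hs hκ
  rcases lt_or_ge (3 * u₀) u with hU | hU
  · refine (rpow_mul_le_weight_of_lt (a := a) hh hu₀ hU (c := 1 / 2) (by norm_num) ?_).trans ?_
    · calc 1 / 2 * u ^ 2 = (u / 2) * u := by ring
        _ ≤ A * B := mul_le_mul (by linarith) hB2 hu.le (norm_nonneg _)
    · refine mul_le_mul_of_nonneg_right ?_ hw
      have : 0 ≤ (e ^ 2) ^ (-h) * (3 * u₀) ^ (2 * h - a) := by positivity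
      linarith
  · have hAB : e ^ 2 ≤ A * B := by
      rw [← sq_abs, sq]; exact mul_le_mul hA1 hB1 (abs_nonneg _) (norm_nonneg _)
    have e1 : u ^ (h - 2) ≤ (3 * u₀) ^ (2 * h - a) * weight a h u₀ u := by
      have : u ^ (h - 2) = u ^ (2 * h - a) * weight a h u₀ u := by
        rw [weight, if_pos hU, ← Real.rpow_add hu]; congr 1; ring
      rw [this]; gcongr
    calc _ ≤ ((3 * u₀) ^ (2 * h - a) * weight a h u₀ u) * (e ^ 2) ^ (-h) :=
          mul_le_mul e1 (Real.rpow_le_rpow_of_nonpos (by positivity) hAB (by linarith))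
            (by positivity) (by positivity)
      _ = (0 + (e ^ 2) ^ (-h) * (3 * u₀) ^ (2 * h - a)) * weight a h u₀ u := by ring
      _ ≤ _ := by gcongr; positivity

/-- Domination of the integrand on the horizontal segment. -/
theorem kern_zero_le {h a u₀ u S b x : ℝ} (hh : 0 < h) (ha : 0 < a) (hah : a ≤ 2 * h)
    (hu₀ : 0 < u₀) (hu : 0 < u) (hS : 0 ≤ S) (hb : 0 ≤ b) (hx : x ≠ 0) :
    u ^ (h - 2) * ‖kern h u S b x (0 : ℝ)‖ ≤
      weight a h u₀ u * ((S * b) ^ (h - 1) * (|x| ^ (-a) + 1)) := by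
  rw [norm_kern_ofReal hS (by linarith), sub_zero, add_zero]
  have hκ : 0 ≤ (S * b) ^ (h - 1) := by positivity
  have hA1 : |x| ≤ ‖(u : ℂ) - ((0 : ℝ) + x * Complex.I)‖ := by
    refine le_trans (le_of_eq ?_) (Complex.abs_im_le_norm _); simp
  have hA2 : u ≤ ‖(u : ℂ) - ((0 : ℝ) + x * Complex.I)‖ := by
    refine le_trans (le_of_eq ?_) (Complex.re_le_norm _); simp
  have hB1 : |x| ≤ ‖(u : ℂ) + ((0 : ℝ) + x * Complex.I)‖ := by
    refine le_trans (le_of_eq ?_) (Complex.abs_im_le_norm _); simp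
  have hB2 : u ≤ ‖(u : ℂ) + ((0 : ℝ) + x * Complex.I)‖ := by
    refine le_trans (le_of_eq ?_) (Complex.re_le_norm _); simp
  set A := ‖(u : ℂ) - ((0 : ℝ) + x * Complex.I)‖
  set B := ‖(u : ℂ) + ((0 : ℝ) + x * Complex.I)‖
  have hw := weight_nonneg (a := a) (h := h) (u₀ := u₀) hu.le
  have hx0 : 0 < |x| := abs_pos.2 hx
  have hAB2 : u ^ 2 ≤ A * B := by
    rw [sq]; exact mul_le_mul hA2 hB2 hu.le (norm_nonneg _)
  suffices hs : u ^ (h - 2) * (A * B) ^ (-h) ≤ (|x| ^ (-a) + 1) * weight a h u₀ u by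
    calc _ = (u ^ (h - 2) * (A * B) ^ (-h)) * (S * b) ^ (h - 1) := by ring
      _ ≤ ((|x| ^ (-a) + 1) * weight a h u₀ u) * (S * b) ^ (h - 1) :=
        mul_le_mul_of_nonneg_right hs hκ
      _ = _ := by ring
  rcases lt_or_ge (3 * u₀) u with hU | hU
  · refine (rpow_mul_le_weight_of_lt (a := a) hh hu₀ hU (c := 1) (by norm_num) ?_).trans ?_
    · rwa [one_mul]
    · refine mul_le_mul_of_nonneg_right ?_ hw
      rw [Real.one_rpow]
      have : 0 ≤ |x| ^ (-a) := by positivity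
      linarith
  · have hAB : |x| ^ 2 ≤ A * B := by
      rw [sq]; exact mul_le_mul hA1 hB1 (abs_nonneg _) (norm_nonneg _)
    have hh2 : -h = -((h - a / 2) + a / 2) := by ring
    have e1 : (A * B) ^ (-h) ≤ (u ^ 2) ^ (-(h - a / 2)) * (|x| ^ 2) ^ (-(a / 2)) := by
      rw [hh2]
      exact mul_rpow_neg_mul_rpow_le (by positivity) (by positivity) hAB2 hAB (by linarith)
        (by linarith)
    have e2 : u ^ (h - 2) * (u ^ 2) ^ (-(h - a / 2)) = weight a h u₀ u := by
      rw [weight, if_pos hU, ← Real.rpow_natCast u 2, ← Real.rpow_mul hu.le, ← Real.rpow_add hu]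
      congr 1; push_cast; ring
    have e3 : (|x| ^ 2) ^ (-(a / 2)) = |x| ^ (-a) := by
      rw [← Real.rpow_natCast |x| 2, ← Real.rpow_mul hx0.le]; congr 1; push_cast; ring
    calc _ ≤ u ^ (h - 2) * ((u ^ 2) ^ (-(h - a / 2)) * (|x| ^ 2) ^ (-(a / 2))) := by gcongr
      _ = (|x| ^ (-a) + 0) * weight a h u₀ u := by rw [← mul_assoc, e2, e3]; ring
      _ ≤ _ := by gcongr; norm_num

theorem integrableOn_Ioo_rpow {r c : ℝ} (hr : -1 < r) (hc : 0 < c) :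
    IntegrableOn (fun x : ℝ => x ^ r) (Ioo 0 c) :=
  (intervalIntegrable_iff_integrableOn_Ioo_of_le hc.le).1
    (intervalIntegral.intervalIntegrable_rpow' hr)

theorem integrableOn_Ioo_sub_rpow {r c : ℝ} (hr : -1 < r) (hc : 0 < c) :
    IntegrableOn (fun x : ℝ => (c - x) ^ r) (Ioo 0 c) := by
  have := (intervalIntegral.intervalIntegrable_rpow' (a := 0) (b := c) hr).comp_sub_left c
  rw [sub_self, sub_zero] at this
  exact (intervalIntegrable_iff_integrableOn_Ioo_of_le hc.le).1 this.symm

theorem integrableOn_Ioo_abs_rpow {r c : ℝ} (hr : -1 < r) (hc : 0 < c) :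
    IntegrableOn (fun x : ℝ => |x| ^ r) (Ioo (-c) c) := by
  have h1 : IntervalIntegrable (fun x : ℝ => |x| ^ r) volume 0 c := by
    rw [intervalIntegrable_iff_integrableOn_Ioo_of_le hc.le]
    refine (integrableOn_Ioo_rpow hr hc).congr_fun (fun x hx => ?_) measurableSet_Ioo
    simp only [abs_of_pos hx.1]
  have h2 : IntervalIntegrable (fun x : ℝ => |x| ^ r) volume (-c) 0 := by
    simpa using (h1.comp_sub_left 0).symm
  exact (intervalIntegrable_iff_integrableOn_Ioo_of_le (by linarith)).1 (h2.trans h1)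

/-- Nothing but integrability is known of n, so the singularity on the line u = u₀ - y is integrated
in y first. By translation invariance its local part has an integral that does not depend on u. -/
theorem integrable_mul_abs_sub_rpow {n : ℝ → ℝ} (hn : IntegrableOn n (Ioi 0)) {l u₀ : ℝ}
    (hl0 : 0 ≤ l) (hl : l < 1) :
    Integrable (fun p : ℝ × ℝ => n p.1 * |p.1 - (u₀ - p.2)| ^ (-l))
      ((volume.restrict (Ioi 0)).prod (volume.restrict (Ioo 0 u₀))) := by
  set φ : ℝ → ℝ := (Ioo (-1 : ℝ) 1).indicator (fun x => |x| ^ (-l)) with hφ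
  have hφi : Integrable φ := (integrableOn_Ioo_abs_rpow (by linarith) one_pos).integrable_indicator
    measurableSet_Ioo
  have hφm : Measurable φ := Measurable.indicator (by fun_prop) measurableSet_Ioo
  have h1 : Integrable (fun p : ℝ × ℝ => n p.1 * φ (p.2 + (p.1 - u₀)))
      ((volume.restrict (Ioi 0)).prod volume) := by
    have hm : AEStronglyMeasurable (fun p : ℝ × ℝ => n p.1 * φ (p.2 + (p.1 - u₀)))
        ((volume.restrict (Ioi 0)).prod volume) :=
      hn.aestronglyMeasurable.comp_fst.mul
        (hφm.comp (by fun_prop : Measurable fun p : ℝ × ℝ => p.2 + (p.1 - u₀))).aestronglyMeasurable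
    rw [integrable_prod_iff hm]
    refine ⟨Eventually.of_forall fun u => (hφi.comp_add_right (u - u₀)).const_mul (n u), ?_⟩
    simp only [norm_mul, integral_const_mul]
    have hinv : ∀ u : ℝ, ∫ y, ‖φ (y + (u - u₀))‖ = ∫ y, ‖φ y‖ := fun u =>
      integral_add_right_eq_self (fun y => ‖φ y‖) (u - u₀)
    simp only [hinv]
    exact hn.norm.mul_const _
  have h2 : Integrable (fun p : ℝ × ℝ => n p.1 * φ (p.2 + (p.1 - u₀)))
      ((volume.restrict (Ioi 0)).prod (volume.restrict (Ioo 0 u₀))) :=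
    h1.mono_measure (Measure.prod_mono le_rfl Measure.restrict_le_self)
  have h3 : Integrable (fun p : ℝ × ℝ => n p.1 * (1 : ℝ))
      ((volume.restrict (Ioi 0)).prod (volume.restrict (Ioo 0 u₀))) :=
    Integrable.mul_prod (f := n) (g := fun _ => (1 : ℝ)) hn (integrable_const 1)
  refine Integrable.mono' (h2.norm.add h3.norm)
    (hn.aestronglyMeasurable.comp_fst.mul (by fun_prop : Measurable fun p : ℝ × ℝ =>
      |p.1 - (u₀ - p.2)| ^ (-l)).aestronglyMeasurable) (Eventually.of_forall fun p => ?_)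
  have hx : p.1 - (u₀ - p.2) = p.2 + (p.1 - u₀) := by ring
  simp only [Pi.add_apply, norm_mul, mul_one, hx, ← mul_add_one]
  gcongr
  set x := p.2 + (p.1 - u₀)
  by_cases hmem : x ∈ Ioo (-1 : ℝ) 1
  · rw [hφ, indicator_of_mem hmem]; linarith
  · rw [hφ, indicator_of_notMem hmem, norm_zero, zero_add]
    have h1x : 1 ≤ |x| := by
      by_contra hlt
      exact hmem (abs_lt.1 (not_le.1 hlt))
    rw [Real.norm_of_nonneg (by positivity)]
    exact Real.rpow_le_one_of_one_le_of_nonpos h1x (by linarith)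

/-- Integrability of the function that dominates the integrands on the arcs. -/
theorem integrable_arc_bound {n : ℝ → ℝ} (hn : IntegrableOn n (Ioi 0)) {h a u₀ : ℝ} (hh : 0 < h)
    (ha : 0 < a) (ha1 : a < 1) (hu₀ : 0 < u₀) :
    Integrable (fun p : (ℝ × ℝ) × ℝ => n p.1.1 * ((u₀ - p.1.2) ^ (h - a) * p.2 ^ (-a) +
        |p.1.1 - (u₀ - p.1.2)| ^ (-(a / 2)) * (1 - p.2) ^ (a / 2 - 1) + (1 - p.2) ^ (h - 1)))
      (((volume.restrict (Ioi 0)).prod (volume.restrict (Ioo 0 u₀))).prod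
        (volume.restrict (Ioo 0 1))) := by
  have i1 := (Integrable.mul_prod (f := n) hn
    (integrableOn_Ioo_sub_rpow (r := h - a) (by linarith) hu₀)).mul_prod
    (integrableOn_Ioo_rpow (r := -a) (by linarith) one_pos)
  have i2 := (integrable_mul_abs_sub_rpow hn (l := a / 2) (u₀ := u₀) (by linarith) (by linarith)).mul_prod
    (integrableOn_Ioo_sub_rpow (r := a / 2 - 1) (by linarith) one_pos)
  have i3 := (Integrable.mul_prod (f := n) (g := fun _ => (1 : ℝ))
    (ν := volume.restrict (Ioo 0 u₀)) hn (integrable_const 1)).mul_prod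
    (integrableOn_Ioo_sub_rpow (r := h - 1) (by linarith) one_pos)
  refine ((i1.add i2).add i3).congr (Eventually.of_forall fun p => ?_)
  simp only [Pi.add_apply]
  ring

end AdS

/-! ### Controlled functions: measurability and integrability on the vertical sides. -/

namespace AdS

/-- A continuous function of `u > 0` and of the coordinates `e`, `y` of a half of the rectangle,
dominated in `u` by an integrable function with respect to the weight. -/
structure Controlled (h a u₀ ε₀ : ℝ) (n : ℝ → ℝ) (g : ℝ → ℝ → ℝ → ℂ) : Prop where
  cont : ContinuousOn (fun p : ℝ × ℝ × ℝ => g p.1 p.2.1 p.2.2)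
    (Ioi 0 ×ˢ (Icc (-ε₀) ε₀ ×ˢ Icc 0 u₀))
  integrable : IntegrableOn n (Ioi 0)
  bound : ∀ u, 0 < u → ∀ e ∈ Icc (-ε₀) ε₀, ∀ y ∈ Icc 0 u₀, weight a h u₀ u * ‖g u e y‖ ≤ n u

/-- The integrand on the vertical segments as a function of `t` and `p = (u, y)`. -/
def vert (h u₀ : ℝ) (g : ℝ → ℝ → ℝ → ℂ) (e t : ℝ) (p : ℝ × ℝ) : ℂ :=
  if p.2 < t then ((p.1 ^ (h - 2) : ℝ) : ℂ) *
    (kern h p.1 (u₀ - p.2) (u₀ + p.2) e ((t - p.2 : ℝ) : ℂ) * g p.1 e p.2) else 0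

/-- The integrand on the vertical segments after the deformation of the `w`-contour. -/
def arcTerm (h u₀ : ℝ) (g : ℝ → ℝ → ℝ → ℂ) (σ e : ℝ) (p : (ℝ × ℝ) × ℝ) : ℂ :=
  ((p.1.1 ^ (h - 2) : ℝ) : ℂ) * g p.1.1 e p.1.2 *
    (kern h p.1.1 (u₀ - p.1.2) (u₀ + p.1.2) e (arcPath σ (u₀ - p.1.2) p.2) *
      arcPathDeriv σ (u₀ - p.1.2) p.2)

theorem Controlled.aestronglyMeasurable {h a u₀ ε₀ : ℝ} {n : ℝ → ℝ} {g : ℝ → ℝ → ℝ → ℂ}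
    (H : Controlled h a u₀ ε₀ n g) {e : ℝ} (he : e ∈ Icc (-ε₀) ε₀) :
    AEStronglyMeasurable (fun p : ℝ × ℝ => g p.1 e p.2)
      ((volume.restrict (Ioi 0)).prod (volume.restrict (Ioo 0 u₀))) := by
  rw [Measure.prod_restrict]
  refine ContinuousOn.aestronglyMeasurable ?_ (measurableSet_Ioi.prod measurableSet_Ioo)
  exact H.cont.comp (f := fun p : ℝ × ℝ => (p.1, e, p.2)) (by fun_prop)
    fun p hp => ⟨hp.1, he, Ioo_subset_Icc_self hp.2⟩

theorem ae_prod_mem {u₀ : ℝ} : ∀ᵐ p : ℝ × ℝ ∂((volume.restrict (Ioi 0)).prod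
    (volume.restrict (Ioo 0 u₀))), 0 < p.1 ∧ p.2 ∈ Ioo 0 u₀ := by
  rw [Measure.prod_restrict]
  filter_upwards [ae_restrict_mem (measurableSet_Ioi.prod measurableSet_Ioo)] with p hp
  exact hp

/-- On the line u = S the branch points u and S collide in the limit, and the arc bound is
unavailable. It is a null set. -/
theorem ae_ne_sub {u₀ : ℝ} : ∀ᵐ p : ℝ × ℝ ∂((volume.restrict (Ioi 0)).prod
    (volume.restrict (Ioo 0 u₀))), p.1 ≠ u₀ - p.2 := by
  rw [Measure.ae_prod_iff_ae_ae]
  · refine Eventually.of_forall fun u => ae_restrict_of_ae ?_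
    filter_upwards [Measure.ae_ne volume (u₀ - u)] with y hy h
    exact hy (by linarith)
  · exact (measurableSet_eq_fun (by fun_prop) (by fun_prop)).compl

theorem integrableOn_Ioo_sub_mul_add_rpow {h u₀ : ℝ} (hh : 0 < h) (hu₀ : 0 < u₀) :
    IntegrableOn (fun t : ℝ => ((u₀ - t) * (u₀ + t)) ^ (h - 1)) (Ioo 0 u₀) := by
  refine Integrable.mono' ((integrableOn_Ioo_sub_rpow (r := h - 1) (by linarith) hu₀).mul_const
    (u₀ ^ (h - 1) + (2 * u₀) ^ (h - 1))) (by fun_prop : Measurable fun t : ℝ =>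
      ((u₀ - t) * (u₀ + t)) ^ (h - 1)).aestronglyMeasurable ?_
  filter_upwards [ae_restrict_mem measurableSet_Ioo] with t ht
  have h1 : 0 < u₀ - t := by linarith [ht.2]
  rw [Real.mul_rpow h1.le (by linarith [ht.1]), Real.norm_of_nonneg]
  · gcongr
    exact rpow_le_add_rpow hu₀ (by linarith [ht.1]) (by linarith [ht.2]) _
  · have := ht.1
    positivity

section Controlled

variable {h a u₀ ε₀ : ℝ} {n : ℝ → ℝ} {g : ℝ → ℝ → ℝ → ℂ}

/-- The constant may depend on e. This is enough for convergence and Fubini at fixed e ≠ 0;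
uniformity in e is obtained only on the arcs. -/
theorem Controlled.exists_norm_vert_le (H : Controlled h a u₀ ε₀ n g) (hh : 0 < h)
    (hah : a ≤ 2 * h) (hu₀ : 0 < u₀) {e : ℝ} (he : e ∈ Icc (-ε₀) ε₀) (he0 : e ≠ 0) :
    ∃ C : ℝ, ∀ t ∈ Ico 0 u₀, ∀ p : ℝ × ℝ, 0 < p.1 → p.2 ∈ Ioo 0 u₀ →
      ‖vert h u₀ g e t p‖ ≤ C * (((u₀ - t) * (u₀ + t)) ^ (h - 1) * n p.1) := by
  obtain ⟨C, hC0, hC⟩ := exists_kern_ofReal_le (a := a) hh hah hu₀ he0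
  refine ⟨C, fun t ht p hu hy => ?_⟩
  have hb := H.bound p.1 hu e he p.2 (Ioo_subset_Icc_self hy)
  have hw := weight_nonneg (a := a) (h := h) (u₀ := u₀) hu.le
  have hκ : 0 ≤ ((u₀ - t) * (u₀ + t)) ^ (h - 1) :=
    Real.rpow_nonneg (mul_nonneg (by linarith [ht.2]) (by linarith [ht.1])) _
  rw [vert]
  split_ifs with hyt
  · have hk := hC p.1 (u₀ - p.2) (u₀ + p.2) (t - p.2) hu (by linarith) (by linarith [ht.2])
      (by linarith [hy.1]) (by linarith [hy.1])
    have e1 : u₀ - p.2 - (t - p.2) = u₀ - t := by ring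
    have e2 : u₀ + p.2 + (t - p.2) = u₀ + t := by ring
    rw [e1, e2] at hk
    rw [norm_mul, norm_mul, Complex.norm_real, Real.norm_of_nonneg (by positivity), ← mul_assoc]
    calc _ ≤ (C * weight a h u₀ p.1 * ((u₀ - t) * (u₀ + t)) ^ (h - 1)) * ‖g p.1 e p.2‖ := by
          gcongr
      _ = C * (((u₀ - t) * (u₀ + t)) ^ (h - 1) * (weight a h u₀ p.1 * ‖g p.1 e p.2‖)) := by ring
      _ ≤ _ := by gcongr
  · rw [norm_zero]
    have : 0 ≤ n p.1 := le_trans (by positivity) hb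
    positivity

theorem Controlled.aestronglyMeasurable_vert (H : Controlled h a u₀ ε₀ n g) {e : ℝ}
    (he : e ∈ Icc (-ε₀) ε₀) (t : ℝ) : AEStronglyMeasurable (vert h u₀ g e t)
      ((volume.restrict (Ioi 0)).prod (volume.restrict (Ioo 0 u₀))) := by
  have hm : Measurable fun p : ℝ × ℝ => ((p.1 ^ (h - 2) : ℝ) : ℂ) *
      kern h p.1 (u₀ - p.2) (u₀ + p.2) e ((t - p.2 : ℝ) : ℂ) := by
    unfold kern; fun_prop
  have := (hm.aestronglyMeasurable.mul (H.aestronglyMeasurable he)).indicator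
    (measurableSet_lt measurable_snd (measurable_const (a := t)))
  refine this.congr (Eventually.of_forall fun p => ?_)
  simp only [indicator, mem_ofPred_eq, vert, Pi.mul_apply, mul_assoc]

theorem Controlled.aestronglyMeasurable_vert_prod (H : Controlled h a u₀ ε₀ n g) {e : ℝ}
    (he : e ∈ Icc (-ε₀) ε₀) :
    AEStronglyMeasurable (fun q : ℝ × (ℝ × ℝ) => vert h u₀ g e q.1 q.2)
      ((volume.restrict (Ioo 0 u₀)).prod
        ((volume.restrict (Ioi 0)).prod (volume.restrict (Ioo 0 u₀)))) := by
  have hm : Measurable fun q : ℝ × (ℝ × ℝ) => ((q.2.1 ^ (h - 2) : ℝ) : ℂ) *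
      kern h q.2.1 (u₀ - q.2.2) (u₀ + q.2.2) e ((q.1 - q.2.2 : ℝ) : ℂ) := by
    unfold kern; fun_prop
  have := (hm.aestronglyMeasurable.mul ((H.aestronglyMeasurable he).comp_snd
    (μ := volume.restrict (Ioo 0 u₀)))).indicator
    (measurableSet_lt (f := fun q : ℝ × (ℝ × ℝ) => q.2.2) (g := fun q => q.1)
      (by fun_prop) (by fun_prop))
  refine this.congr (Eventually.of_forall fun p => ?_)
  simp only [indicator, mem_ofPred_eq, vert, Pi.mul_apply, mul_assoc]

theorem Controlled.integrable_vert (H : Controlled h a u₀ ε₀ n g) (hh : 0 < h)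
    (hah : a ≤ 2 * h) (hu₀ : 0 < u₀) {e : ℝ} (he : e ∈ Icc (-ε₀) ε₀) (he0 : e ≠ 0) {t : ℝ}
    (ht : t ∈ Ico 0 u₀) : Integrable (vert h u₀ g e t)
      ((volume.restrict (Ioi 0)).prod (volume.restrict (Ioo 0 u₀))) := by
  obtain ⟨C, hC⟩ := H.exists_norm_vert_le hh hah hu₀ he he0
  have hn : Integrable (fun p : ℝ × ℝ => n p.1 * (1 : ℝ))
      ((volume.restrict (Ioi 0)).prod (volume.restrict (Ioo 0 u₀))) :=
    Integrable.mul_prod (f := n) (g := fun _ => (1 : ℝ)) H.integrable (integrable_const 1)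
  refine Integrable.mono' ((hn.const_mul (((u₀ - t) * (u₀ + t)) ^ (h - 1))).const_mul C)
    (H.aestronglyMeasurable_vert he t) ?_
  filter_upwards [ae_prod_mem] with p hp
  simpa using hC t ht p hp.1 hp.2

theorem Controlled.integrable_vert_prod (H : Controlled h a u₀ ε₀ n g) (hh : 0 < h)
    (hah : a ≤ 2 * h) (hu₀ : 0 < u₀) {e : ℝ} (he : e ∈ Icc (-ε₀) ε₀) (he0 : e ≠ 0) :
    Integrable (fun q : ℝ × (ℝ × ℝ) => vert h u₀ g e q.1 q.2)
      ((volume.restrict (Ioo 0 u₀)).prod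
        ((volume.restrict (Ioi 0)).prod (volume.restrict (Ioo 0 u₀)))) := by
  obtain ⟨C, hC⟩ := H.exists_norm_vert_le hh hah hu₀ he he0
  have hn : Integrable (fun p : ℝ × ℝ => n p.1 * (1 : ℝ))
      ((volume.restrict (Ioi 0)).prod (volume.restrict (Ioo 0 u₀))) :=
    Integrable.mul_prod (f := n) (g := fun _ => (1 : ℝ)) H.integrable (integrable_const 1)
  refine Integrable.mono' (((integrableOn_Ioo_sub_mul_add_rpow hh hu₀).mul_prod hn).const_mul C)
    (H.aestronglyMeasurable_vert_prod he) ?_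
  have h1 : ∀ᵐ q : ℝ × (ℝ × ℝ) ∂((volume.restrict (Ioo 0 u₀)).prod
      ((volume.restrict (Ioi 0)).prod (volume.restrict (Ioo 0 u₀)))), q.1 ∈ Ioo 0 u₀ :=
    Measure.quasiMeasurePreserving_fst.ae (ae_restrict_mem measurableSet_Ioo)
  filter_upwards [h1, Measure.quasiMeasurePreserving_snd.ae ae_prod_mem] with q hq hp
  simpa using hC q.1 (Ioo_subset_Ico_self hq) q.2 hp.1 hp.2

theorem Controlled.aestronglyMeasurable_arcTerm (H : Controlled h a u₀ ε₀ n g) (σ : ℝ) {e : ℝ}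
    (he : e ∈ Icc (-ε₀) ε₀) : AEStronglyMeasurable (arcTerm h u₀ g σ e)
      (((volume.restrict (Ioi 0)).prod (volume.restrict (Ioo 0 u₀))).prod
        (volume.restrict (Ioo 0 1))) := by
  have h1 : Measurable fun p : (ℝ × ℝ) × ℝ => ((p.1.1 ^ (h - 2) : ℝ) : ℂ) := by fun_prop
  have h2 : Measurable fun p : (ℝ × ℝ) × ℝ =>
      kern h p.1.1 (u₀ - p.1.2) (u₀ + p.1.2) e (arcPath σ (u₀ - p.1.2) p.2) *
      arcPathDeriv σ (u₀ - p.1.2) p.2 := by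
    unfold kern arcPath arcPathDeriv; fun_prop
  exact (h1.aestronglyMeasurable.mul (H.aestronglyMeasurable he).comp_fst).mul
    h2.aestronglyMeasurable

theorem Controlled.exists_norm_arcTerm_le (H : Controlled h a u₀ ε₀ n g) (hh : 0 < h)
    (ha : 0 < a) (hah : a ≤ 2 * h) (hu₀ : 0 < u₀) : ∃ C : ℝ, ∀ σ e : ℝ, (σ = 1 ∨ σ = -1) →
      0 ≤ σ * e → e ∈ Icc (-ε₀) ε₀ →
      ∀ᵐ p : (ℝ × ℝ) × ℝ ∂(((volume.restrict (Ioi 0)).prod (volume.restrict (Ioo 0 u₀))).prod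
        (volume.restrict (Ioo 0 1))), ‖arcTerm h u₀ g σ e p‖ ≤
      C * (n p.1.1 * ((u₀ - p.1.2) ^ (h - a) * p.2 ^ (-a) +
        |p.1.1 - (u₀ - p.1.2)| ^ (-(a / 2)) * (1 - p.2) ^ (a / 2 - 1) +
          (1 - p.2) ^ (h - 1))) := by
  obtain ⟨C, hC0, hC⟩ := exists_kern_arcPath_le hh ha hah hu₀
  refine ⟨C, fun σ e hσ hσe he => ?_⟩
  have h1 : ∀ᵐ p : (ℝ × ℝ) × ℝ ∂(((volume.restrict (Ioi 0)).prod
      (volume.restrict (Ioo 0 u₀))).prod (volume.restrict (Ioo (0 : ℝ) 1))), p.2 ∈ Ioo (0 : ℝ) 1 :=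
    Measure.quasiMeasurePreserving_snd.ae (ae_restrict_mem measurableSet_Ioo)
  filter_upwards [h1, Measure.quasiMeasurePreserving_fst.ae ae_prod_mem,
    Measure.quasiMeasurePreserving_fst.ae ae_ne_sub] with p hτ hp hne
  have hy := hp.2
  have hk := hC p.1.1 (u₀ - p.1.2) (u₀ + p.1.2) e σ p.2 hp.1 hne
    ⟨by linarith [hy.2], by linarith [hy.1]⟩ ⟨by linarith [hy.1], by linarith [hy.2]⟩ hσ hσe hτ
  have hb := H.bound p.1.1 hp.1 e he p.1.2 (Ioo_subset_Icc_self hy)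
  have hu := hp.1
  have h2 : 0 < 1 - p.2 := by linarith [hτ.2]
  have h3 : 0 < u₀ - p.1.2 := by linarith [hy.2]
  have h4 := hτ.1
  have hD : 0 ≤ (u₀ - p.1.2) ^ (h - a) * p.2 ^ (-a) + |p.1.1 - (u₀ - p.1.2)| ^ (-(a / 2)) *
      (1 - p.2) ^ (a / 2 - 1) + (1 - p.2) ^ (h - 1) := by positivity
  rw [arcTerm, norm_mul, norm_mul, Complex.norm_real, Real.norm_of_nonneg (by positivity)]
  generalize (u₀ - p.1.2) ^ (h - a) * p.2 ^ (-a) + |p.1.1 - (u₀ - p.1.2)| ^ (-(a / 2)) *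
      (1 - p.2) ^ (a / 2 - 1) + (1 - p.2) ^ (h - 1) = D at hk hD ⊢
  calc _ = ‖g p.1.1 e p.1.2‖ * (p.1.1 ^ (h - 2) *
        ‖kern h p.1.1 (u₀ - p.1.2) (u₀ + p.1.2) e (arcPath σ (u₀ - p.1.2) p.2) *
          arcPathDeriv σ (u₀ - p.1.2) p.2‖) := by ring
    _ ≤ _ := mul_le_mul_of_nonneg_left hk (norm_nonneg _)
    _ = C * ((weight a h u₀ p.1.1 * ‖g p.1.1 e p.1.2‖) * D) := by ring
    _ ≤ _ := by gcongr

theorem Controlled.integrable_arcTerm (H : Controlled h a u₀ ε₀ n g) (hh : 0 < h)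
    (ha : 0 < a) (ha1 : a < 1) (hah : a ≤ 2 * h) (hu₀ : 0 < u₀) {σ e : ℝ} (hσ : σ = 1 ∨ σ = -1)
    (hσe : 0 ≤ σ * e) (he : e ∈ Icc (-ε₀) ε₀) : Integrable (arcTerm h u₀ g σ e)
      (((volume.restrict (Ioi 0)).prod (volume.restrict (Ioo 0 u₀))).prod
        (volume.restrict (Ioo 0 1))) := by
  obtain ⟨C, hC⟩ := H.exists_norm_arcTerm_le hh ha hah hu₀
  exact Integrable.mono' ((integrable_arc_bound H.integrable hh ha ha1 hu₀).const_mul C)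
    (H.aestronglyMeasurable_arcTerm σ he) (hC σ e hσ hσe he)

end Controlled

end AdS

/-! ### The limit of the vertical sides. -/

namespace AdS

variable {h a u₀ ε₀ : ℝ} {n : ℝ → ℝ} {g : ℝ → ℝ → ℝ → ℂ}

/-- The substitution t = y + (u₀ - y)τ writes the w-integral as one over the degenerate arc with σ =
0, which is then moved off the axis. -/
theorem integral_vert_right {u y e σ : ℝ} (hh : 0 < h) (hu : 0 < u)
    (hy : y ∈ Ioo 0 u₀) (hσ : |σ| ≤ 1) (he0 : e ≠ 0) (hσe : 0 ≤ σ * e) :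
    ∫ t in Ioo 0 u₀, vert h u₀ g e t (u, y) =
      ∫ τ in Ioo (0 : ℝ) 1, arcTerm h u₀ g σ e ((u, y), τ) := by
  have hS : 0 < u₀ - y := by linarith [hy.2]
  have hb : 0 < u₀ + y := by linarith [hy.1, hy.2]
  set K : ℝ → ℂ := fun s => kern h u (u₀ - y) (u₀ + y) e (s : ℂ) with hK
  have h1 : ∫ t in Ioo 0 u₀, vert h u₀ g e t (u, y) =
      ∫ t in Ioo y u₀, ((u ^ (h - 2) : ℝ) : ℂ) * (K (t - y) * g u e y) := by
    have : Ioo y u₀ = Ioo 0 u₀ ∩ Ioi y := by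
      ext t; constructor
      · rintro ⟨h1, h2⟩; exact ⟨⟨hy.1.trans h1, h2⟩, h1⟩
      · rintro ⟨⟨-, h2⟩, h1⟩; exact ⟨h1, h2⟩
    rw [this, ← setIntegral_indicator measurableSet_Ioi]
    rfl
  have h2 : ∫ t in Ioo y u₀, K (t - y) =
      ∫ τ in Ioo (0 : ℝ) 1, kern h u (u₀ - y) (u₀ + y) e (arcPath 0 (u₀ - y) τ) *
        arcPathDeriv 0 (u₀ - y) τ := by
    rw [← integral_Ioc_eq_integral_Ioo, ← intervalIntegral.integral_of_le hy.2.le,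
      intervalIntegral.integral_comp_sub_right K y, sub_self]
    have := intervalIntegral.smul_integral_comp_mul_left (a := 0) (b := 1) K (u₀ - y)
    rw [mul_zero, mul_one] at this
    rw [← this, intervalIntegral.integral_of_le zero_le_one, integral_Ioc_eq_integral_Ioo,
      ← integral_smul]
    congr 1
    ext τ
    simp only [hK, arcPath, arcPathDeriv, Complex.real_smul]
    push_cast
    simp [mul_comm]
  rw [h1, integral_const_mul, integral_mul_const, h2,
    integral_kern_shift hh hu hS hb hσ he0 hσe]
  simp only [arcTerm]
  rw [integral_const_mul]
  ring

theorem Controlled.integral_vert (H : Controlled h a u₀ ε₀ n g) (hh : 0 < h)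
    (ha : 0 < a) (ha1 : a < 1) (hah : a ≤ 2 * h) (hu₀ : 0 < u₀) {σ e : ℝ} (hσ : σ = 1 ∨ σ = -1)
    (hσe : 0 ≤ σ * e) (he : e ∈ Icc (-ε₀) ε₀) (he0 : e ≠ 0) :
    ∫ t in Ioo 0 u₀, ∫ p, vert h u₀ g e t p
        ∂((volume.restrict (Ioi 0)).prod (volume.restrict (Ioo 0 u₀))) =
      ∫ p, arcTerm h u₀ g σ e p
        ∂(((volume.restrict (Ioi 0)).prod (volume.restrict (Ioo 0 u₀))).prod
          (volume.restrict (Ioo 0 1))) := by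
  rw [integral_integral_swap (H.integrable_vert_prod hh hah hu₀ he he0),
    integral_prod _ (H.integrable_arcTerm hh ha ha1 hah hu₀ hσ hσe he)]
  refine integral_congr_ae ?_
  filter_upwards [ae_prod_mem] with p hp
  exact integral_vert_right hh hp.1 hp.2 (by rcases hσ with rfl | rfl <;> simp) he0 hσe

theorem continuousAt_kern_right {u S b : ℝ} {s : ℂ} (hs : s.im ≠ 0) :
    ContinuousAt (fun e : ℝ => kern h u S b e s) 0 := by
  unfold kern
  refine continuousAt_const.mul (ContinuousAt.cpow (f := fun e : ℝ =>
    ((u : ℂ) - (s + e * Complex.I)) * (u + (s + e * Complex.I)))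
      (by fun_prop) continuousAt_const ?_)
  exact sub_mul_add_mem_slitPlane (Or.inl (by simpa using hs))

/-- Off its endpoints the arc avoids the real axis, so the kernel is continuous at e = 0, and the
bound on the arcs does not involve e. Dominated convergence applies. -/
theorem Controlled.tendsto_integral_arcTerm (H : Controlled h a u₀ ε₀ n g) (hh : 0 < h)
    (ha : 0 < a) (ha1 : a < 1) (hah : a ≤ 2 * h) (hu₀ : 0 < u₀) (hε₀ : 0 < ε₀) {σ : ℝ}
    (hσ : σ = 1 ∨ σ = -1) :
    Tendsto (fun ε => ∫ p, arcTerm h u₀ g σ (σ * ε) p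
        ∂(((volume.restrict (Ioi 0)).prod (volume.restrict (Ioo 0 u₀))).prod
          (volume.restrict (Ioo 0 1)))) (𝓝[>] 0)
      (𝓝 (∫ p, arcTerm h u₀ g σ 0 p
        ∂(((volume.restrict (Ioi 0)).prod (volume.restrict (Ioo 0 u₀))).prod
          (volume.restrict (Ioo 0 1))))) := by
  obtain ⟨C, hC⟩ := H.exists_norm_arcTerm_le hh ha hah hu₀
  have hev : ∀ᶠ ε in 𝓝[>] (0 : ℝ), 0 ≤ σ * (σ * ε) ∧ σ * ε ∈ Icc (-ε₀) ε₀ := by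
    filter_upwards [Ioo_mem_nhdsGT hε₀] with ε hε
    rcases hσ with rfl | rfl <;> refine ⟨?_, ?_, ?_⟩ <;> linarith [hε.1, hε.2]
  have hlim : Tendsto (fun ε : ℝ => σ * ε) (𝓝[>] 0) (𝓝[Icc (-ε₀) ε₀] 0) := by
    refine tendsto_nhdsWithin_iff.2 ⟨?_, hev.mono fun ε h => h.2⟩
    have : ContinuousAt (fun ε : ℝ => σ * ε) 0 := by fun_prop
    have h2 := this.tendsto
    rw [mul_zero] at h2
    exact h2.mono_left nhdsWithin_le_nhds
  refine tendsto_integral_filter_of_dominated_convergence _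
    (hev.mono fun ε hε => H.aestronglyMeasurable_arcTerm σ hε.2)
    (hev.mono fun ε hε => hC σ (σ * ε) hσ hε.1 hε.2)
    ((integrable_arc_bound H.integrable hh ha ha1 hu₀).const_mul C) ?_
  have h1 : ∀ᵐ p : (ℝ × ℝ) × ℝ ∂(((volume.restrict (Ioi 0)).prod
      (volume.restrict (Ioo 0 u₀))).prod (volume.restrict (Ioo (0 : ℝ) 1))), p.2 ∈ Ioo (0 : ℝ) 1 :=
    Measure.quasiMeasurePreserving_snd.ae (ae_restrict_mem measurableSet_Ioo)
  filter_upwards [h1, Measure.quasiMeasurePreserving_fst.ae ae_prod_mem] with p hτ hp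
  have hg : ContinuousWithinAt (fun e => g p.1.1 e p.1.2) (Icc (-ε₀) ε₀) 0 := by
    have : ContinuousOn (fun e => g p.1.1 e p.1.2) (Icc (-ε₀) ε₀) :=
      H.cont.comp (f := fun e : ℝ => (p.1.1, e, p.1.2)) (by fun_prop)
        fun e he => ⟨hp.1, he, Ioo_subset_Icc_self hp.2⟩
    exact this 0 ⟨by linarith, hε₀.le⟩
  have him : (arcPath σ (u₀ - p.1.2) p.2).im ≠ 0 := by
    rw [arcPath_im]
    have h2 : u₀ - p.1.2 ≠ 0 := by linarith [hp.2.2]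
    have h3 : σ ≠ 0 := by rcases hσ with rfl | rfl <;> norm_num
    have h4 : 1 - p.2 ≠ 0 := by linarith [hτ.2]
    exact mul_ne_zero h2 (mul_ne_zero (mul_ne_zero h3 hτ.1.ne') h4)
  have hk := (continuousAt_kern_right (h := h) (u := p.1.1) (S := u₀ - p.1.2) (b := u₀ + p.1.2)
    him).continuousWithinAt (s := Icc (-ε₀) ε₀)
  have hc : ContinuousWithinAt (fun e => arcTerm h u₀ g σ e p) (Icc (-ε₀) ε₀) 0 :=
    (continuousWithinAt_const.mul hg).mul (hk.mul continuousWithinAt_const)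
  exact hc.tendsto.comp hlim

/-- The `w`-integral over an arc in the limit `ε → 0`. -/
def arcLimit (h u₀ σ : ℝ) (p : ℝ × ℝ) : ℂ :=
  ∫ τ in Ioo (0 : ℝ) 1, kern h p.1 (u₀ - p.2) (u₀ + p.2) 0 (arcPath σ (u₀ - p.2) τ) *
    arcPathDeriv σ (u₀ - p.2) τ

theorem integrableOn_kern_arcPath (hh : 0 < h) (ha : 0 < a) (ha1 : a < 1) (hah : a ≤ 2 * h)
    (hu₀ : 0 < u₀) {u y σ : ℝ} (hu : 0 < u) (hy : y ∈ Ioo 0 u₀) (hne : u ≠ u₀ - y)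
    (hσ : σ = 1 ∨ σ = -1) : IntegrableOn (fun τ =>
      kern h u (u₀ - y) (u₀ + y) 0 (arcPath σ (u₀ - y) τ) * arcPathDeriv σ (u₀ - y) τ)
      (Ioo 0 1) := by
  obtain ⟨C, hC0, hC⟩ := exists_kern_arcPath_le hh ha hah hu₀
  have hm : Measurable fun τ : ℝ =>
      kern h u (u₀ - y) (u₀ + y) 0 (arcPath σ (u₀ - y) τ) * arcPathDeriv σ (u₀ - y) τ := by
    unfold kern arcPath arcPathDeriv; fun_prop
  have hD : IntegrableOn (fun τ : ℝ => (u₀ - y) ^ (h - a) * τ ^ (-a) + |u - (u₀ - y)| ^ (-(a / 2)) *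
      (1 - τ) ^ (a / 2 - 1) + (1 - τ) ^ (h - 1)) (Ioo 0 1) :=
    (((integrableOn_Ioo_rpow (r := -a) (by linarith) one_pos).const_mul _).add
      ((integrableOn_Ioo_sub_rpow (r := a / 2 - 1) (by linarith) one_pos).const_mul _)).add
      (integrableOn_Ioo_sub_rpow (r := h - 1) (by linarith) one_pos)
  refine Integrable.mono' (hD.const_mul (u ^ (-(h - 2)) * (C * weight a h u₀ u)))
    hm.aestronglyMeasurable ?_
  filter_upwards [ae_restrict_mem measurableSet_Ioo] with τ hτ
  have hk := hC u (u₀ - y) (u₀ + y) 0 σ τ hu hne ⟨by linarith [hy.2], by linarith [hy.1]⟩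
    ⟨by linarith [hy.1], by linarith [hy.2]⟩ hσ (by simp) hτ
  have h1 : u ^ (-(h - 2)) * u ^ (h - 2) = 1 := by rw [← Real.rpow_add hu]; simp
  have h2 := mul_le_mul_of_nonneg_left hk (by positivity : 0 ≤ u ^ (-(h - 2)))
  rw [← mul_assoc, h1, one_mul] at h2
  rw [mul_assoc]
  exact h2

/-- The difference of the two arc integrals is supported in the triangle `u < u₀ - y`. -/
theorem arcLimit_sub (hh : 0 < h) (ha : 0 < a) (ha1 : a < 1) (hah : a ≤ 2 * h)
    (hu₀ : 0 < u₀) {u y : ℝ} (hu : 0 < u) (hy : y ∈ Ioo 0 u₀) (hne : u ≠ u₀ - y) :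
    arcLimit h u₀ 1 (u, y) - arcLimit h u₀ (-1) (u, y) = if u < u₀ - y then
      Complex.I * ((u ^ (-h) * (2 * u₀) ^ (h - 1) : ℝ) : ℂ) * mehlerInt (h - 1) h (xiInv u₀ u y)
      else 0 := by
  split_ifs with hlt
  · have := integral_kern_sub (b := u₀ + y) hh hu hlt (by linarith [hy.1]) fun σ hσ =>
      integrableOn_kern_arcPath hh ha ha1 hah hu₀ hu hy hne hσ
    have e1 : u₀ + y + (u₀ - y) = 2 * u₀ := by ring
    have e2 : ((u₀ + y) * (u₀ - y) + u ^ 2) / (u * (2 * u₀)) = xiInv u₀ u y := by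
      rw [xiInv]; congr 1 <;> ring
    rw [e1, e2] at this
    exact this
  · have hlt' : u₀ - y < u := lt_of_le_of_ne (not_lt.1 hlt) (Ne.symm hne)
    exact sub_eq_zero.2 (integral_kern_eq_of_lt hh (by linarith [hy.2]) (by linarith [hy.1]) hlt')

/-- The limit of the contributions of the vertical segments, together with its convergence. -/
theorem Controlled.tendsto_vert (H : Controlled h a u₀ ε₀ n g) (hh : 0 < h)
    (ha : 0 < a) (ha1 : a < 1) (hah : a ≤ 2 * h) (hu₀ : 0 < u₀) (hε₀ : 0 < ε₀) :
    Integrable (fun p : ℝ × ℝ => if p.1 < u₀ - p.2 then ((p.1 ^ (-2 : ℝ) : ℝ) : ℂ) *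
        (mehlerInt (h - 1) h (xiInv u₀ p.1 p.2) * g p.1 0 p.2) else 0)
      ((volume.restrict (Ioi 0)).prod (volume.restrict (Ioo 0 u₀))) ∧
    Tendsto (fun ε =>
      (∫ t in Ioo 0 u₀, ∫ p, vert h u₀ g ε t p
        ∂((volume.restrict (Ioi 0)).prod (volume.restrict (Ioo 0 u₀)))) -
      ∫ t in Ioo 0 u₀, ∫ p, vert h u₀ g (-ε) t p
        ∂((volume.restrict (Ioi 0)).prod (volume.restrict (Ioo 0 u₀)))) (𝓝[>] 0)
      (𝓝 (Complex.I * (((2 * u₀) ^ (h - 1) : ℝ) : ℂ) *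
        ∫ p : ℝ × ℝ, (if p.1 < u₀ - p.2 then ((p.1 ^ (-2 : ℝ) : ℝ) : ℂ) *
          (mehlerInt (h - 1) h (xiInv u₀ p.1 p.2) * g p.1 0 p.2) else 0)
        ∂((volume.restrict (Ioi 0)).prod (volume.restrict (Ioo 0 u₀))))) := by
  have h0 : (0 : ℝ) ∈ Icc (-ε₀) ε₀ := ⟨by linarith, hε₀.le⟩
  have i1 := H.integrable_arcTerm hh ha ha1 hah hu₀ (σ := 1) (Or.inl rfl) (by simp) h0
  have i2 := H.integrable_arcTerm hh ha ha1 hah hu₀ (σ := -1) (Or.inr rfl) (by simp) h0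
  have t1 := H.tendsto_integral_arcTerm hh ha ha1 hah hu₀ hε₀ (σ := 1) (Or.inl rfl)
  have t2 := H.tendsto_integral_arcTerm hh ha ha1 hah hu₀ hε₀ (σ := -1) (Or.inr rfl)
  have hc : Complex.I * (((2 * u₀) ^ (h - 1) : ℝ) : ℂ) ≠ 0 := by
    refine mul_ne_zero Complex.I_ne_zero ?_
    have : 0 < (2 * u₀) ^ (h - 1) := by positivity
    exact_mod_cast this.ne'
  have key : (fun p : ℝ × ℝ => Complex.I * (((2 * u₀) ^ (h - 1) : ℝ) : ℂ) *
      (if p.1 < u₀ - p.2 then ((p.1 ^ (-2 : ℝ) : ℝ) : ℂ) *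
        (mehlerInt (h - 1) h (xiInv u₀ p.1 p.2) * g p.1 0 p.2) else 0))
      =ᵐ[(volume.restrict (Ioi 0)).prod (volume.restrict (Ioo 0 u₀))]
      fun p => (∫ τ in Ioo (0 : ℝ) 1, arcTerm h u₀ g 1 0 (p, τ)) -
        ∫ τ in Ioo (0 : ℝ) 1, arcTerm h u₀ g (-1) 0 (p, τ) := by
    filter_upwards [ae_prod_mem, ae_ne_sub] with p hp hne
    have := arcLimit_sub hh ha ha1 hah hu₀ hp.1 hp.2 hne
    have e1 : ∀ σ : ℝ, ∫ τ in Ioo (0 : ℝ) 1, arcTerm h u₀ g σ 0 (p, τ) =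
        ((p.1 ^ (h - 2) : ℝ) : ℂ) * g p.1 0 p.2 * arcLimit h u₀ σ p := fun σ => by
      simp only [arcTerm]
      rw [integral_const_mul, arcLimit]
    rw [e1, e1, ← mul_sub, this]
    split_ifs with hlt
    · have e2 : p.1 ^ (-2 : ℝ) = p.1 ^ (h - 2) * p.1 ^ (-h) := by
        rw [← Real.rpow_add hp.1]; congr 1; ring
      rw [e2]; push_cast; ring
    · simp
  -- Integrability over the triangle is inherited from the two arc integrals; no estimate of the
  -- Legendre function near x = 1 or x = ∞ is needed.
  have hI := ((i1.integral_prod_left.sub i2.integral_prod_left).congr key.symm)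
  refine ⟨?_, ?_⟩
  · refine (hI.const_mul (Complex.I * (((2 * u₀) ^ (h - 1) : ℝ) : ℂ))⁻¹).congr
      (Eventually.of_forall fun p => ?_)
    simp only []
    rw [inv_mul_cancel_left₀ hc]
  · rw [← integral_const_mul, integral_congr_ae key, integral_sub i1.integral_prod_left
      i2.integral_prod_left, ← integral_prod _ i1, ← integral_prod _ i2]
    refine (t1.sub t2).congr' ?_
    filter_upwards [Ioo_mem_nhdsGT hε₀] with ε hε
    rw [one_mul, neg_one_mul, H.integral_vert hh ha ha1 hah hu₀ (σ := 1) (Or.inl rfl)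
        (by linarith [hε.1]) ⟨by linarith [hε.1], hε.2.le⟩ hε.1.ne',
      H.integral_vert hh ha ha1 hah hu₀ (σ := -1) (e := -ε) (Or.inr rfl)
        (by linarith [hε.1]) ⟨by linarith [hε.2], by linarith [hε.1]⟩ (by linarith [hε.1])]

end AdS

/-! ### The horizontal side. -/

namespace AdS

variable {h a u₀ ε₀ : ℝ} {n : ℝ → ℝ} {g : ℝ → ℝ → ℝ → ℂ}

/-- The integrand on the horizontal segment as a function of `t` and `p = (u, x)`. -/
def horiz (h u₀ : ℝ) (g : ℝ → ℝ → ℝ → ℂ) (t : ℝ) (p : ℝ × ℝ) : ℂ :=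
  ((p.1 ^ (h - 2) : ℝ) : ℂ) * (kern h p.1 (u₀ - t) (u₀ + t) p.2 ((0 : ℝ) : ℂ) * g p.1 p.2 t)

theorem Controlled.norm_horiz_le (H : Controlled h a u₀ ε₀ n g) (hh : 0 < h)
    (ha : 0 < a) (hah : a ≤ 2 * h) (hu₀ : 0 < u₀) {t : ℝ} (ht : t ∈ Ico 0 u₀) {p : ℝ × ℝ}
    (hp : 0 < p.1) (hx : p.2 ∈ Icc (-ε₀) ε₀) (hx0 : p.2 ≠ 0) :
    ‖horiz h u₀ g t p‖ ≤ ((u₀ - t) * (u₀ + t)) ^ (h - 1) * (n p.1 * (|p.2| ^ (-a) + 1)) := by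
  have hb := H.bound p.1 hp p.2 hx t (Ico_subset_Icc_self ht)
  have hS : 0 < u₀ - t := by linarith [ht.2]
  have hS' : 0 < u₀ + t := by linarith [ht.1]
  have hk := kern_zero_le (u₀ := u₀) hh ha hah hu₀ hp hS.le hS'.le hx0
  rw [horiz, norm_mul, norm_mul, Complex.norm_real, Real.norm_of_nonneg (by positivity),
    ← mul_assoc]
  calc _ ≤ (weight a h u₀ p.1 * (((u₀ - t) * (u₀ + t)) ^ (h - 1) * (|p.2| ^ (-a) + 1))) *
        ‖g p.1 p.2 t‖ := by gcongr
    _ = ((u₀ - t) * (u₀ + t)) ^ (h - 1) * ((weight a h u₀ p.1 * ‖g p.1 p.2 t‖) *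
        (|p.2| ^ (-a) + 1)) := by ring
    _ ≤ _ := by gcongr

theorem ae_ne_zero_and_mem {ε : ℝ} : ∀ᵐ p : ℝ × ℝ ∂((volume.restrict (Ioi 0)).prod
    (volume.restrict (Ioo (-ε) ε))), 0 < p.1 ∧ p.2 ∈ Ioo (-ε) ε ∧ p.2 ≠ 0 := by
  have h1 : ∀ᵐ p : ℝ × ℝ ∂((volume.restrict (Ioi (0 : ℝ))).prod
      (volume.restrict (Ioo (-ε) ε))), p.1 ∈ Ioi (0 : ℝ) :=
    Measure.quasiMeasurePreserving_fst.ae (ae_restrict_mem measurableSet_Ioi)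
  have h2 : ∀ᵐ p : ℝ × ℝ ∂((volume.restrict (Ioi (0 : ℝ))).prod
      (volume.restrict (Ioo (-ε) ε))), p.2 ∈ Ioo (-ε) ε :=
    Measure.quasiMeasurePreserving_snd.ae (ae_restrict_mem measurableSet_Ioo)
  have h3 : ∀ᵐ p : ℝ × ℝ ∂((volume.restrict (Ioi (0 : ℝ))).prod
      (volume.restrict (Ioo (-ε) ε))), p.2 ≠ 0 :=
    Measure.quasiMeasurePreserving_snd.ae (ae_restrict_of_ae (Measure.ae_ne volume 0))
  filter_upwards [h1, h2, h3] with p k1 k2 k3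
  exact ⟨k1, k2, k3⟩

theorem integrableOn_abs_rpow_add_one {ε : ℝ} (ha1 : a < 1) (hε : 0 < ε) :
    IntegrableOn (fun x : ℝ => |x| ^ (-a) + 1) (Ioo (-ε) ε) :=
  (integrableOn_Ioo_abs_rpow (r := -a) (by linarith) hε).add (integrable_const 1)

theorem Controlled.integrable_horiz (H : Controlled h a u₀ ε₀ n g) (hh : 0 < h)
    (ha : 0 < a) (ha1 : a < 1) (hah : a ≤ 2 * h) (hu₀ : 0 < u₀) {ε : ℝ} (hε : 0 < ε)
    (hεε₀ : ε ≤ ε₀) {t : ℝ} (ht : t ∈ Ico 0 u₀) : Integrable (horiz h u₀ g t)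
      ((volume.restrict (Ioi 0)).prod (volume.restrict (Ioo (-ε) ε))) := by
  have hI : Ioo (-ε) ε ⊆ Icc (-ε₀) ε₀ := fun x hx => ⟨by linarith [hx.1], by linarith [hx.2]⟩
  have hn := H.integrable.mul_prod (integrableOn_abs_rpow_add_one ha1 hε)
  have hm : Measurable fun p : ℝ × ℝ => ((p.1 ^ (h - 2) : ℝ) : ℂ) *
      kern h p.1 (u₀ - t) (u₀ + t) p.2 ((0 : ℝ) : ℂ) := by
    unfold kern; fun_prop
  have hg : AEStronglyMeasurable (fun p : ℝ × ℝ => g p.1 p.2 t)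
      ((volume.restrict (Ioi 0)).prod (volume.restrict (Ioo (-ε) ε))) := by
    rw [Measure.prod_restrict]
    refine ContinuousOn.aestronglyMeasurable ?_ (measurableSet_Ioi.prod measurableSet_Ioo)
    exact H.cont.comp (f := fun p : ℝ × ℝ => (p.1, p.2, t)) (by fun_prop)
      fun p hp => ⟨hp.1, hI hp.2, Ico_subset_Icc_self ht⟩
  refine Integrable.mono' (hn.const_mul (((u₀ - t) * (u₀ + t)) ^ (h - 1)))
    ((hm.aestronglyMeasurable.mul hg).congr (Eventually.of_forall fun p => ?_)) ?_
  · simp only [horiz, Pi.mul_apply, mul_assoc]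
  · filter_upwards [ae_ne_zero_and_mem] with p hp
    exact H.norm_horiz_le hh ha hah hu₀ ht hp.1 (hI hp.2.1) hp.2.2

/-- The bound separates the variables t, u and x. Only the x-factor depends on ε, and it is the
integral of an integrable function over (-ε, ε). -/
theorem Controlled.horiz_prod (H : Controlled h a u₀ ε₀ n g) (hh : 0 < h)
    (ha : 0 < a) (ha1 : a < 1) (hah : a ≤ 2 * h) (hu₀ : 0 < u₀) {ε : ℝ} (hε : 0 < ε)
    (hεε₀ : ε ≤ ε₀) : Integrable (fun q : ℝ × (ℝ × ℝ) => horiz h u₀ g q.1 q.2)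
      ((volume.restrict (Ioo 0 u₀)).prod
        ((volume.restrict (Ioi 0)).prod (volume.restrict (Ioo (-ε) ε)))) ∧
    ‖∫ t in Ioo 0 u₀, ∫ p, horiz h u₀ g t p
        ∂((volume.restrict (Ioi 0)).prod (volume.restrict (Ioo (-ε) ε)))‖ ≤
      (∫ t in Ioo 0 u₀, ((u₀ - t) * (u₀ + t)) ^ (h - 1)) *
        ((∫ u in Ioi 0, n u) * ∫ x in Ioo (-ε) ε, (|x| ^ (-a) + 1)) := by
  have hI : Ioo (-ε) ε ⊆ Icc (-ε₀) ε₀ := fun x hx => ⟨by linarith [hx.1], by linarith [hx.2]⟩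
  have hn := (integrableOn_Ioo_sub_mul_add_rpow hh hu₀).mul_prod
    (H.integrable.mul_prod (integrableOn_abs_rpow_add_one ha1 hε))
  have hm : Measurable fun q : ℝ × (ℝ × ℝ) => ((q.2.1 ^ (h - 2) : ℝ) : ℂ) *
      kern h q.2.1 (u₀ - q.1) (u₀ + q.1) q.2.2 ((0 : ℝ) : ℂ) := by
    unfold kern; fun_prop
  have hg : AEStronglyMeasurable (fun q : ℝ × (ℝ × ℝ) => g q.2.1 q.2.2 q.1)
      ((volume.restrict (Ioo 0 u₀)).prod
        ((volume.restrict (Ioi 0)).prod (volume.restrict (Ioo (-ε) ε)))) := by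
    rw [Measure.prod_restrict, Measure.prod_restrict]
    refine ContinuousOn.aestronglyMeasurable ?_
      (measurableSet_Ioo.prod (measurableSet_Ioi.prod measurableSet_Ioo))
    exact H.cont.comp (f := fun q : ℝ × (ℝ × ℝ) => (q.2.1, q.2.2, q.1)) (by fun_prop)
      fun q hq => ⟨hq.2.1, hI hq.2.2, Ioo_subset_Icc_self hq.1⟩
  have hle : ∀ᵐ q : ℝ × (ℝ × ℝ) ∂((volume.restrict (Ioo 0 u₀)).prod
      ((volume.restrict (Ioi 0)).prod (volume.restrict (Ioo (-ε) ε)))),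
      ‖horiz h u₀ g q.1 q.2‖ ≤
        ((u₀ - q.1) * (u₀ + q.1)) ^ (h - 1) * (n q.2.1 * (|q.2.2| ^ (-a) + 1)) := by
    have h1 : ∀ᵐ q : ℝ × (ℝ × ℝ) ∂((volume.restrict (Ioo 0 u₀)).prod
        ((volume.restrict (Ioi (0 : ℝ))).prod (volume.restrict (Ioo (-ε) ε)))), q.1 ∈ Ioo 0 u₀ :=
      Measure.quasiMeasurePreserving_fst.ae (ae_restrict_mem measurableSet_Ioo)
    filter_upwards [h1, Measure.quasiMeasurePreserving_snd.ae ae_ne_zero_and_mem] with q hq hp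
    exact H.norm_horiz_le hh ha hah hu₀ (Ioo_subset_Ico_self hq) hp.1 (hI hp.2.1) hp.2.2
  have hint : Integrable (fun q : ℝ × (ℝ × ℝ) => horiz h u₀ g q.1 q.2)
      ((volume.restrict (Ioo 0 u₀)).prod
        ((volume.restrict (Ioi 0)).prod (volume.restrict (Ioo (-ε) ε)))) := by
    refine Integrable.mono' hn
      ((hm.aestronglyMeasurable.mul hg).congr (Eventually.of_forall fun p => ?_)) hle
    simp only [horiz, Pi.mul_apply, mul_assoc]
  refine ⟨hint, ?_⟩
  rw [← integral_prod _ hint]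
  refine (norm_integral_le_of_norm_le hn hle).trans (le_of_eq ?_)
  rw [integral_prod_mul (fun t : ℝ => ((u₀ - t) * (u₀ + t)) ^ (h - 1))
    (fun p : ℝ × ℝ => n p.1 * (|p.2| ^ (-a) + 1)), integral_prod_mul n
    (fun x : ℝ => |x| ^ (-a) + 1)]

theorem Controlled.tendsto_horiz (H : Controlled h a u₀ ε₀ n g) (hh : 0 < h)
    (ha : 0 < a) (ha1 : a < 1) (hah : a ≤ 2 * h) (hu₀ : 0 < u₀) (hε₀ : 0 < ε₀) :
    Tendsto (fun ε => ∫ t in Ioo 0 u₀, ∫ p, horiz h u₀ g t p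
        ∂((volume.restrict (Ioi 0)).prod (volume.restrict (Ioo (-ε) ε)))) (𝓝[>] 0) (𝓝 0) := by
  have hev : ∀ᶠ ε in 𝓝[>] (0 : ℝ), ε ∈ Ioo 0 ε₀ := Ioo_mem_nhdsGT hε₀
  have hφ : Tendsto (fun ε : ℝ => ∫ x in Ioo (-ε) ε, (|x| ^ (-a) + 1)) (𝓝[>] 0) (𝓝 0) := by
    have h1 := (integrableOn_abs_rpow_add_one ha1 hε₀).tendsto_setIntegral_nhds_zero
      (l := 𝓝[>] (0 : ℝ)) (s := fun ε : ℝ => Ioo (-ε) ε) ?_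
    · refine h1.congr' (hev.mono fun ε hε => ?_)
      rw [Measure.restrict_restrict measurableSet_Ioo, inter_eq_left.2]
      exact Ioo_subset_Ioo (by linarith [hε.2]) hε.2.le
    · have h2 : Tendsto (fun ε : ℝ => ENNReal.ofReal (2 * ε)) (𝓝[>] 0) (𝓝 0) := by
        have : Continuous fun ε : ℝ => ENNReal.ofReal (2 * ε) :=
          ENNReal.continuous_ofReal.comp (by fun_prop)
        have h3 := this.tendsto 0
        simp only [mul_zero, ENNReal.ofReal_zero] at h3
        exact h3.mono_left nhdsWithin_le_nhds
      refine tendsto_of_tendsto_of_tendsto_of_le_of_le tendsto_const_nhds h2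
        (fun _ => zero_le) fun ε => ?_
      refine (Measure.restrict_apply_le _ _).trans (le_of_eq ?_)
      rw [Real.volume_Ioo]; congr 1; ring
  refine squeeze_zero_norm' (hev.mono fun ε hε =>
    (H.horiz_prod hh ha ha1 hah hu₀ hε.1 hε.2.le).2) ?_
  simpa using ((hφ.const_mul (∫ u in Ioi 0, n u)).const_mul
    (∫ t in Ioo 0 u₀, ((u₀ - t) * (u₀ + t)) ^ (h - 1)))

end AdS

/-! ### The contour integral in real coordinates. -/

namespace AdS

variable {h a u₀ z₀ ε₀ : ℝ} {n : ℝ → ℝ}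

theorem segInt_add_I_mul (G : ℂ → ℂ) (a : ℂ) (t : ℝ) :
    segInt G a (a + Complex.I * t) = Complex.I * ∫ y in (0 : ℝ)..t, G (a + Complex.I * y) := by
  have := intervalIntegral.smul_integral_comp_mul_left (a := 0) (b := 1)
    (fun y : ℝ => G (a + Complex.I * y)) t
  rw [mul_zero, mul_one] at this
  rw [segInt, ← this, add_sub_cancel_left, Complex.real_smul, mul_assoc]
  congr 3
  ext s
  congr 2
  push_cast; ring

theorem segInt_symm (G : ℂ → ℂ) (a b : ℂ) : segInt G a b = -segInt G b a := by
  have := intervalIntegral.integral_comp_sub_left (a := 0) (b := 1)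
    (fun s : ℝ => G (b + s * (a - b))) 1
  rw [sub_zero, sub_self] at this
  rw [segInt, segInt, ← this, ← neg_mul, neg_sub]
  congr 2
  ext s
  congr 1
  push_cast; ring

theorem segInt_sub_add (G : ℂ → ℂ) (a : ℂ) (ε : ℝ) :
    segInt G (a - ε) (a + ε) = ∫ x in (-ε)..ε, G (a + x) := by
  have := intervalIntegral.smul_integral_comp_mul_add (a := 0) (b := 1)
    (fun x : ℝ => G (a + x)) (2 * ε) (-ε)
  have e1 : 2 * ε * 0 + -ε = -ε := by ring
  have e2 : 2 * ε * 1 + -ε = ε := by ring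
  rw [e1, e2] at this
  rw [segInt, ← this, Complex.real_smul]
  congr 1
  · push_cast; ring
  · congr 1
    ext s
    congr 1
    push_cast; ring

/-- The modified propagator in the coordinates `z = z₀ + e + i y`, `w = z₀ + i t`. -/
theorem Ghat_eq_kern {u t e y : ℝ} (hu : 0 < u) (ht : |t| < u₀) (he : e ≠ 0 ∨ y = t) :
    Ghat h u (z₀ + e + Complex.I * y) u₀ z₀ (z₀ + Complex.I * t) =
      propConst h * ((u₀ ^ (1 - h) : ℝ) : ℂ) * ((u ^ h : ℝ) : ℂ) *
        kern h u (u₀ - y) (u₀ + y) e ((t - y : ℝ) : ℂ) := by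
  have hu₀ : 0 < u₀ := (abs_nonneg t).trans_lt ht
  obtain ⟨ht1, ht2⟩ := abs_lt.1 ht
  have hX : 0 < (u₀ - t) * (u₀ + t) := mul_pos (by linarith) (by linarith)
  have hI := Complex.I_sq
  have e1 : (u₀ : ℂ) / ((u₀ : ℂ) ^ 2 + ((z₀ : ℂ) - (z₀ + Complex.I * t)) ^ 2) =
      ((u₀ / ((u₀ - t) * (u₀ + t)) : ℝ) : ℂ) := by
    push_cast
    congr 1
    linear_combination (t : ℂ) ^ 2 * hI
  have e2 : ((u₀ : ℂ) / ((u₀ : ℂ) ^ 2 + ((z₀ : ℂ) - (z₀ + Complex.I * t)) ^ 2)) ^ (1 - (h : ℂ)) =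
      ((u₀ ^ (1 - h) : ℝ) : ℂ) * ((((u₀ - y : ℝ) : ℂ) - ((t - y : ℝ) : ℂ)) *
        (((u₀ + y : ℝ) : ℂ) + ((t - y : ℝ) : ℂ))) ^ ((h - 1 : ℝ) : ℂ) := by
    have e3 : (((u₀ - y : ℝ) : ℂ) - ((t - y : ℝ) : ℂ)) * (((u₀ + y : ℝ) : ℂ) + ((t - y : ℝ) : ℂ)) =
        (((u₀ - t) * (u₀ + t) : ℝ) : ℂ) := by push_cast; ring
    have e4 : (1 - (h : ℂ)) = ((1 - h : ℝ) : ℂ) := by push_cast; ring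
    rw [e1, e3, e4, ← Complex.ofReal_cpow (by positivity), ← Complex.ofReal_cpow hX.le,
      ← Complex.ofReal_mul, Real.div_rpow hu₀.le hX.le, div_eq_mul_inv, ← Real.rpow_neg hX.le,
      neg_sub]
  set σ : ℂ := ((t - y : ℝ) : ℂ) + e * Complex.I with hσ
  -- Off the negative axis inversion commutes with the principal power. On the horizontal side e may
  -- vanish, but then σ = 0 lies between the branch points.
  have hY : ((u : ℂ) - σ) * (u + σ) ∈ Complex.slitPlane := by
    refine sub_mul_add_mem_slitPlane ?_
    rcases he with he | he
    · exact Or.inl (by simpa [hσ] using he)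
    · refine Or.inr ?_
      have : σ.re = 0 := by simp [hσ, he]
      rw [this]; exact ⟨by linarith, hu⟩
  have e5 : ((u : ℂ) / ((u : ℂ) ^ 2 + ((z₀ + e + Complex.I * y : ℂ) - (z₀ + Complex.I * t)) ^ 2)) ^
      (h : ℂ) = ((u ^ h : ℝ) : ℂ) * (((u : ℂ) - σ) * (u + σ)) ^ ((-h : ℝ) : ℂ) := by
    have e6 : (u : ℂ) ^ 2 + ((z₀ + e + Complex.I * y : ℂ) - (z₀ + Complex.I * t)) ^ 2 =
        ((u : ℂ) - σ) * (u + σ) := by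
      rw [hσ]; push_cast
      linear_combination ((e : ℂ) ^ 2 + (t - y) ^ 2) * hI
    rw [e6, div_eq_mul_inv, Complex.ofReal_mul_cpow hu, Complex.inv_cpow _ _
      (Complex.slitPlane_arg_ne_pi hY), ← Complex.cpow_neg, ← Complex.ofReal_cpow hu.le,
      Complex.ofReal_neg]
  rw [Ghat, e2, e5, kern]
  ring

/-- A function on the rectangle in the coordinates `z = z₀ + e + i y`. -/
def coord (z₀ : ℝ) (f : ℂ × ℂ → ℂ) (u e y : ℝ) : ℂ := f (u, z₀ + e + Complex.I * y)

theorem one_div_sq_mul_rpow {u : ℝ} (hu : 0 < u) :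
    1 / (u : ℂ) ^ 2 * ((u ^ h : ℝ) : ℂ) = ((u ^ (h - 2) : ℝ) : ℂ) := by
  have : u ^ (h - 2) = 1 / u ^ 2 * u ^ h := by
    rw [Real.rpow_sub hu, Real.rpow_ofNat]; ring
  rw [this]; push_cast; ring

theorem integral_vert_section {f : ℂ × ℂ → ℂ} {e t u : ℝ} (hu : 0 < u) (ht : t ∈ Ico 0 u₀)
    (he : e ≠ 0) :
    1 / (u : ℂ) ^ 2 * ∫ y in (0 : ℝ)..t, Ghat h u (z₀ + e + Complex.I * y) u₀ z₀
        (z₀ + Complex.I * t) * f (u, z₀ + e + Complex.I * y) =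
      propConst h * ((u₀ ^ (1 - h) : ℝ) : ℂ) *
        ∫ y in Ioo 0 u₀, vert h u₀ (coord z₀ f) e t (u, y) := by
  have htu : |t| < u₀ := by rw [abs_of_nonneg ht.1]; exact ht.2
  have hset : Ioo 0 t = Ioo 0 u₀ ∩ Iio t := by
    ext y; constructor
    · rintro ⟨h1, h2⟩; exact ⟨⟨h1, h2.trans ht.2⟩, h2⟩
    · rintro ⟨⟨h1, -⟩, h2⟩; exact ⟨h1, h2⟩
  have h1 : ∫ y in Ioo 0 u₀, vert h u₀ (coord z₀ f) e t (u, y) =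
      ∫ y in Ioo 0 t, ((u ^ (h - 2) : ℝ) : ℂ) *
        (kern h u (u₀ - y) (u₀ + y) e ((t - y : ℝ) : ℂ) * coord z₀ f u e y) := by
    rw [hset, ← setIntegral_indicator measurableSet_Iio]
    rfl
  rw [h1, intervalIntegral.integral_of_le ht.1, integral_Ioc_eq_integral_Ioo,
    ← integral_const_mul, ← integral_const_mul]
  congr 1
  ext y
  rw [Ghat_eq_kern hu htu (Or.inl he), ← one_div_sq_mul_rpow hu, coord]
  ring

theorem integral_horiz_section {f : ℂ × ℂ → ℂ} {ε t u : ℝ} (hu : 0 < u) (ht : t ∈ Ico 0 u₀)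
    (hε : 0 < ε) :
    1 / (u : ℂ) ^ 2 * ∫ x in (-ε)..ε, Ghat h u (z₀ + Complex.I * t + x) u₀ z₀
        (z₀ + Complex.I * t) * f (u, z₀ + Complex.I * t + x) =
      propConst h * ((u₀ ^ (1 - h) : ℝ) : ℂ) *
        ∫ x in Ioo (-ε) ε, horiz h u₀ (coord z₀ f) t (u, x) := by
  have htu : |t| < u₀ := by rw [abs_of_nonneg ht.1]; exact ht.2
  rw [intervalIntegral.integral_of_le (by linarith), integral_Ioc_eq_integral_Ioo,
    ← integral_const_mul, ← integral_const_mul]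
  congr 1
  ext x
  have : (z₀ : ℂ) + Complex.I * t + x = z₀ + x + Complex.I * t := by ring
  rw [this, Ghat_eq_kern hu htu (Or.inr rfl), horiz, ← one_div_sq_mul_rpow hu, coord, sub_self]
  ring

/-- The inner integrand in terms of `vert` and `horiz`. -/
theorem contourTerm_eq {f : ℂ × ℂ → ℂ} {ε t u : ℝ} (hu : 0 < u) (ht : t ∈ Ico 0 u₀)
    (hε : 0 < ε) : contourTerm h u₀ z₀ f ε (z₀ + Complex.I * t) u =
      propConst h * ((u₀ ^ (1 - h) : ℝ) : ℂ) *
        (Complex.I * (∫ y in Ioo 0 u₀, vert h u₀ (coord z₀ f) (-ε) t (u, y)) -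
          Complex.I * (∫ y in Ioo 0 u₀, vert h u₀ (coord z₀ f) ε t (u, y)) +
          ∫ x in Ioo (-ε) ε, horiz h u₀ (coord z₀ f) t (u, x)) := by
  have v1 := integral_vert_section (h := h) (z₀ := z₀) (f := f) hu ht (neg_ne_zero.2 hε.ne')
  have v2 := integral_vert_section (h := h) (z₀ := z₀) (f := f) hu ht hε.ne'
  have v3 := integral_horiz_section (h := h) (z₀ := z₀) (f := f) hu ht hε
  have a1 : (z₀ : ℂ) + Complex.I * t - ε = z₀ - ε + Complex.I * t := by ring
  have a2 : (z₀ : ℂ) + Complex.I * t + ε = z₀ + ε + Complex.I * t := by ring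
  rw [contourTerm, piContourInt, segInt_sub_add, a1, a2, segInt_add_I_mul,
    segInt_symm _ (z₀ + ε + Complex.I * t), segInt_add_I_mul]
  simp only [Complex.ofReal_neg, ← sub_eq_add_neg] at v1
  linear_combination Complex.I * v1 - Complex.I * v2 + v3

end AdS

/-! ### The upper half of the outer integral, and reflection. -/

namespace AdS

variable {h a u₀ z₀ ε₀ : ℝ} {n : ℝ → ℝ} {f : ℂ × ℂ → ℂ}

/-- The integrand on the right-hand side on the upper half of the triangle. -/
def triTerm (h u₀ z₀ : ℝ) (f : ℂ × ℂ → ℂ) (p : ℝ × ℝ) : ℂ :=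
  if p.1 < u₀ - p.2 then 1 / (p.1 : ℂ) ^ 2 *
    (Gtilde h p.1 (z₀ + Complex.I * p.2) u₀ z₀ * f (p.1, z₀ + Complex.I * p.2)) else 0

theorem integral_mul_combination {α : Type*} [MeasurableSpace α] {μ : Measure α} {A B C : α → ℂ}
    (hA : Integrable A μ) (hB : Integrable B μ) (hC : Integrable C μ) (c k : ℂ) :
    Integrable (fun x => c * (k * A x - k * B x + C x)) μ ∧
    ∫ x, c * (k * A x - k * B x + C x) ∂μ =
      c * (k * (∫ x, A x ∂μ) - k * (∫ x, B x ∂μ) + ∫ x, C x ∂μ) := by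
  have j := (hA.const_mul k).sub (hB.const_mul k)
  refine ⟨(j.add hC).const_mul c, ?_⟩
  rw [integral_const_mul, integral_add (f := fun x => k * A x - k * B x) j hC,
    integral_sub (hA.const_mul k) (hB.const_mul k), integral_const_mul, integral_const_mul]

theorem Controlled.integrableOn_contourTerm (H : Controlled h a u₀ ε₀ n (coord z₀ f)) (hh : 0 < h)
    (ha : 0 < a) (ha1 : a < 1) (hah : a ≤ 2 * h) (hu₀ : 0 < u₀) {ε : ℝ} (hε : 0 < ε)
    (hεε₀ : ε ≤ ε₀) {t : ℝ} (ht : t ∈ Ico 0 u₀) :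
    IntegrableOn (contourTerm h u₀ z₀ f ε (z₀ + Complex.I * t)) (Ioi 0) ∧
    ∫ u in Ioi 0, contourTerm h u₀ z₀ f ε (z₀ + Complex.I * t) u =
      propConst h * ((u₀ ^ (1 - h) : ℝ) : ℂ) *
        (Complex.I * (∫ p, vert h u₀ (coord z₀ f) (-ε) t p
          ∂((volume.restrict (Ioi 0)).prod (volume.restrict (Ioo 0 u₀)))) -
        Complex.I * (∫ p, vert h u₀ (coord z₀ f) ε t p
          ∂((volume.restrict (Ioi 0)).prod (volume.restrict (Ioo 0 u₀)))) +
        ∫ p, horiz h u₀ (coord z₀ f) t p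
          ∂((volume.restrict (Ioi 0)).prod (volume.restrict (Ioo (-ε) ε)))) := by
  have i1 := H.integrable_vert hh hah hu₀ (e := -ε) ⟨by linarith, by linarith⟩
    (neg_ne_zero.2 hε.ne') ht
  have i2 := H.integrable_vert hh hah hu₀ (e := ε) ⟨by linarith, by linarith⟩ hε.ne' ht
  have i3 := H.integrable_horiz hh ha ha1 hah hu₀ hε hεε₀ ht
  have he : ∀ u ∈ Ioi (0 : ℝ), contourTerm h u₀ z₀ f ε (z₀ + Complex.I * t) u = _ := fun u hu =>
    contourTerm_eq hu ht hε
  obtain ⟨j1, j2⟩ := integral_mul_combination i1.integral_prod_left i2.integral_prod_left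
    i3.integral_prod_left (propConst h * ((u₀ ^ (1 - h) : ℝ) : ℂ)) Complex.I
  refine ⟨IntegrableOn.congr_fun j1 (fun u hu => (he u hu).symm) measurableSet_Ioi, ?_⟩
  rw [setIntegral_congr_fun measurableSet_Ioi he, j2, integral_prod _ i1, integral_prod _ i2,
    integral_prod _ i3]

theorem Controlled.integrableOn_integral_contourTerm
    (H : Controlled h a u₀ ε₀ n (coord z₀ f)) (hh : 0 < h)
    (ha : 0 < a) (ha1 : a < 1) (hah : a ≤ 2 * h) (hu₀ : 0 < u₀) {ε : ℝ} (hε : 0 < ε)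
    (hεε₀ : ε ≤ ε₀) :
    IntegrableOn (fun t : ℝ => ∫ u in Ioi 0, contourTerm h u₀ z₀ f ε (z₀ + Complex.I * t) u)
      (Ioo 0 u₀) ∧
    ∫ t in Ioo 0 u₀, ∫ u in Ioi 0, contourTerm h u₀ z₀ f ε (z₀ + Complex.I * t) u =
      propConst h * ((u₀ ^ (1 - h) : ℝ) : ℂ) *
        (Complex.I * (∫ t in Ioo 0 u₀, ∫ p, vert h u₀ (coord z₀ f) (-ε) t p
          ∂((volume.restrict (Ioi 0)).prod (volume.restrict (Ioo 0 u₀)))) -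
        Complex.I * (∫ t in Ioo 0 u₀, ∫ p, vert h u₀ (coord z₀ f) ε t p
          ∂((volume.restrict (Ioi 0)).prod (volume.restrict (Ioo 0 u₀)))) +
        ∫ t in Ioo 0 u₀, ∫ p, horiz h u₀ (coord z₀ f) t p
          ∂((volume.restrict (Ioi 0)).prod (volume.restrict (Ioo (-ε) ε)))) := by
  have i1 := (H.integrable_vert_prod hh hah hu₀ (e := -ε) ⟨by linarith, by linarith⟩
    (neg_ne_zero.2 hε.ne')).integral_prod_left
  have i2 := (H.integrable_vert_prod hh hah hu₀ (e := ε) ⟨by linarith, by linarith⟩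
    hε.ne').integral_prod_left
  have i3 := (H.horiz_prod hh ha ha1 hah hu₀ hε hεε₀).1.integral_prod_left
  have he : ∀ t ∈ Ioo 0 u₀,
      ∫ u in Ioi 0, contourTerm h u₀ z₀ f ε (z₀ + Complex.I * t) u = _ := fun t ht =>
    (H.integrableOn_contourTerm hh ha ha1 hah hu₀ hε hεε₀ (Ioo_subset_Ico_self ht)).2
  obtain ⟨j1, j2⟩ := integral_mul_combination i1 i2 i3
    (propConst h * ((u₀ ^ (1 - h) : ℝ) : ℂ)) Complex.I
  refine ⟨IntegrableOn.congr_fun j1 (fun t ht => (he t ht).symm) measurableSet_Ioo, ?_⟩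
  rw [setIntegral_congr_fun measurableSet_Ioo he, j2]

/-- The factor π of the theorem arises here: u₀^(1-h) (2u₀)^(h-1) = 2^(h-1) is π times the
normalization 2^h/(2π) of the Legendre function. -/
theorem mul_mehlerInt_eq_Gtilde (hh : 0 < h) (hu₀ : 0 < u₀) {p : ℝ × ℝ} (hp : 0 < p.1)
    (hy : p.2 ∈ Ioo 0 u₀) :
    propConst h * ((u₀ ^ (1 - h) : ℝ) : ℂ) * (((2 * u₀) ^ (h - 1) : ℝ) : ℂ) *
      (if p.1 < u₀ - p.2 then ((p.1 ^ (-2 : ℝ) : ℝ) : ℂ) *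
        (mehlerInt (h - 1) h (xiInv u₀ p.1 p.2) * coord z₀ f p.1 0 p.2) else 0) =
    Real.pi * triTerm h u₀ z₀ f p := by
  rw [triTerm]
  split_ifs with hlt
  · rw [Gtilde_eq_legendreFn hh z₀ hu₀ hp (by rw [abs_of_pos hy.1]; linarith), legendreFn, coord]
    have e1 : u₀ ^ (1 - h) * (2 * u₀) ^ (h - 1) = Real.pi * (2 ^ h / (2 * Real.pi)) := by
      rw [Real.mul_rpow zero_le_two hu₀.le, mul_left_comm, ← Real.rpow_add hu₀,
        Real.rpow_sub_one two_ne_zero]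
      have := Real.pi_pos.ne'
      simp only [sub_add_sub_cancel, sub_self, Real.rpow_zero]
      field_simp
    have e2 : p.1 ^ (-2 : ℝ) = 1 / p.1 ^ 2 := by
      rw [Real.rpow_neg hp.le, Real.rpow_ofNat, one_div]
    have e1c := congrArg (fun r : ℝ => (r : ℂ)) e1
    simp only [Complex.ofReal_mul] at e1c
    have e2c : ((p.1 ^ (-2 : ℝ) : ℝ) : ℂ) = 1 / (p.1 : ℂ) ^ 2 := by rw [e2]; push_cast; rfl
    rw [e2c, Complex.ofReal_zero, add_zero]
    linear_combination (propConst h * (1 / (p.1 : ℂ) ^ 2) *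
      (mehlerInt (h - 1) h (xiInv u₀ p.1 p.2) * f (p.1, z₀ + Complex.I * p.2))) * e1c
  · simp

/-- The limit of the contribution of the upper half of the outer integral. -/
theorem Controlled.tendsto_integral_contourTerm
    (H : Controlled h a u₀ ε₀ n (coord z₀ f)) (hh : 0 < h)
    (ha : 0 < a) (ha1 : a < 1) (hah : a ≤ 2 * h) (hu₀ : 0 < u₀) (hε₀ : 0 < ε₀) :
    Integrable (triTerm h u₀ z₀ f) ((volume.restrict (Ioi 0)).prod (volume.restrict (Ioo 0 u₀))) ∧
    Tendsto (fun ε => ∫ t in Ioo 0 u₀, ∫ u in Ioi 0,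
        contourTerm h u₀ z₀ f ε (z₀ + Complex.I * (t : ℝ)) u) (𝓝[>] 0)
      (𝓝 (Real.pi * ∫ p, triTerm h u₀ z₀ f p
        ∂((volume.restrict (Ioi 0)).prod (volume.restrict (Ioo 0 u₀))))) := by
  obtain ⟨i, t1⟩ := H.tendsto_vert hh ha ha1 hah hu₀ hε₀
  have t2 := H.tendsto_horiz hh ha ha1 hah hu₀ hε₀
  have hae : (fun p : ℝ × ℝ => propConst h * ((u₀ ^ (1 - h) : ℝ) : ℂ) *
      (((2 * u₀) ^ (h - 1) : ℝ) : ℂ) * (if p.1 < u₀ - p.2 then ((p.1 ^ (-2 : ℝ) : ℝ) : ℂ) *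
        (mehlerInt (h - 1) h (xiInv u₀ p.1 p.2) * coord z₀ f p.1 0 p.2) else 0))
      =ᵐ[(volume.restrict (Ioi 0)).prod (volume.restrict (Ioo 0 u₀))]
      fun p => Real.pi * triTerm h u₀ z₀ f p := by
    filter_upwards [ae_prod_mem] with p hp
    exact mul_mehlerInt_eq_Gtilde hh hu₀ hp.1 hp.2
  refine ⟨?_, ?_⟩
  · have hpi : (Real.pi : ℂ) ≠ 0 := by exact_mod_cast Real.pi_ne_zero
    refine (((i.const_mul _).congr hae).const_mul (Real.pi : ℂ)⁻¹).congr
      (Eventually.of_forall fun p => ?_)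
    simp only []
    rw [inv_mul_cancel_left₀ hpi]
  · rw [← integral_const_mul, ← integral_congr_ae hae, integral_const_mul]
    have := ((t1.const_mul (-Complex.I)).add t2).const_mul
      (propConst h * ((u₀ ^ (1 - h) : ℝ) : ℂ))
    have hI := Complex.I_sq
    have e : ∀ X : ℂ, propConst h * ((u₀ ^ (1 - h) : ℝ) : ℂ) * (-Complex.I * (Complex.I *
        (((2 * u₀) ^ (h - 1) : ℝ) : ℂ) * X) + 0) = propConst h * ((u₀ ^ (1 - h) : ℝ) : ℂ) *
        (((2 * u₀) ^ (h - 1) : ℝ) : ℂ) * X := fun X => by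
      linear_combination (-(propConst h * ((u₀ ^ (1 - h) : ℝ) : ℂ) *
        (((2 * u₀) ^ (h - 1) : ℝ) : ℂ) * X)) * hI
    rw [e] at this
    refine this.congr' ?_
    filter_upwards [Ioo_mem_nhdsGT hε₀] with ε hε
    rw [(H.integrableOn_integral_contourTerm hh ha ha1 hah hu₀ hε.1 hε.2.le).2]
    ring

/-- The reflection of a function of `(u, z)` in `z = z₀`. -/
def reflect (z₀ : ℝ) (f : ℂ × ℂ → ℂ) (p : ℂ × ℂ) : ℂ := f (p.1, 2 * z₀ - p.2)

theorem coord_reflect (u e y : ℝ) : coord z₀ (reflect z₀ f) u e y = coord z₀ f u (-e) (-y) := by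
  simp only [coord, reflect]
  congr 2
  push_cast; ring

theorem segInt_comp_sub_left (G : ℂ → ℂ) (c a b : ℂ) :
    segInt (fun z => G (c - z)) a b = -segInt G (c - a) (c - b) := by
  rw [segInt, segInt, ← neg_mul]
  congr 1
  · ring
  · congr 1; ext s; congr 1; ring

/-- The reflection maps the contour of w to that of 2z₀ - w with reversed orientation, and dz
changes sign as well, so no sign remains. -/
theorem piContourInt_comp_sub_left (G : ℂ → ℂ) (w : ℂ) (ε : ℝ) :
    piContourInt z₀ w ε (fun z => G (2 * z₀ - z)) = piContourInt z₀ (2 * z₀ - w) ε G := by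
  rw [piContourInt, piContourInt, segInt_comp_sub_left, segInt_comp_sub_left, segInt_comp_sub_left]
  have e1 : 2 * (z₀ : ℂ) - (z₀ - ε) = z₀ + ε := by ring
  have e2 : 2 * (z₀ : ℂ) - (z₀ + ε) = z₀ - ε := by ring
  have e3 : 2 * (z₀ : ℂ) - (w - ε) = 2 * z₀ - w + ε := by ring
  have e4 : 2 * (z₀ : ℂ) - (w + ε) = 2 * z₀ - w - ε := by ring
  rw [e1, e2, e3, e4, segInt_symm G (z₀ + ε), segInt_symm G (2 * z₀ - w + ε) (2 * z₀ - w - ε),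
    segInt_symm G (2 * z₀ - w - ε) (z₀ - ε)]
  ring

theorem contourTerm_reflect (ε u : ℝ) (w : ℂ) :
    contourTerm h u₀ z₀ (reflect z₀ f) ε w u = contourTerm h u₀ z₀ f ε (2 * z₀ - w) u := by
  have e1 : ((z₀ : ℂ) - (2 * z₀ - w)) ^ 2 = (z₀ - w) ^ 2 := by ring
  have e2 : ∀ z : ℂ, (2 * (z₀ : ℂ) - z - (2 * z₀ - w)) ^ 2 = (z - w) ^ 2 := fun z => by ring
  rw [contourTerm, contourTerm, ← piContourInt_comp_sub_left]
  simp only [Ghat, reflect, e1, e2]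

end AdS

/-! ### From the growth conditions to a dominating function. -/

namespace AdS

variable {h a u₀ z₀ ε₀ : ℝ} {f : ℂ × ℂ → ℂ}

theorem weight_le {u : ℝ} (ha : 0 ≤ a) (hu₀ : 0 < u₀) (hu : 0 < u) :
    weight a h u₀ u ≤ (1 + (3 * u₀) ^ (-a)) * u ^ (a - h - 2) ∧
    weight a h u₀ u ≤ (1 + (3 * u₀) ^ a) * u ^ (-h - 2) := by
  have k1 : 0 ≤ (3 * u₀) ^ (-a) := by positivity
  have k2 : 0 ≤ (3 * u₀) ^ a := by positivity
  have k3 : 0 ≤ u ^ (a - h - 2) := by positivity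
  have k4 : 0 ≤ u ^ (-h - 2) := by positivity
  rw [weight]
  split_ifs with hU
  · refine ⟨by nlinarith [mul_nonneg k1 k3], ?_⟩
    have e : u ^ (a - h - 2) = u ^ a * u ^ (-h - 2) := by
      rw [← Real.rpow_add hu]; congr 1; ring
    have : u ^ a ≤ (3 * u₀) ^ a := by gcongr
    rw [e]
    exact mul_le_mul_of_nonneg_right (by linarith) k4
  · refine ⟨?_, by nlinarith [mul_nonneg k2 k4]⟩
    have e : u ^ (-h - 2) = u ^ (-a) * u ^ (a - h - 2) := by
      rw [← Real.rpow_add hu]; congr 1; ring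
    have : u ^ (-a) ≤ (3 * u₀) ^ (-a) :=
      Real.rpow_le_rpow_of_nonpos (by positivity) (not_le.1 hU).le (by linarith)
    rw [e]
    exact mul_le_mul_of_nonneg_right (by linarith) k3

theorem isCompact_rect (u₀ z₀ ε₀ : ℝ) : IsCompact (rect u₀ z₀ ε₀) := by
  have : rect u₀ z₀ ε₀ = Icc (z₀ - ε₀) (z₀ + ε₀) ×ℂ Icc (-u₀) u₀ := by
    ext z
    simp only [rect, Complex.mem_reProdIm, mem_ofPred_eq, mem_Icc, abs_le]
    constructor <;> rintro ⟨⟨h1, h2⟩, h3, h4⟩ <;> refine ⟨⟨?_, ?_⟩, ?_, ?_⟩ <;> linarith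
  rw [this]
  exact isCompact_Icc.reProdIm isCompact_Icc

/-- The growth conditions on `f` provide an exponent and a dominating function. -/
theorem exists_dominating (hh : 0 < h) (hu₀ : 0 < u₀) (hε₀ : 0 < ε₀)
    {Ω : Set (ℂ × ℂ)} (hf : ContinuousOn f Ω)
    (hsub : ∀ u : ℝ, 0 < u → ∀ z ∈ rect u₀ z₀ ε₀, ((u : ℂ), z) ∈ Ω)
    {δ : ℝ} (hδ : 0 < δ) (hδ' : 1 - 2 * h < δ) {C : ℝ}
    (hzero : ∀ᶠ u : ℝ in 𝓝[>] 0, ∀ z ∈ rect u₀ z₀ ε₀, u ^ (-h) * ‖f (u, z)‖ ≤ C * u ^ δ)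
    {M : ℝ → ℝ} (hM : IntegrableOn (fun u : ℝ => u ^ (-h - 2) * M u) (Ioi 1))
    (hinf : ∀ u : ℝ, 1 < u → ∀ z ∈ rect u₀ z₀ ε₀, ‖f (u, z)‖ ≤ M u) :
    ∃ (a : ℝ) (n : ℝ → ℝ), 0 < a ∧ a < 1 ∧ a ≤ 2 * h ∧ IntegrableOn n (Ioi 0) ∧
      ∀ u : ℝ, 0 < u → ∀ z ∈ rect u₀ z₀ ε₀, weight a h u₀ u * ‖f (u, z)‖ ≤ n u := by
  -- The interpolation needs a ≤ 2h, the singularities need a < 1, and near u = 0 the weighted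
  -- function is of size u^(a + δ - 2), which needs a + δ > 1. Such an a exists because δ > max(0, 1
  -- - 2h).
  obtain ⟨a, ha, ha1, hah, haδ⟩ : ∃ a : ℝ, 0 < a ∧ a < 1 ∧ a ≤ 2 * h ∧ 1 < a + δ := by
    rcases lt_or_ge (2 * h) 1 with h1 | h1
    · exact ⟨2 * h, by linarith, h1, le_rfl, by linarith⟩
    · refine ⟨max (1 - δ / 2) (1 / 2), ?_, ?_, ?_, ?_⟩
      · exact lt_of_lt_of_le (by norm_num) (le_max_right _ _)
      · exact max_lt (by linarith) (by norm_num)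
      · exact (max_le (by linarith) (by norm_num)).trans h1
      · linarith [le_max_left (1 - δ / 2) (1 / 2)]
  obtain ⟨η₀, hη₀, hη₀'⟩ := mem_nhdsGT_iff_exists_Ioo_subset.1 hzero
  have hη₀pos : 0 < η₀ := hη₀
  set η := min η₀ 1 with hη
  have hη0 : 0 < η := lt_min hη₀pos one_pos
  have hη1 : η ≤ 1 := min_le_right _ _
  have hz₀ : (z₀ : ℂ) ∈ rect u₀ z₀ ε₀ := by simp [rect, hε₀.le, hu₀.le]
  obtain ⟨B, hB⟩ : ∃ B : ℝ, ∀ u ∈ Icc η 1, ∀ z ∈ rect u₀ z₀ ε₀, ‖f ((u : ℂ), z)‖ ≤ B := by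
    have hc : ContinuousOn (fun p : ℝ × ℂ => f ((p.1 : ℂ), p.2)) (Icc η 1 ×ˢ rect u₀ z₀ ε₀) :=
      hf.comp (f := fun p : ℝ × ℂ => ((p.1 : ℂ), p.2)) (by fun_prop)
        fun p hp => hsub p.1 (hη0.trans_le hp.1.1) p.2 hp.2
    obtain ⟨B, hB⟩ := (isCompact_Icc.prod (isCompact_rect u₀ z₀ ε₀)).exists_bound_of_continuousOn hc
    exact ⟨B, fun u hu z hz => hB (u, z) ⟨hu, hz⟩⟩
  set K₁ := 1 + (3 * u₀) ^ (-a) with hK₁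
  set K₂ := 1 + (3 * u₀) ^ a with hK₂
  have hK₁0 : 0 ≤ K₁ := by positivity
  have hK₂0 : 0 ≤ K₂ := by positivity
  set n₁ : ℝ → ℝ := (Ioo 0 η).indicator fun u => K₁ * |C| * u ^ (a + δ - 2) with hn₁
  set n₂ : ℝ → ℝ := (Icc η 1).indicator fun _ =>
    K₁ * (η ^ (a - h - 2) + 1 ^ (a - h - 2)) * |B| with hn₂
  set n₃ : ℝ → ℝ := (Ioi 1).indicator fun u => K₂ * (u ^ (-h - 2) * M u) with hn₃
  have p1 : ∀ u, 0 ≤ n₁ u := fun u => indicator_nonneg (fun x hx => by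
    have := hx.1; positivity) u
  have p2 : ∀ u, 0 ≤ n₂ u := fun u => indicator_nonneg (fun x hx => by positivity) u
  have p3 : ∀ u, 0 ≤ n₃ u := fun u => indicator_nonneg (fun x hx => by
    have h1 : 1 < x := hx
    have := (norm_nonneg _).trans (hinf x h1 z₀ hz₀)
    positivity) u
  refine ⟨a, fun u => n₁ u + n₂ u + n₃ u, ha, ha1, hah, ?_, ?_⟩
  · have i1 : Integrable n₁ := IntegrableOn.integrable_indicator
      ((integrableOn_Ioo_rpow (r := a + δ - 2) (by linarith) hη0).const_mul _) measurableSet_Ioo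
    have i2 : Integrable n₂ := IntegrableOn.integrable_indicator
      (integrableOn_const (by simp)) measurableSet_Icc
    have i3 : Integrable n₃ := IntegrableOn.integrable_indicator (hM.const_mul _) measurableSet_Ioi
    exact ((i1.add i2).add i3).integrableOn
  · intro u hu z hz
    obtain ⟨w1, w2⟩ := weight_le (h := h) ha.le hu₀ hu
    rcases lt_or_ge u η with h1 | h1
    · refine le_trans ?_ (le_add_of_nonneg_right (p3 u))
      refine le_trans ?_ (le_add_of_nonneg_right (p2 u))
      rw [hn₁, indicator_of_mem (show u ∈ Ioo 0 η from ⟨hu, h1⟩)]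
      have h2 : u ^ (-h) * ‖f (u, z)‖ ≤ C * u ^ δ :=
        hη₀' ⟨hu, h1.trans_le (min_le_left _ _)⟩ z hz
      have e1 : u ^ (a - h - 2) = u ^ (a - 2) * u ^ (-h) := by
        rw [← Real.rpow_add hu]; congr 1; ring
      have e2 : u ^ (a + δ - 2) = u ^ (a - 2) * u ^ δ := by
        rw [← Real.rpow_add hu]; congr 1; ring
      calc _ ≤ (K₁ * u ^ (a - h - 2)) * ‖f (u, z)‖ := by gcongr
        _ = K₁ * u ^ (a - 2) * (u ^ (-h) * ‖f (u, z)‖) := by rw [e1]; ring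
        _ ≤ K₁ * u ^ (a - 2) * (|C| * u ^ δ) := by
          refine mul_le_mul_of_nonneg_left (h2.trans ?_) (by positivity)
          exact mul_le_mul_of_nonneg_right (le_abs_self C) (by positivity)
        _ = _ := by rw [e2]; ring
    rcases le_or_gt u 1 with h2 | h2
    · refine le_trans ?_ (le_add_of_nonneg_right (p3 u))
      refine le_trans ?_ (le_add_of_nonneg_left (p1 u))
      rw [hn₂, indicator_of_mem (show u ∈ Icc η 1 from ⟨h1, h2⟩)]
      have h3 := rpow_le_add_rpow hη0 h1 h2 (a - h - 2)
      have h4 := (hB u ⟨h1, h2⟩ z hz).trans (le_abs_self B)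
      calc _ ≤ (K₁ * u ^ (a - h - 2)) * ‖f (u, z)‖ := by gcongr
        _ ≤ _ := by gcongr
    · refine le_trans ?_ (le_add_of_nonneg_left (add_nonneg (p1 u) (p2 u)))
      rw [hn₃, indicator_of_mem (show u ∈ Ioi 1 from h2)]
      calc _ ≤ (K₂ * u ^ (-h - 2)) * M u :=
            mul_le_mul w2 (hinf u h2 z hz) (norm_nonneg _) (by positivity)
        _ = _ := by ring

theorem coord_mem_rect {e y : ℝ} (he : e ∈ Icc (-ε₀) ε₀) (hy : y ∈ Icc (-u₀) u₀) :
    (z₀ : ℂ) + e + Complex.I * y ∈ rect u₀ z₀ ε₀ := by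
  simpa [rect] using And.intro (abs_le.2 he) (abs_le.2 hy)

theorem controlled_coord {n : ℝ → ℝ} {Ω : Set (ℂ × ℂ)} (hf : ContinuousOn f Ω)
    (hsub : ∀ u : ℝ, 0 < u → ∀ z ∈ rect u₀ z₀ ε₀, ((u : ℂ), z) ∈ Ω)
    (hn : IntegrableOn n (Ioi 0))
    (hle : ∀ u : ℝ, 0 < u → ∀ z ∈ rect u₀ z₀ ε₀, weight a h u₀ u * ‖f (u, z)‖ ≤ n u) :
    Controlled h a u₀ ε₀ n (coord z₀ f) ∧ Controlled h a u₀ ε₀ n (coord z₀ (reflect z₀ f)) := by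
  have hc : ∀ s : ℝ, s = 1 ∨ s = -1 →
      Controlled h a u₀ ε₀ n (fun u e y => coord z₀ f u (s * e) (s * y)) := by
    intro s hs
    have hm : ∀ e ∈ Icc (-ε₀) ε₀, ∀ y ∈ Icc 0 u₀,
        (z₀ : ℂ) + (s * e : ℝ) + Complex.I * (s * y : ℝ) ∈ rect u₀ z₀ ε₀ := by
      intro e he y hy
      refine coord_mem_rect ?_ ?_
      · rcases hs with rfl | rfl <;> constructor <;> linarith [he.1, he.2]
      · rcases hs with rfl | rfl <;> constructor <;> linarith [hy.1, hy.2]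
    refine ⟨?_, hn, fun u hu e he y hy => hle u hu _ (hm e he y hy)⟩
    exact hf.comp (f := fun p : ℝ × ℝ × ℝ => ((p.1 : ℂ), (z₀ : ℂ) + (s * p.2.1 : ℝ) +
      Complex.I * (s * p.2.2 : ℝ))) (by fun_prop)
      fun p hp => hsub p.1 hp.1 _ (hm _ hp.2.1 _ hp.2.2)
  refine ⟨by simpa using hc 1 (Or.inl rfl), ?_⟩
  have := hc (-1) (Or.inr rfl)
  simp only [neg_mul, one_mul] at this
  have e : coord z₀ (reflect z₀ f) = fun u e y => coord z₀ f u (-e) (-y) := by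
    funext u e y; exact coord_reflect u e y
  rwa [e]

end AdS

/-! ### Assembling both halves. -/

namespace AdS

variable {h a u₀ z₀ ε₀ : ℝ} {f : ℂ × ℂ → ℂ}

/-- Integration along a vertical segment that is symmetric about `z₀`. -/
theorem segInt_symmetric {G : ℂ → ℂ} {c : ℝ} (hc : 0 < c)
    (h1 : IntegrableOn (fun t : ℝ => G (z₀ + Complex.I * t)) (Ioo 0 c))
    (h2 : IntegrableOn (fun t : ℝ => G (z₀ + Complex.I * (-t : ℝ))) (Ioo 0 c)) :
    SegIntegrable G (z₀ - Complex.I * c) (z₀ + Complex.I * c) ∧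
    segInt G (z₀ - Complex.I * c) (z₀ + Complex.I * c) =
      Complex.I * ((∫ t in Ioo 0 c, G (z₀ + Complex.I * t)) +
        ∫ t in Ioo 0 c, G (z₀ + Complex.I * (-t : ℝ))) := by
  set φ : ℝ → ℂ := fun t => G (z₀ + Complex.I * t) with hφ
  have i1 : IntervalIntegrable φ volume 0 c :=
    (intervalIntegrable_iff_integrableOn_Ioo_of_le hc.le).2 h1
  have i2 : IntervalIntegrable (fun t => φ (-t)) volume 0 c :=
    (intervalIntegrable_iff_integrableOn_Ioo_of_le hc.le).2 h2
  have i3 : IntervalIntegrable φ volume (-c) 0 := by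
    simpa using (i2.comp_sub_left 0).symm
  have i4 := i3.trans i1
  have hG : ∀ s : ℝ, G ((z₀ - Complex.I * c) + s * ((z₀ + Complex.I * c) - (z₀ - Complex.I * c))) =
      φ (2 * c * s + -c) := fun s => by
    simp only [hφ]; congr 1; push_cast; ring
  refine ⟨?_, ?_⟩
  · rw [SegIntegrable]
    simp only [hG]
    have := (i4.comp_add_right (-c)).comp_mul_left (c := 2 * c)
    have e1 : (-c - -c) / (2 * c) = 0 := by simp
    have e2 : (c - -c) / (2 * c) = 1 := by field_simp; ring
    rwa [e1, e2] at this
  · have := intervalIntegral.smul_integral_comp_mul_add (a := 0) (b := 1) φ (2 * c) (-c)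
    have e1 : 2 * c * 0 + -c = -c := by ring
    have e2 : 2 * c * 1 + -c = c := by ring
    rw [e1, e2, ← intervalIntegral.integral_add_adjacent_intervals i3 i1] at this
    have e3 : ∫ t in (-c)..0, φ t = ∫ t in (0 : ℝ)..c, φ (-t) := by
      rw [intervalIntegral.integral_comp_neg, neg_zero]
    rw [e3, intervalIntegral.integral_of_le hc.le, intervalIntegral.integral_of_le hc.le,
      integral_Ioc_eq_integral_Ioo, integral_Ioc_eq_integral_Ioo, Complex.real_smul] at this
    rw [segInt]
    simp only [hG]
    have e4 : ((z₀ : ℂ) + Complex.I * c) - (z₀ - Complex.I * c) = Complex.I * ((2 * c : ℝ) : ℂ) := by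
      push_cast; ring
    rw [e4, mul_assoc, this, add_comm]

theorem reflect_eq {u t : ℝ} :
    reflect z₀ f ((u : ℂ), z₀ + Complex.I * t) = f (u, z₀ + Complex.I * (-t : ℝ)) := by
  rw [reflect]
  congr 2
  push_cast; ring

theorem contourTerm_neg (ε t u : ℝ) :
    contourTerm h u₀ z₀ f ε (z₀ + Complex.I * (-t : ℝ)) u =
      contourTerm h u₀ z₀ (reflect z₀ f) ε (z₀ + Complex.I * t) u := by
  rw [contourTerm_reflect]
  congr 1
  push_cast; ring

/-- The integrand on the right-hand side. -/
def rhsTerm (h u₀ z₀ : ℝ) (f : ℂ × ℂ → ℂ) (p : ℝ × ℝ) : ℂ :=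
  1 / (p.1 : ℂ) ^ 2 *
    (Gtilde h p.1 (z₀ + Complex.I * p.2) u₀ z₀ * f (p.1, z₀ + Complex.I * p.2))

/-- G̃ depends on y only through y², so reflecting f moves the integrand to the lower half of the
triangle. -/
theorem triTerm_reflect (hh : 0 < h) (hu₀ : 0 < u₀) {u y : ℝ} (hu : 0 < u) (hy : y ∈ Ioo 0 u₀) :
    triTerm h u₀ z₀ (reflect z₀ f) (u, y) = if u < u₀ - y then rhsTerm h u₀ z₀ f (u, -y) else 0 := by
  rw [triTerm, rhsTerm]
  simp only
  split_ifs with hlt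
  · have hy' : |y| < u₀ - u := by rw [abs_of_pos hy.1]; linarith
    have hx : xiInv u₀ u (-y) = xiInv u₀ u y := by simp [xiInv]
    rw [reflect_eq, Gtilde_eq_legendreFn hh z₀ hu₀ hu hy',
      Gtilde_eq_legendreFn hh z₀ hu₀ hu (by rwa [abs_neg]), hx]
  · rfl

theorem integrableOn_triangle (hh : 0 < h) (hu₀ : 0 < u₀)
    (h1 : Integrable (triTerm h u₀ z₀ f)
      ((volume.restrict (Ioi 0)).prod (volume.restrict (Ioo 0 u₀))))
    (h2 : Integrable (triTerm h u₀ z₀ (reflect z₀ f))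
      ((volume.restrict (Ioi 0)).prod (volume.restrict (Ioo 0 u₀)))) :
    IntegrableOn (rhsTerm h u₀ z₀ f) {p : ℝ × ℝ | 0 < p.1 ∧ |p.2| < u₀ - p.1} := by
  have hT : MeasurableSet {p : ℝ × ℝ | p.1 < u₀ - p.2} :=
    measurableSet_lt (by fun_prop) (by fun_prop)
  set Q : Set (ℝ × ℝ) := {p : ℝ × ℝ | p.1 < u₀ - p.2} ∩ (Ioi 0 ×ˢ Ioo 0 u₀) with hQ
  have hQm : MeasurableSet Q := hT.inter (measurableSet_Ioi.prod measurableSet_Ioo)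
  have j : ∀ F : ℝ × ℝ → ℂ, Integrable (fun p : ℝ × ℝ => if p.1 < u₀ - p.2 then F p else 0)
      ((volume.restrict (Ioi 0)).prod (volume.restrict (Ioo 0 u₀))) → IntegrableOn F Q := by
    intro F hF
    rw [Measure.prod_restrict] at hF
    have : Integrable ({p : ℝ × ℝ | p.1 < u₀ - p.2}.indicator F)
        ((volume.prod volume).restrict (Ioi 0 ×ˢ Ioo 0 u₀)) := hF
    rwa [integrable_indicator_iff hT, IntegrableOn, Measure.restrict_restrict hT] at this
  have k1 : IntegrableOn (rhsTerm h u₀ z₀ f) Q := j _ h1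
  have k2 : IntegrableOn (fun p : ℝ × ℝ => rhsTerm h u₀ z₀ f (p.1, -p.2)) Q := by
    refine j _ (h2.congr ?_)
    filter_upwards [ae_prod_mem] with p hp
    exact triTerm_reflect hh hu₀ hp.1 hp.2
  have hmp : MeasurePreserving (fun p : ℝ × ℝ => (p.1, -p.2)) (volume : Measure (ℝ × ℝ)) volume :=
    (MeasurePreserving.id volume).prod (Measure.measurePreserving_neg volume)
  have hinv : (fun p : ℝ × ℝ => (p.1, -p.2)) ∘ (fun p : ℝ × ℝ => (p.1, -p.2)) = id := by
    funext p; simp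
  have hme : MeasurableEmbedding (fun p : ℝ × ℝ => (p.1, -p.2)) :=
    ((MeasurableEquiv.refl ℝ).prodCongr (MeasurableEquiv.neg ℝ)).measurableEmbedding
  have k3 : IntegrableOn (rhsTerm h u₀ z₀ f) ((fun p : ℝ × ℝ => (p.1, -p.2)) ⁻¹' Q) := by
    rw [← hmp.integrableOn_comp_preimage hme, ← preimage_comp, hinv, preimage_id]
    exact k2
  -- The open halves and their common null edge y = 0 cover the triangle.
  have k4 : IntegrableOn (rhsTerm h u₀ z₀ f) {p : ℝ × ℝ | p.2 = 0} := by
    have : volume {p : ℝ × ℝ | p.2 = 0} = 0 := by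
      have : {p : ℝ × ℝ | p.2 = 0} = univ ×ˢ {0} := by ext p; simp
      rw [this, Measure.volume_eq_prod, Measure.prod_prod]; simp
    rw [IntegrableOn, Measure.restrict_eq_zero.2 this]
    exact integrable_zero_measure
  refine ((k1.union k3).union k4).mono_set ?_
  rintro ⟨u, y⟩ ⟨hu, hy⟩
  have hu' : 0 < u := hu
  have hy' := abs_lt.1 hy
  simp only at hy'
  rcases lt_trichotomy y 0 with h0 | h0 | h0
  · exact Or.inl (Or.inr ⟨by simp; linarith, hu, by simp; linarith, by simp; linarith⟩)
  · exact Or.inr h0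
  · exact Or.inl (Or.inl ⟨by simp; linarith, hu, h0, by simp; linarith⟩)

theorem integral_Ioo_ite {c : ℝ} (hc : c ≤ u₀) (F : ℝ → ℂ) (u : ℝ) (hu : u₀ - u = c) :
    ∫ y in Ioo 0 u₀, (if u < u₀ - y then F y else 0) = ∫ y in Ioo 0 c, F y := by
  have : Ioo 0 c = Ioo 0 u₀ ∩ {y | u < u₀ - y} := by
    ext y
    simp only [mem_inter_iff, mem_Ioo, mem_ofPred_eq]
    constructor
    · rintro ⟨h1, h2⟩; exact ⟨⟨h1, by linarith⟩, by linarith⟩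
    · rintro ⟨⟨h1, -⟩, h2⟩; exact ⟨h1, by linarith⟩
  rw [this, ← setIntegral_indicator (measurableSet_lt (by fun_prop) (by fun_prop))]
  rfl

theorem integrableOn_Ioo_ite {c : ℝ} (hc : c ≤ u₀) (F : ℝ → ℂ) (u : ℝ) (hu : u₀ - u = c)
    (hF : IntegrableOn (fun y => if u < u₀ - y then F y else 0) (Ioo 0 u₀)) :
    IntegrableOn F (Ioo 0 c) := by
  refine (hF.mono_set (Ioo_subset_Ioo_right hc)).congr_fun (fun y hy => ?_) measurableSet_Ioo
  exact if_pos (by linarith [hy.2])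

/-- The right-hand side in terms of the two halves of the triangle. -/
theorem integral_segInt_Gtilde (hh : 0 < h) (hu₀ : 0 < u₀)
    (h1 : Integrable (triTerm h u₀ z₀ f)
      ((volume.restrict (Ioi 0)).prod (volume.restrict (Ioo 0 u₀))))
    (h2 : Integrable (triTerm h u₀ z₀ (reflect z₀ f))
      ((volume.restrict (Ioi 0)).prod (volume.restrict (Ioo 0 u₀)))) :
    ∫ u in (0 : ℝ)..u₀, 1 / (u : ℂ) ^ 2 *
        segInt (fun z => Gtilde h u z u₀ z₀ * f (u, z))
          (z₀ - Complex.I * (u₀ - u)) (z₀ + Complex.I * (u₀ - u)) =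
      Complex.I * ((∫ p, triTerm h u₀ z₀ f p
          ∂((volume.restrict (Ioi 0)).prod (volume.restrict (Ioo 0 u₀)))) +
        ∫ p, triTerm h u₀ z₀ (reflect z₀ f) p
          ∂((volume.restrict (Ioi 0)).prod (volume.restrict (Ioo 0 u₀)))) := by
  rw [integral_prod _ h1, integral_prod _ h2,
    ← integral_add h1.integral_prod_left h2.integral_prod_left, ← integral_const_mul,
    intervalIntegral.integral_of_le hu₀.le, integral_Ioc_eq_integral_Ioo]
  have hsub : Ioo 0 u₀ ⊆ Ioi 0 := fun u hu => hu.1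
  -- For u ≥ u₀ and y > 0 the condition u < u₀ - y fails, so integrating over all u > 0 adds
  -- nothing.
  rw [setIntegral_eq_of_subset_of_forall_sdiff_eq_zero (s := Ioo 0 u₀) (t := Ioi 0)
    measurableSet_Ioi hsub]
  · refine setIntegral_congr_ae measurableSet_Ioo ?_
    filter_upwards [(ae_restrict_iff' measurableSet_Ioi).1 h1.prod_right_ae,
      (ae_restrict_iff' measurableSet_Ioi).1 h2.prod_right_ae] with u k1 k2 hu
    have hu0 : 0 < u := hu.1
    have huc : (u : ℂ) ^ 2 ≠ 0 := pow_ne_zero 2 (by exact_mod_cast hu0.ne')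
    have hc : 0 < u₀ - u := by linarith [hu.2]
    have hcu : u₀ - u ≤ u₀ := by linarith
    have l2 : ∀ y ∈ Ioo 0 u₀, triTerm h u₀ z₀ (reflect z₀ f) (u, y) =
        if u < u₀ - y then rhsTerm h u₀ z₀ f (u, -y) else 0 := fun y hy =>
      triTerm_reflect hh hu₀ hu0 hy
    have m1 : IntegrableOn (fun y => rhsTerm h u₀ z₀ f (u, y)) (Ioo 0 (u₀ - u)) :=
      integrableOn_Ioo_ite hcu _ u rfl (k1 hu0)
    have m2 : IntegrableOn (fun y => rhsTerm h u₀ z₀ f (u, -y)) (Ioo 0 (u₀ - u)) :=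
      integrableOn_Ioo_ite hcu (fun y => rhsTerm h u₀ z₀ f (u, -y)) u rfl
        (IntegrableOn.congr_fun (k2 hu0) l2 measurableSet_Ioo)
    have n1 : ∫ y in Ioo 0 u₀, triTerm h u₀ z₀ f (u, y) =
        ∫ y in Ioo 0 (u₀ - u), rhsTerm h u₀ z₀ f (u, y) := integral_Ioo_ite hcu _ u rfl
    have n2 : ∫ y in Ioo 0 u₀, triTerm h u₀ z₀ (reflect z₀ f) (u, y) =
        ∫ y in Ioo 0 (u₀ - u), rhsTerm h u₀ z₀ f (u, -y) := by
      rw [setIntegral_congr_fun measurableSet_Ioo l2]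
      exact integral_Ioo_ite hcu (fun y => rhsTerm h u₀ z₀ f (u, -y)) u rfl
    have hdiv : ∀ y : ℝ, (u : ℂ) ^ 2 * rhsTerm h u₀ z₀ f (u, y) =
        (fun z => Gtilde h u z u₀ z₀ * f (u, z)) (z₀ + Complex.I * y) := fun y => by
      rw [rhsTerm, one_div, mul_inv_cancel_left₀ huc]
    have seg := (segInt_symmetric (G := fun z => Gtilde h u z u₀ z₀ * f (u, z)) (z₀ := z₀) hc
      ((m1.const_mul ((u : ℂ) ^ 2)).congr (Eventually.of_forall fun y => hdiv y))
      ((m2.const_mul ((u : ℂ) ^ 2)).congr (Eventually.of_forall fun y => hdiv (-y)))).2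
    rw [Complex.ofReal_sub] at seg
    rw [seg, n1, n2]
    have r1 : ∫ y in Ioo 0 (u₀ - u), Gtilde h u (z₀ + Complex.I * y) u₀ z₀ *
        f (u, z₀ + Complex.I * y) = (u : ℂ) ^ 2 * ∫ y in Ioo 0 (u₀ - u), rhsTerm h u₀ z₀ f (u, y) := by
      rw [← integral_const_mul]
      exact integral_congr_ae (Eventually.of_forall fun y => (hdiv y).symm)
    have r2 : ∫ y in Ioo 0 (u₀ - u), Gtilde h u (z₀ + Complex.I * (-y : ℝ)) u₀ z₀ *
        f (u, z₀ + Complex.I * (-y : ℝ)) =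
        (u : ℂ) ^ 2 * ∫ y in Ioo 0 (u₀ - u), rhsTerm h u₀ z₀ f (u, -y) := by
      rw [← integral_const_mul]
      exact integral_congr_ae (Eventually.of_forall fun y => (hdiv (-y)).symm)
    rw [r1, r2, ← mul_add, mul_left_comm Complex.I, one_div, inv_mul_cancel_left₀ huc]
  · rintro u ⟨hu, hu'⟩
    have hu0 : 0 < u := hu
    have hle : u₀ ≤ u := by
      by_contra hlt
      exact hu' ⟨hu0, not_le.1 hlt⟩
    have z : ∀ F : ℂ × ℂ → ℂ, ∫ y in Ioo 0 u₀, triTerm h u₀ z₀ F (u, y) = 0 := fun F => by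
      refine setIntegral_eq_zero_of_forall_eq_zero fun y hy => ?_
      rw [triTerm, if_neg]
      simp only
      linarith [hy.1]
    rw [z, z]; simp

end AdS
end

theorem lemma2 (h : ℝ) (hh : 0 < h) (u₀ z₀ : ℝ) (hu₀ : 0 < u₀) (ε₀ : ℝ) (hε₀ : 0 < ε₀)
    (Ω : Set (ℂ × ℂ)) (hΩ : IsOpen Ω) (f : ℂ × ℂ → ℂ) (hf : DifferentiableOn ℂ f Ω)
    (hsub : ∀ u : ℝ, 0 < u → ∀ z ∈ AdS.rect u₀ z₀ ε₀, ((u : ℂ), z) ∈ Ω)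
    -- `u ^ (-h) * f = O(u ^ δ)` at `u → 0`
    (δ : ℝ) (hδ : 0 < δ) (hδ' : 1 - 2 * h < δ) (C : ℝ)
    (hzero : ∀ᶠ u : ℝ in 𝓝[>] 0, ∀ z ∈ AdS.rect u₀ z₀ ε₀, u ^ (-h) * ‖f (u, z)‖ ≤ C * u ^ δ)
    -- convergence of the `u`-integral at infinity
    (M : ℝ → ℝ) (hM : IntegrableOn (fun u : ℝ => u ^ (-h - 2) * M u) (Ioi 1))
    (hinf : ∀ u : ℝ, 1 < u → ∀ z ∈ AdS.rect u₀ z₀ ε₀, ‖f (u, z)‖ ≤ M u) :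
    -- all the integrals on the left converge
    (∀ ε : ℝ, 0 < ε → ε ≤ ε₀ →
      (∀ t : ℝ, |t| < u₀ →
        IntegrableOn (AdS.contourTerm h u₀ z₀ f ε (z₀ + Complex.I * t)) (Ioi 0)) ∧
      AdS.SegIntegrable (fun w => ∫ u in Ioi (0 : ℝ), AdS.contourTerm h u₀ z₀ f ε w u)
        (z₀ - Complex.I * u₀) (z₀ + Complex.I * u₀)) ∧
    -- the integral on the right converges
    IntegrableOn (fun p : ℝ × ℝ => 1 / (p.1 : ℂ) ^ 2 *
        (AdS.Gtilde h p.1 (z₀ + Complex.I * p.2) u₀ z₀ * f (p.1, z₀ + Complex.I * p.2)))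
      {p : ℝ × ℝ | 0 < p.1 ∧ |p.2| < u₀ - p.1} ∧
    Tendsto
      (fun ε : ℝ => AdS.segInt
        (fun w => ∫ u in Ioi (0 : ℝ), AdS.contourTerm h u₀ z₀ f ε w u)
        (z₀ - Complex.I * u₀) (z₀ + Complex.I * u₀))
      (𝓝[>] 0)
      (𝓝 (Real.pi * ∫ u in (0 : ℝ)..u₀, 1 / (u : ℂ) ^ 2 *
        AdS.segInt (fun z => AdS.Gtilde h u z u₀ z₀ * f (u, z))
          (z₀ - Complex.I * (u₀ - u)) (z₀ + Complex.I * (u₀ - u)))) := by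
  obtain ⟨a, n, ha, ha1, hah, hn, hle⟩ :=
    AdS.exists_dominating hh hu₀ hε₀ hf.continuousOn hsub hδ hδ' hzero hM hinf
  obtain ⟨H₁, H₂⟩ := AdS.controlled_coord hf.continuousOn hsub hn hle
  obtain ⟨i₁, t₁⟩ := H₁.tendsto_integral_contourTerm hh ha ha1 hah hu₀ hε₀
  obtain ⟨i₂, t₂⟩ := H₂.tendsto_integral_contourTerm hh ha ha1 hah hu₀ hε₀
  -- The outer segment is cut at z₀: the upper half is governed by f, the lower half by its
  -- reflection.
  have hseg : ∀ ε : ℝ, 0 < ε → ε ≤ ε₀ → _ := fun ε hε hε' =>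
    AdS.segInt_symmetric (z₀ := z₀)
      (G := fun w => ∫ u in Ioi (0 : ℝ), AdS.contourTerm h u₀ z₀ f ε w u) hu₀
      (H₁.integrableOn_integral_contourTerm hh ha ha1 hah hu₀ hε hε').1 (by
        simp only [AdS.contourTerm_neg]
        exact (H₂.integrableOn_integral_contourTerm hh ha ha1 hah hu₀ hε hε').1)
  refine ⟨fun ε hε hε' => ⟨fun t ht => ?_, (hseg ε hε hε').1⟩,
    AdS.integrableOn_triangle hh hu₀ i₁ i₂, ?_⟩
  · rcases le_total 0 t with h0 | h0
    · exact (H₁.integrableOn_contourTerm hh ha ha1 hah hu₀ hε hε'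
        ⟨h0, (le_abs_self t).trans_lt ht⟩).1
    · have := (H₂.integrableOn_contourTerm hh ha ha1 hah hu₀ hε hε' (t := -t)
        ⟨by linarith, (neg_le_abs t).trans_lt ht⟩).1
      have e : AdS.contourTerm h u₀ z₀ (AdS.reflect z₀ f) ε (z₀ + Complex.I * (-t : ℝ)) =
          AdS.contourTerm h u₀ z₀ f ε (z₀ + Complex.I * t) := by
        ext u
        rw [← AdS.contourTerm_neg, neg_neg]
      rwa [e] at this
  · rw [AdS.integral_segInt_Gtilde hh hu₀ i₁ i₂]
    have t := (t₁.add t₂).const_mul Complex.I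
    rw [← mul_add, mul_left_comm] at t
    refine t.congr' ?_
    filter_upwards [Ioo_mem_nhdsGT hε₀] with ε hε
    rw [(hseg ε hε.1 hε.2.le).2]
    simp only [AdS.contourTerm_neg]
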